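/- Let $X$ be a second countable, locally connected, paracompact Hausdorff space. An orbispace chart for $X$ is a triple $(\tilde U,G,\varrho)$ of a finite dimensional smooth manifold $\tilde U$ (Hausdorff, second countable), a compact Lie group $G$ acting smoothly on $\tilde U$, and a $G$-invariant continuous map $\varrho:\tilde U\to X$ inducing a homeomorphism of $\tilde U/G$ onto an open subset $U\subset X$. A morphism $(\tilde V,H,\upsilon)\to(\tilde U,G,\varrho)$ is a pair $(\varphi,\iota)$ of a smooth map $\varphi:\tilde V\to\tilde U$ and a continuous homomorphism $\iota:H\to G$ with $\varphi(hy)=\iota(h)\varphi(y)$ and $\varrho\circ\varphi=\upsilon$; it is an open embedding if $\varphi$ is a smooth open embedding and the induced map $\tilde V/H\to\tilde U/G$ is a homeomorphism onto an open subset. Let $X$ be an orbispace: there is given an open covering $\mathcal U$ of $X$ and a functor from the category of connected components of finite intersections of members of $\mathcal U$ (with inclusions as morphisms) to orbispace charts of $X$, such that the chart assigned to $U$ has image $U$ and connected domain and all morphisms are sent to open embeddings. Let $X$ be symplectic: the domains of these charts carry $G$-invariant symplectic forms $\omega_{\tilde U}$ with $\varphi^*\omega_{\tilde U}=\omega_{\tilde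 V}$ for all morphisms $(\varphi,\iota)$ of the functor. For a chart and a subgroup $H\subset G$ let $\tilde U_H$ be the set of points with isotropy group equal to $H$ and $\tilde U_{(H)}$ the set of points with isotropy group conjugate to $H$. The canonical stratification of $X$ assigns to $x\in X$ the set germ at $x$ of $\varrho(\tilde U_{(G_y)})$, where $(\tilde U,G,\varrho)$ is a chart around $x$ and $\varrho(y)=x$. The dimension of this germ is that of the space of $G_y$-fixed vectors in $T_y\tilde U/T_y(Gy)$. A $d$-dimensional stratum is a nonempty set $S\subset X$ whose germ at each of its points is the canonical one and has dimension $d$; this includes all pieces of any decomposition of $X$ inducing the canonical stratification, in particular of the coarsest one. **Proposition.** (1) For every chart $(\tilde U,G,\varrho)$ of the functor and every subgroup $H\subset G$, $\tilde U_H$ is an embedded submanifold of $\tilde U$ (possibly with components of different dimensions), and $\omega_{\tilde U}$ restricts to a symplectic form on it. (2) Every $d$-dimensional stratum $S$, with the induced topology, has a unique structure of a smooth $d$-manifold such that all projections $\pi_H:\tilde U_H\cap\varrho^{-1}(S)\to S$ (restrictions of $\varrho$) are smooth submersions, and there is a unique Poisson bracket $\{\cdot,\cdot\}_S$ on $C^\infty(S)$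 such that $$\{f,g\}_S\circ\pi_H=\{f\circ\pi_H,\;g\circ\pi_H\}_{\tilde U_H}\qquad(f,g\in C^\infty(S))$$ for all charts of the functor and all $H$, where the bracket on the right is that of the symplectic form $\omega_{\tilde U}|_{\tilde U_H}$. (3) If $X$ is an orbifold, i.e. the groups $G$ of all charts of the functor are finite, then the strata are symplectic: on every stratum $S$ there is a unique symplectic form $\sigma$ with $\pi_H^*\sigma=\omega_{\tilde U}|_{\tilde U_H}$ for all charts and all $H$ and whose Poisson bracket is $\{\cdot,\cdot\}_S$. -/

import Mathlib

open Set Filter Topology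
open scoped Manifold ContDiff

universe u v w

noncomputable section

set_option linter.checkUnivs false

/-- Euclidean space of dimension `n`. -/
abbrev Euc (n : ℕ) : Type := EuclideanSpace ℝ (Fin n)

/-! ### Symplectic forms and Poisson brackets on manifolds -/

/-- A (not necessarily smooth) differential 2-form on an `n`-dimensional manifold. -/
abbrev TwoForm (n : ℕ) (M : Type*) [TopologicalSpace M] [ChartedSpace (Euc n) M] :=
  ∀ x : M, TangentSpace (𝓡 n) x [⋀^Fin 2]→L[ℝ] ℝ

/-- The pullback `i^* Ω` of a 2-form. -/
def TwoForm.pullback {m n : ℕ} {N M : Type*}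
    [TopologicalSpace N] [ChartedSpace (Euc m) N] [TopologicalSpace M] [ChartedSpace (Euc n) M]
    (i : N → M) (Ω : TwoForm n M) : TwoForm m N :=
  fun z => (Ω (i z)).compContinuousLinearMap (mfderiv (𝓡 m) (𝓡 n) i z)

/-- `η` is a symplectic form on the open subset `O` of `ℝⁿ`: it is smooth, closed and
nondegenerate there. -/
structure IsSymplecticOn {n : ℕ} (η : Euc n → Euc n [⋀^Fin 2]→L[ℝ] ℝ) (O : Set (Euc n)) :
    Prop where
  smooth : ContDiffOn ℝ ∞ η O
  closed : ∀ z ∈ O, extDeriv η z = 0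
  nondegenerate : ∀ z ∈ O, ∀ v, (∀ v', η z ![v, v'] = 0) → v = 0

/-- `Ω` is a symplectic form on the manifold `M`: its expression in every chart of the atlas
is symplectic. -/
def IsSymplecticForm {n : ℕ} {M : Type*} [TopologicalSpace M] [ChartedSpace (Euc n) M]
    (Ω : TwoForm n M) : Prop :=
  ∀ e ∈ atlas (Euc n) M, IsSymplecticOn (TwoForm.pullback (m := n) e.symm Ω) e.target

/-- `r` is the value at the point `x` of the Poisson bracket of `f` and `g` belonging to the
2-form `η`, that is, `r = η (X_f, X_g)` with Hamiltonian vectors given by `η (X_f, ·) = df` and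
`η (X_g, ·) = dg`. (For nondegenerate `η` there is exactly one such number.) -/
def IsBracketValue {n : ℕ} {M : Type*} [TopologicalSpace M] [ChartedSpace (Euc n) M]
    (η : TwoForm n M) (f g : M → ℝ) (x : M) (r : ℝ) : Prop :=
  ∃ Xf Xg : TangentSpace (𝓡 n) x,
    (∀ t, η x ![Xf, t] = (mfderiv (𝓡 n) 𝓘(ℝ, ℝ) f x t : ℝ)) ∧
    (∀ t, η x ![Xg, t] = (mfderiv (𝓡 n) 𝓘(ℝ, ℝ) g x t : ℝ)) ∧
    r = η x ![Xf, Xg]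

/-- A Poisson structure on the manifold `N`: a Poisson bracket on its algebra of smooth
functions. -/
@[ext]
structure PoissonStructure (n : ℕ) (N : Type*) [TopologicalSpace N] [ChartedSpace (Euc n) N] where
  bracket : C^∞⟮𝓡 n, N; 𝓘(ℝ, ℝ), ℝ⟯ →ₗ[ℝ] C^∞⟮𝓡 n, N; 𝓘(ℝ, ℝ), ℝ⟯ →ₗ[ℝ] C^∞⟮𝓡 n, N; 𝓘(ℝ, ℝ), ℝ⟯
  antisymm : ∀ f g, bracket f g = -bracket g f
  leibniz : ∀ f g h, bracket f (g * h) = bracket f g * h + g * bracket f h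
  jacobi : ∀ f g h,
    bracket f (bracket g h) + bracket g (bracket h f) + bracket h (bracket f g) = 0

/-- `i`, restricted to the open set `O ⊆ ℝᵏ`, is a local parametrization of the subset `A` of the
manifold `M`: a smooth embedding of `O` into `M` whose image is an open subset of `A`. -/
structure IsLocalParametrization (n : ℕ) {k : ℕ} {M : Type*} [TopologicalSpace M]
    [ChartedSpace (Euc n) M] (A : Set M) (O : Set (Euc k)) (i : Euc k → M) : Prop where
  isOpen : IsOpen O
  smooth : ContMDiffOn (𝓡 k) (𝓡 n) ∞ i O
  immersive : ∀ z ∈ O, Function.Injective (mfderiv (𝓡 k) (𝓡 n) i z)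
  embedding : IsEmbedding (O.domRestrict i)
  open_image : ∃ V : Set M, IsOpen V ∧ i '' O = A ∩ V

/-- `A` is an embedded submanifold of `M`. Different connected components of `A` may have
different dimensions. -/
def IsEmbeddedSubmanifold (n : ℕ) {M : Type*} [TopologicalSpace M] [ChartedSpace (Euc n) M]
    (A : Set M) : Prop :=
  ∀ x ∈ A, ∃ (k : ℕ) (O : Set (Euc k)) (i : Euc k → M),
    IsLocalParametrization n A O i ∧ x ∈ i '' O

/-- The 2-form `Ω` on `M` restricts to a symplectic form on the embedded submanifold `A`. -/
def RestrictsToSymplectic {n : ℕ} {M : Type*} [TopologicalSpace M] [ChartedSpace (Euc n) M]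
    (Ω : TwoForm n M) (A : Set M) : Prop :=
  ∀ (k : ℕ) (O : Set (Euc k)) (i : Euc k → M), IsLocalParametrization n A O i →
    IsSymplecticOn (TwoForm.pullback (m := k) i Ω) O

/-! ### Orbispace charts -/

/-- A finite dimensional orbispace chart `(dom, grp, proj)` for `X`: a smooth manifold `dom`
with a smooth action of a compact Lie group `grp`, and an invariant map `proj : dom → X`
which induces a homeomorphism of `dom / grp` onto an open subset of `X`. -/
structure OrbispaceChart (X : Type u) [TopologicalSpace X] where
  dim : ℕ
  dom : Type v
  [topDom : TopologicalSpace dom]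
  [t2Dom : T2Space dom]
  [secondCountableDom : SecondCountableTopology dom]
  [chartedDom : ChartedSpace (Euc dim) dom]
  [manifoldDom : IsManifold (𝓡 dim) ∞ dom]
  gdim : ℕ
  grp : Type w
  [groupGrp : Group grp]
  [topGrp : TopologicalSpace grp]
  [t2Grp : T2Space grp]
  [compactGrp : CompactSpace grp]
  [chartedGrp : ChartedSpace (Euc gdim) grp]
  [lieGrp : LieGroup (𝓡 gdim) ∞ grp]
  [action : MulAction grp dom]
  [smoothAction : ContMDiffSMul (𝓡 gdim) (𝓡 dim) ∞ grp dom]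
  proj : dom → X
  proj_smul : ∀ (g : grp) (y : dom), proj (g • y) = proj y
  isOpenEmbedding : IsOpenEmbedding
    (Quotient.lift proj (by rintro _ y ⟨g, rfl⟩; exact proj_smul g y) :
      MulAction.orbitRel.Quotient grp dom → X)

namespace OrbispaceChart

attribute [instance] topDom t2Dom secondCountableDom chartedDom manifoldDom groupGrp topGrp t2Grp
  compactGrp chartedGrp lieGrp action smoothAction

variable {X : Type u} [TopologicalSpace X]

/-- A morphism of orbispace charts: an equivariant smooth map over the identity of `X`. -/
structure Hom (D C : OrbispaceChart.{u, v, w} X) where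
  toFun : D.dom → C.dom
  smooth : ContMDiff (𝓡 D.dim) (𝓡 C.dim) ∞ toFun
  hom : D.grp →* C.grp
  continuous_hom : Continuous hom
  equivariant : ∀ (h : D.grp) (y : D.dom), toFun (h • y) = hom h • toFun y
  proj_comp : ∀ y, C.proj (toFun y) = D.proj y

/-- The map induced by a morphism between the orbit spaces. -/
def Hom.orbitMap {D C : OrbispaceChart.{u, v, w} X} (φ : Hom D C) :
    MulAction.orbitRel.Quotient D.grp D.dom → MulAction.orbitRel.Quotient C.grp C.dom :=
  Quotient.map φ.toFun (by
    rintro _ y ⟨h, rfl⟩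
    exact ⟨φ.hom h, (φ.equivariant h y).symm⟩)

/-- A morphism is an open embedding if it is a smooth embedding and an open map, and if it induces
a homeomorphism of the orbit spaces onto an open subset. -/
structure Hom.IsOpenEmb {D C : OrbispaceChart.{u, v, w} X} (φ : Hom D C) : Prop where
  smoothEmbedding : Manifold.IsSmoothEmbedding (𝓡 D.dim) (𝓡 C.dim) ∞ φ.toFun
  isOpenMap : IsOpenMap φ.toFun
  orbitMap : IsOpenEmbedding φ.orbitMap

variable (C : OrbispaceChart.{u, v, w} X)

/-- `M_H`: the points of the domain with isotropy group equal to `H`. -/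
def isotropySet (H : Subgroup C.grp) : Set C.dom :=
  {y | MulAction.stabilizer C.grp y = H}

/-- `M_(H)`: the points of the domain with isotropy group conjugate to `H`. -/
def orbitTypeSet (H : Subgroup C.grp) : Set C.dom :=
  {y | ∃ g : C.grp, MulAction.stabilizer C.grp y = H.map (MulAut.conj g).toMonoidHom}

/-- The tangent space at `y` of the orbit through `y`. -/
def orbitTangent (y : C.dom) : Submodule ℝ (Euc C.dim) :=
  LinearMap.range
    (mfderiv (𝓡 C.gdim) (𝓡 C.dim) (fun g : C.grp => g • y) 1 :
      Euc C.gdim →L[ℝ] Euc C.dim).toLinearMap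

/-- The tangent vectors at `y` whose classes in `T_y M / T_y (G y)` (the slice representation of
the isotropy group of `y`) are fixed by the isotropy group. -/
def sliceFixed (y : C.dom) : Submodule ℝ (Euc C.dim) :=
  ⨅ h : MulAction.stabilizer C.grp y, (C.orbitTangent y).comap
    ((mfderiv (𝓡 C.dim) (𝓡 C.dim) (fun y' : C.dom => (h : C.grp) • y') y :
      Euc C.dim →L[ℝ] Euc C.dim).toLinearMap - LinearMap.id)

/-- The germ at `proj y` of the stratum of `dom / grp` by orbit types has dimension `d`: the space
of fixed vectors of the slice representation at `y` has dimension `d`. -/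
def HasStratumDim (y : C.dom) (d : ℕ) : Prop :=
  Module.finrank ℝ (C.sliceFixed y) = d + Module.finrank ℝ (C.orbitTangent y)

end OrbispaceChart

/-! ### Orbispaces -/

/-- The objects of the category generated by a covering: connected components of finite
intersections of members of the covering. -/
def IsCoverComponent {X : Type u} [TopologicalSpace X] (cover : Set (Set X)) (U : Set X) : Prop :=
  ∃ F : Set (Set X), F.Finite ∧ F.Nonempty ∧ F ⊆ cover ∧
    ∃ x ∈ ⋂₀ F, U = connectedComponentIn (⋂₀ F) x

/-- A (finite dimensional) orbispace structure on `X`: an open covering and an orbispace functor,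
that is, a functor from the category of connected components of finite intersections (with
the inclusions as morphisms) to the category of orbispace charts, such that the chart of `U` has
image `U` and connected domain, and such that the morphisms are open embeddings. -/
structure Orbispace (X : Type u) [TopologicalSpace X] where
  cover : Set (Set X)
  isOpen_cover : ∀ U ∈ cover, IsOpen U
  sUnion_cover : ⋃₀ cover = univ
  chart : {U : Set X // IsCoverComponent cover U} → OrbispaceChart.{u, v, w} X
  range_proj : ∀ U, range (chart U).proj = U
  connected : ∀ U, ConnectedSpace (chart U).dom
  map : ∀ {V U : {U : Set X // IsCoverComponent cover U}}, V.1 ⊆ U.1 → (chart V).Hom (chart U)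
  map_isOpenEmb : ∀ {V U : {U : Set X // IsCoverComponent cover U}} (h : V.1 ⊆ U.1),
    (map h).IsOpenEmb
  map_id : ∀ U : {U : Set X // IsCoverComponent cover U},
    (map (subset_refl U.1)).toFun = id ∧ (map (subset_refl U.1)).hom = MonoidHom.id _
  map_comp : ∀ {W V U : {U : Set X // IsCoverComponent cover U}} (h : W.1 ⊆ V.1) (h' : V.1 ⊆ U.1),
    (map (h.trans h')).toFun = (map h').toFun ∘ (map h).toFun ∧
    (map (h.trans h')).hom = (map h').hom.comp (map h).hom

namespace Orbispace

variable {X : Type u} [TopologicalSpace X] (𝒳 : Orbispace.{u, v, w} X)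

/-- The index type of the charts of an orbispace. -/
abbrev Obj : Type u := {U : Set X // IsCoverComponent 𝒳.cover U}

/-- An orbispace is an orbifold if the symmetry groups of its charts are finite. -/
def IsOrbifold : Prop := ∀ U : 𝒳.Obj, Finite (𝒳.chart U).grp

/-- A symplectic form on an orbispace: a family of invariant symplectic forms on the domains of
the charts which is compatible with the morphisms of charts. -/
structure SymplecticForm where
  form : ∀ U : 𝒳.Obj, TwoForm (𝒳.chart U).dim (𝒳.chart U).dom
  symplectic : ∀ U, IsSymplecticForm (form U)
  invariant : ∀ (U) (g : (𝒳.chart U).grp),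
    TwoForm.pullback (fun y : (𝒳.chart U).dom => g • y) (form U) = form U
  compatible : ∀ {V U : 𝒳.Obj} (h : V.1 ⊆ U.1),
    TwoForm.pullback (𝒳.map h).toFun (form U) = form V

/-- `S` is a `d`-dimensional stratum of the canonical stratification: a nonempty
set such that at each of its points `x` the set germ of `S` is the canonical one, namely the germ
of the image of `M_(H)`, with `H` the isotropy group of a point `y` over `x` in a chart around `x`,
and has dimension `d`. All pieces of all decompositions of `X` that induce the canonical
stratification by orbit types (for example the pieces of the coarsest such decomposition, or their
connected components) are of this form. -/
def IsStratum (S : Set X) (d : ℕ) : Prop :=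
  S.Nonempty ∧ ∀ x ∈ S, ∃ (U : 𝒳.Obj) (y : (𝒳.chart U).dom), (𝒳.chart U).proj y = x ∧
    S =ᶠ[𝓝 x] (𝒳.chart U).proj ''
      (𝒳.chart U).orbitTypeSet (MulAction.stabilizer (𝒳.chart U).grp y) ∧
    (𝒳.chart U).HasStratumDim y d

/-- The data of a local parametrization `i : O → M_H` of an isotropy submanifold of a chart
with image over `S`, and the restricted projection `q = proj ∘ i : O → S`. -/
structure ParametrizedProjection (S : Set X) where
  U : 𝒳.Obj
  H : Subgroup (𝒳.chart U).grp
  k : ℕ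
  O : Set (Euc k)
  i : Euc k → (𝒳.chart U).dom
  isLocalParametrization : IsLocalParametrization (𝒳.chart U).dim ((𝒳.chart U).isotropySet H) O i
  q : Euc k → S
  q_eq : ∀ z ∈ O, (q z : X) = (𝒳.chart U).proj (i z)

variable {𝒳}

/-- The canonical projections `M_H ∩ proj⁻¹ S → S` are smooth submersions. -/
def ProjectionsAreSubmersions (𝒳 : Orbispace.{u, v, w} X) (S : Set X) (d : ℕ)
    [ChartedSpace (Euc d) S] : Prop :=
  ∀ P : 𝒳.ParametrizedProjection S,
    ContMDiffOn (𝓡 P.k) (𝓡 d) ∞ P.q P.O ∧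
    ∀ z ∈ P.O, Function.Surjective (mfderiv (𝓡 P.k) (𝓡 d) P.q z)

namespace SymplecticForm

variable (Ω : 𝒳.SymplecticForm)

/-- The Poisson structure `B` on the stratum `S` is induced by the symplectic structures of the
`M_H`: `{f, g} ∘ π = {f ∘ π, g ∘ π}` on `M_H` for the canonical projections
`π : M_H ∩ proj⁻¹ S → S`, where the bracket on the right is that of the restriction of the
symplectic form to `M_H`. -/
def InducesPoisson (S : Set X) (d : ℕ) [ChartedSpace (Euc d) S] (B : PoissonStructure d S) : Prop :=
  ∀ (P : 𝒳.ParametrizedProjection S) (f g : C^∞⟮𝓡 d, S; 𝓘(ℝ, ℝ), ℝ⟯), ∀ z ∈ P.O,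
    IsBracketValue (TwoForm.pullback (m := P.k) P.i (Ω.form P.U)) (f ∘ P.q) (g ∘ P.q) z
      (B.bracket f g (P.q z))

/-- The 2-form `σ` on the stratum `S` pulls back under the canonical projections
`M_H ∩ proj⁻¹ S → S` to the restriction of the symplectic form to `M_H`. -/
def InducesForm (S : Set X) (d : ℕ) [ChartedSpace (Euc d) S] (σ : TwoForm d S) : Prop :=
  ∀ P : 𝒳.ParametrizedProjection S, ∀ z ∈ P.O,
    TwoForm.pullback (m := P.k) P.q σ z = TwoForm.pullback (m := P.k) P.i (Ω.form P.U) z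

end SymplecticForm

end Orbispace

end

noncomputable section

set_option linter.unusedSectionVars false

/-! ### Smooth analysis in finite dimensional spaces -/

section Calculus

variable {E F : Type*} [NormedAddCommGroup E] [NormedSpace ℝ E]
  [NormedAddCommGroup F] [NormedSpace ℝ F]

/-! Locally everything rests on the slice theorem for compact groups. Averaging over the isotropy
group `K` of a point `y` gives coordinates in which `K` acts linearly (`nonempty_linearization`). An
invariant complement `N` of the tangent space of the orbit then yields a slice (`exists_slice`):
every point near `y` is a group translate of a point of a small open piece of `N`, and a group
element carrying one point of this piece to another lies in `K`.

Consequently isotropy groups near `y` are subconjugate to `K`. A closed subgroup of a compact group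
contains no proper conjugate of itself, so near `y` the set of points with isotropy group exactly
`K` is the linear space of `K`-fixed vectors. Hence `M_H` is a submanifold whose tangent spaces are
the spaces of fixed vectors. If `a` is fixed, then ω(a, v) = ω(a, Av), where `A` averages over the
isotropy group; so ω remains nondegenerate on fixed vectors.

Near `y` the stratum is the injective image of the `K`-fixed part of the slice. This yields a
coordinate map `s` and a section `j` (`nonempty_stratumChart`). Points over the same point of `X` in
different charts are related by local symplectomorphisms over `X`, composed of group elements, chart
morphisms and their inverses (`exists_isTransfer`), so these coordinates are smoothly compatible.
Averaging a lift of a tangent vector makes it tangent to `M_H`; therefore the projections are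
submersions. They have smooth local sections, so smoothness on the stratum can be tested after
composition with them, which gives uniqueness of the smooth structure.

The brackets computed on the various `M_H` must agree over a common point. A transfer map is not
shown to carry isotropy submanifolds to isotropy submanifolds, and this is not needed: by averaging,
the Hamiltonian vector of `f ∘ π` computes the derivative of `f` along every smooth lift of a map to
the stratum (`fderiv_comp_lift`). Two applications, together with invariance of ω under transfer,
prove independence (`poissonBracket_eq_of_q_eq`). Smoothness and the Poisson identities then descend
from the `M_H`.

For finite groups the slice is a full neighbourhood and `j` parametrizes `M_H` itself, so the
restricted symplectic forms descend as well. -/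

theorem ContDiffOn.hasFDerivAt_of_isOpen {f : E → F} {U : Set E} (hf : ContDiffOn ℝ ∞ f U)
    (hU : IsOpen U) {a : E} (ha : a ∈ U) : HasFDerivAt f (fderiv ℝ f a) a :=
  ((hf.contDiffAt (hU.mem_nhds ha)).differentiableAt (by simp)).hasFDerivAt

variable [FiniteDimensional ℝ E] [FiniteDimensional ℝ F]

/-- The inverse function theorem for smooth maps on open sets. -/
theorem ContDiffOn.exists_openPartialHomeomorph {f : E → F} {U : Set E} (hU : IsOpen U)
    (hf : ContDiffOn ℝ ∞ f U) {a : E} (ha : a ∈ U) {f' : E ≃L[ℝ] F}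
    (hf' : HasFDerivAt f (f' : E →L[ℝ] F) a) :
    ∃ h : OpenPartialHomeomorph E F, (h : E → F) = f ∧ a ∈ h.source ∧ h.source ⊆ U ∧
      ContDiffOn ℝ ∞ h.symm h.target := by
  have hfa : ContDiffAt ℝ ∞ f a := hf.contDiffAt (hU.mem_nhds ha)
  set h₀ := hfa.toOpenPartialHomeomorph f hf' (by simp) with h₀_def
  have hcoe : (h₀ : E → F) = f := rfl
  -- Shrinking to the open set where the derivative is invertible makes the inverse smooth on the
  -- whole target, not only at the image of `a`.
  set V : Set E := U ∩ fderiv ℝ f ⁻¹' range ((↑) : (E ≃L[ℝ] F) → E →L[ℝ] F)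
  have hV : IsOpen V :=
    (hf.continuousOn_fderiv_of_isOpen hU (by simp)).isOpen_inter_preimage hU
      ContinuousLinearEquiv.isOpen
  refine ⟨h₀.restrOpen V hV, hcoe, ⟨hfa.mem_toOpenPartialHomeomorph_source hf' (by simp), ha, f',
    hf'.fderiv.symm⟩, fun z hz => hz.2.1, ?_⟩
  intro b hb
  refine ContDiffAt.contDiffWithinAt ?_
  have hs := (h₀.restrOpen V hV).map_target hb
  obtain ⟨e, he⟩ := hs.2.2
  refine OpenPartialHomeomorph.contDiffAt_symm _ (f₀' := e) hb ?_ ?_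
  · rw [he]
    exact hf.hasFDerivAt_of_isOpen hU hs.2.1
  · exact hf.contDiffAt (hU.mem_nhds hs.2.1)

/-- A smooth immersion has a local smooth left inverse. -/
theorem ContDiffOn.exists_left_inverse {f : E → F} {U : Set E} (hU : IsOpen U)
    (hf : ContDiffOn ℝ ∞ f U) {a : E} (ha : a ∈ U)
    (hinj : Function.Injective (fderiv ℝ f a)) :
    ∃ (r : F → E) (V : Set F), IsOpen V ∧ f a ∈ V ∧ ContDiffOn ℝ ∞ r V ∧
      ∀ᶠ z in 𝓝 a, r (f z) = z := by
  obtain ⟨l, hl⟩ := (fderiv ℝ f a).toLinearMap.exists_leftInverse_of_injective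
    (LinearMap.ker_eq_bot.2 hinj)
  set L : F →L[ℝ] E := l.toContinuousLinearMap
  have hLf : ∀ v, L (fderiv ℝ f a v) = v := fun v => LinearMap.congr_fun hl v
  have hd : HasFDerivAt (fun z => L (f z)) ((ContinuousLinearEquiv.refl ℝ E : E ≃L[ℝ] E) :
      E →L[ℝ] E) a := by
    exact (L.hasFDerivAt.comp a (hf.hasFDerivAt_of_isOpen hU ha)).congr_fderiv
      (ContinuousLinearMap.ext hLf)
  obtain ⟨h, hh, has, -, hsm⟩ := ContDiffOn.exists_openPartialHomeomorph hU
    (L.contDiff.comp_contDiffOn hf) ha hd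
  have hh' : ∀ z, h z = L (f z) := fun z => congrFun hh z
  refine ⟨fun b => h.symm (L b), L ⁻¹' h.target, h.open_target.preimage L.continuous, ?_,
    hsm.comp L.contDiff.contDiffOn fun b hb => hb, ?_⟩
  · have := h.map_source has
    rwa [hh'] at this
  · filter_upwards [h.open_source.mem_nhds has] with z hz
    rw [← hh', h.left_inv hz]

/-- A smooth submersion has a local smooth right inverse. -/
theorem ContDiffOn.exists_right_inverse {f : E → F} {U : Set E} (hU : IsOpen U)
    (hf : ContDiffOn ℝ ∞ f U) {a : E} (ha : a ∈ U)
    (hsurj : Function.Surjective (fderiv ℝ f a)) :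
    ∃ (r : F → E) (V : Set F), IsOpen V ∧ f a ∈ V ∧ ContDiffOn ℝ ∞ r V ∧ r (f a) = a ∧
      ∀ b ∈ V, r b ∈ U ∧ f (r b) = b := by
  obtain ⟨l, hl⟩ := (fderiv ℝ f a).toLinearMap.exists_rightInverse_of_surjective
    (LinearMap.range_eq_top.2 hsurj)
  set L : F →L[ℝ] E := l.toContinuousLinearMap
  have hLf : ∀ v, fderiv ℝ f a (L v) = v := fun v => LinearMap.congr_fun hl v
  -- An affine map through `a` along a linear section of the derivative: `f ∘ m` has identity
  -- derivative at `f a`, so `m` composed with its local inverse is a section of `f`.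
  set m : F → E := fun b => a + L (b - f a) with hm
  have hmc : ContDiff ℝ ∞ m := by fun_prop
  have hma : m (f a) = a := by simp [hm]
  have hmd : HasFDerivAt m L (f a) := by
    have := L.hasFDerivAt.comp (f a) ((hasFDerivAt_id (f a)).sub_const (f a))
    exact this.const_add a
  have hd : HasFDerivAt (fun b => f (m b)) ((ContinuousLinearEquiv.refl ℝ F : F ≃L[ℝ] F) :
      F →L[ℝ] F) (f a) := by
    have h1 : HasFDerivAt f (fderiv ℝ f a) (m (f a)) := by
      rw [hma]; exact hf.hasFDerivAt_of_isOpen hU ha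
    exact (h1.comp (f a) hmd).congr_fderiv (ContinuousLinearMap.ext hLf)
  obtain ⟨h, hh, has, hsU, hsm⟩ := ContDiffOn.exists_openPartialHomeomorph
    (hU.preimage hmc.continuous) (hf.comp hmc.contDiffOn fun b hb => hb)
    (show f a ∈ m ⁻¹' U by simpa [hma] using ha) hd
  have hh' : ∀ z, h z = f (m z) := fun z => congrFun hh z
  have hfa : h (f a) = f a := by rw [hh', hma]
  refine ⟨fun b => m (h.symm b), h.target, h.open_target, ?_, hmc.comp_contDiffOn hsm, ?_, ?_⟩
  · rw [← hfa]; exact h.map_source has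
  · have : h.symm (f a) = f a := by
      conv_lhs => rw [← hfa]
      exact h.left_inv has
    simp only [this, hma]
  · intro b hb
    exact ⟨hsU (h.map_target hb), by rw [← hh', h.right_inv hb]⟩

/-- If the rank of the derivative of `f` is nowhere greater than at `a`, then near `a` the map `f`
takes no other values than on a complement of the kernel of the derivative at `a`. -/
theorem ContDiffOn.exists_mem_compl_ker {f : E → F} {U : Set E} (hU : IsOpen U)
    (hf : ContDiffOn ℝ ∞ f U) {a : E} (ha : a ∈ U)
    (hrank : ∀ x ∈ U, Module.finrank ℝ (LinearMap.range (fderiv ℝ f x).toLinearMap) ≤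
      Module.finrank ℝ (LinearMap.range (fderiv ℝ f a).toLinearMap))
    {R : Submodule ℝ E} (hR : IsCompl R (LinearMap.ker (fderiv ℝ f a).toLinearMap))
    {N : Set E} (hN : N ∈ 𝓝 (0 : E)) :
    ∀ᶠ x in 𝓝 a, ∃ u ∈ R, u ∈ N ∧ f (a + u) = f x := by
  set L := fderiv ℝ f a with hL
  set V₁ := LinearMap.range L.toLinearMap
  set V₂ := LinearMap.ker L.toLinearMap
  obtain ⟨p, hp⟩ := Submodule.ClosedComplemented.of_finiteDimensional_quotient (p := V₁)
    (Submodule.closed_of_finiteDimensional V₁)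
  set π : E →L[ℝ] V₂ := (Submodule.projectionOnto V₂ R hR.symm).toContinuousLinearMap
  have hπ : ∀ v, π v = 0 → v ∈ R := fun v hv =>
    (Submodule.projectionOnto_apply_eq_zero_iff hR.symm).1 hv
  -- Coordinates adapted to `f`: the component of `f x` in the range of the derivative at `a`, and
  -- the component of `x - a` along its kernel.
  set g : E → V₁ × V₂ := fun x => (p (f x), π (x - a)) with hg
  have hgc : ContDiffOn ℝ ∞ g U := (p.contDiff.comp_contDiffOn hf).prodMk
    (π.contDiff.comp (contDiff_id.sub contDiff_const)).contDiffOn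
  have hgd : HasFDerivAt g ((p.comp L).prod π) a := by
    refine (p.hasFDerivAt.comp a (hf.hasFDerivAt_of_isOpen hU ha)).prodMk ?_
    exact π.hasFDerivAt.comp a ((hasFDerivAt_id a).sub_const a)
  have hinj : Function.Injective ((p.comp L).prod π) := by
    refine (injective_iff_map_eq_zero _).2 fun v hv => ?_
    have h1 : p (L v) = 0 := congrArg Prod.fst hv
    have h2 : π v = 0 := congrArg Prod.snd hv
    have h3 : p (L v) = ⟨L v, LinearMap.mem_range_self _ v⟩ := hp ⟨L v, LinearMap.mem_range_self _ v⟩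
    have h4 : L v = 0 := by
      rw [h1] at h3
      exact (congrArg Subtype.val h3).symm
    have h5 : v ∈ V₂ := h4
    have h6 : v ∈ R ⊓ V₂ := ⟨hπ v h2, h5⟩
    rw [hR.inf_eq_bot] at h6
    exact h6
  have hdim : Module.finrank ℝ E = Module.finrank ℝ (V₁ × V₂) := by
    rw [Module.finrank_prod]
    exact (LinearMap.finrank_range_add_finrank_ker L.toLinearMap).symm
  set Λ : E ≃L[ℝ] V₁ × V₂ := (LinearEquiv.ofInjectiveOfFinrankEq
    ((p.comp L).prod π).toLinearMap hinj hdim).toContinuousLinearEquiv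
  have hΛ : (Λ : E →L[ℝ] V₁ × V₂) = (p.comp L).prod π := by
    ext v <;> rfl
  rw [← hΛ] at hgd
  obtain ⟨h, hh, has, hsU, hsm⟩ := ContDiffOn.exists_openPartialHomeomorph hU hgc ha hgd
  have hh' : ∀ z, h z = g z := fun z => congrFun hh z
  have hga : h a = (p (f a), 0) := by rw [hh']; simp [hg]
  have htar : h.target ∈ 𝓝 (p (f a), (0 : V₂)) := by
    rw [← hga]; exact h.open_target.mem_nhds (h.map_source has)
  rw [nhds_prod_eq, mem_prod_iff] at htar
  obtain ⟨B₁, hB₁, B, hB, hBt⟩ := htar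
  obtain ⟨ε, hε, hεB⟩ := Metric.mem_nhds_iff.1 hB
  have hmem : ∀ s ∈ B₁, ∀ t ∈ Metric.ball (0 : V₂) ε, (s, t) ∈ h.target := fun s hs t ht =>
    hBt ⟨hs, hεB ht⟩
  -- `f` does not depend on the second coordinate
  have hconst : ∀ s ∈ B₁, ∀ t ∈ Metric.ball (0 : V₂) ε, f (h.symm (s, t)) = f (h.symm (s, 0)) := by
    intro s hs t ht
    have hder : ∀ t' ∈ Metric.ball (0 : V₂) ε, HasFDerivAt (fun t' => f (h.symm (s, t')))
        (0 : V₂ →L[ℝ] F) t' := by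
      intro t' ht'
      have hst := hmem s hs t' ht'
      set x := h.symm (s, t') with hx
      have hxU : x ∈ U := hsU (h.map_target hst)
      have hT := hsm.hasFDerivAt_of_isOpen h.open_target hst
      set T := fderiv ℝ h.symm (s, t')
      have hD := hf.hasFDerivAt_of_isOpen hU hxU
      set D := fderiv ℝ f x
      have hpD : ∀ v, p (D (T v)) = v.1 := by
        have h1 : HasFDerivAt (fun q => p (f (h.symm q))) (p.comp (D.comp T)) (s, t') :=
          p.hasFDerivAt.comp (s, t') (hD.comp (s, t') hT)
        have h2 : HasFDerivAt (fun q => p (f (h.symm q)))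
            (ContinuousLinearMap.fst ℝ V₁ V₂) (s, t') := by
          refine (ContinuousLinearMap.fst ℝ V₁ V₂).hasFDerivAt.congr_of_eventuallyEq ?_
          filter_upwards [h.open_target.mem_nhds hst] with q hq
          have := h.right_inv hq
          rw [hh'] at this
          exact congrArg Prod.fst this
        intro v
        exact DFunLike.congr_fun (h1.unique h2) v
      -- The projection `p` maps the range of `D` onto `V₁`, whose dimension bounds the rank of `D`;
      -- so `p` is injective on that range. The derivative in the second coordinate lies in the
      -- range and is killed by `p`, hence vanishes.
      have hker : ∀ w : LinearMap.range D.toLinearMap, p (w : F) = 0 → (w : F) = 0 := by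
        set P : LinearMap.range D.toLinearMap →ₗ[ℝ] V₁ :=
          p.toLinearMap.comp (Submodule.subtype _)
        have hsurj : Function.Surjective P := fun v =>
          ⟨⟨D (T (v, 0)), LinearMap.mem_range_self _ _⟩, hpD (v, 0)⟩
        have h1 := LinearMap.finrank_range_add_finrank_ker P
        rw [LinearMap.range_eq_top.2 hsurj, finrank_top] at h1
        have h2 := hrank x hxU
        have h3 : Module.finrank ℝ (LinearMap.ker P) = 0 := by
          have h2' : Module.finrank ℝ (LinearMap.range D.toLinearMap) ≤ Module.finrank ℝ V₁ := h2
          omega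
        have h4 : LinearMap.ker P = ⊥ := Submodule.finrank_eq_zero.1 h3
        intro w hw
        have : w ∈ LinearMap.ker P := hw
        rw [h4] at this
        rw [(Submodule.mem_bot ℝ).1 this]; rfl
      have hcomp := hD.comp t' (hT.comp t' ((hasFDerivAt_const s t').prodMk (hasFDerivAt_id t')))
      refine hcomp.congr_fderiv (ContinuousLinearMap.ext fun v => ?_)
      exact hker ⟨D (T (0, v)), LinearMap.mem_range_self _ _⟩ (hpD (0, v))
    exact (convex_ball (0 : V₂) ε).is_const_of_fderivWithin_eq_zero (𝕜 := ℝ)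
      (fun t' ht' => (hder t' ht').differentiableAt.differentiableWithinAt)
      (fun t' ht' => by
        rw [fderivWithin_of_isOpen Metric.isOpen_ball ht', (hder t' ht').fderiv])
      ht (Metric.mem_ball_self hε)
  have hcf : ContinuousAt f a := (hf.hasFDerivAt_of_isOpen hU ha).continuousAt
  have hcpf : Tendsto (fun x => p (f x)) (𝓝 a) (𝓝 (p (f a))) :=
    p.continuous.continuousAt.comp hcf
  have hu : Tendsto (fun x => h.symm (p (f x), 0) - a) (𝓝 a) (𝓝 0) := by
    have h1 : Tendsto h.symm (𝓝 (p (f a), 0)) (𝓝 a) := by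
      have := h.tendsto_symm has
      rwa [hga] at this
    have h2 := h1.comp (hcpf.prodMk_nhds (tendsto_const_nhds (x := (0 : V₂))))
    simpa using h2.sub_const a
  have hπa : ∀ᶠ x in 𝓝 a, π (x - a) ∈ Metric.ball (0 : V₂) ε := by
    have : ContinuousAt (fun x => π (x - a)) a := by fun_prop
    refine this.eventually_mem ?_
    simpa using Metric.ball_mem_nhds (0 : V₂) hε
  filter_upwards [hcpf.eventually_mem hB₁, hu.eventually_mem hN, hπa,
    h.open_source.mem_nhds has] with x hx1 hx2 hx3 hx4
  -- Setting the second coordinate of `x` to zero leaves `f` unchanged and moves the point into `a +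
  -- R`.
  refine ⟨h.symm (p (f x), 0) - a, hπ _ ?_, hx2, ?_⟩
  · have := h.right_inv (hmem _ hx1 0 (Metric.mem_ball_self hε))
    rw [hh'] at this
    exact congrArg Prod.snd this
  · rw [add_sub_cancel, ← hconst _ hx1 _ hx3]
    congr 1
    have := h.left_inv hx4
    rwa [hh'] at this

end Calculus

/-! ### Smooth dependence of integrals over compact spaces on parameters -/

section ParametricIntegral

open MeasureTheory

variable {K : Type*} [TopologicalSpace K] {P : Type*} [NormedAddCommGroup P] [NormedSpace ℝ P]
  {E : Type u} [NormedAddCommGroup E] [NormedSpace ℝ E]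

/-- The function `f` on `K × U` is smooth in the second variable and depends on the first one
through local maps to `P`. -/
def IsSmoothFamily (P : Type*) [NormedAddCommGroup P] [NormedSpace ℝ P]
    {F : Type*} [NormedAddCommGroup F] [NormedSpace ℝ F] (f : K → E → F) (U : Set E) : Prop :=
  ∀ k, ∀ a ∈ U, ∃ (c : K → P) (φ : P × E → F), ContinuousAt c k ∧ ContDiffAt ℝ ∞ φ (c k, a) ∧
    ∀ᶠ q in 𝓝 (k, a), f q.1 q.2 = φ (c q.1, q.2)

theorem IsSmoothFamily.continuousOn {F : Type*} [NormedAddCommGroup F] [NormedSpace ℝ F]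
    {f : K → E → F} {U : Set E} (hf : IsSmoothFamily P f U) :
    ContinuousOn (Function.uncurry f) (univ ×ˢ U) := by
  rintro ⟨k, a⟩ ⟨-, ha⟩
  obtain ⟨c, φ, hc, hφ, he⟩ := hf k a ha
  refine ContinuousAt.continuousWithinAt (ContinuousAt.congr ?_ (he.mono fun q hq => hq.symm))
  have h1 : ContinuousAt (fun q : K × E => (c q.1, q.2)) (k, a) :=
    (ContinuousAt.comp (f := Prod.fst) (x := (k, a)) hc continuousAt_fst).prodMk continuousAt_snd
  exact ContinuousAt.comp (f := fun q : K × E => (c q.1, q.2)) (x := (k, a)) hφ.continuousAt h1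

theorem IsSmoothFamily.hasFDerivAt {F : Type*} [NormedAddCommGroup F] [NormedSpace ℝ F]
    {f : K → E → F} {U : Set E} (hf : IsSmoothFamily P f U) (k : K) {a : E} (ha : a ∈ U) :
    HasFDerivAt (f k) (fderiv ℝ (f k) a) a := by
  obtain ⟨c, φ, hc, hφ, he⟩ := hf k a ha
  have h1 : DifferentiableAt ℝ (fun x => φ (c k, x)) a :=
    (hφ.differentiableAt (by simp)).comp a (by fun_prop)
  have h2 : f k =ᶠ[𝓝 a] fun x => φ (c k, x) :=
    (continuousAt_const.prodMk continuousAt_id : ContinuousAt (fun x => (k, x)) a).eventually he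
  exact (h1.congr_of_eventuallyEq h2).hasFDerivAt

/-- The same local parameter `c` serves for the derivative, with φ replaced by its partial
derivative. This closure property drives the induction on the order of differentiability of
integrals. -/
theorem IsSmoothFamily.fderiv_right {F : Type*} [NormedAddCommGroup F] [NormedSpace ℝ F]
    {f : K → E → F} {U : Set E} (hf : IsSmoothFamily P f U) :
    IsSmoothFamily P (fun k => fderiv ℝ (f k)) U := by
  intro k a ha
  obtain ⟨c, φ, hc, hφ, he⟩ := hf k a ha
  refine ⟨c, fun q => (fderiv ℝ φ q).comp (ContinuousLinearMap.inr ℝ P E), hc, ?_, ?_⟩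
  · exact (hφ.fderiv_right (m := ∞) (by simp)).clm_comp contDiffAt_const
  · have h1 : ContinuousAt (fun q : K × E => (c q.1, q.2)) (k, a) :=
      (ContinuousAt.comp (f := Prod.fst) (x := (k, a)) hc continuousAt_fst).prodMk continuousAt_snd
    have h2 : ∀ᶠ q in 𝓝 (c k, a), DifferentiableAt ℝ φ q := by
      filter_upwards [(hφ.of_le (m := 1) (by simp)).eventually (by simp)] with q hq
      exact hq.differentiableAt (by simp)
    filter_upwards [he.eventually_nhds, h1.eventually h2] with q hq hd
    have h3 : f q.1 =ᶠ[𝓝 q.2] fun x => φ (c q.1, x) :=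
      (continuousAt_const.prodMk continuousAt_id :
        ContinuousAt (fun x => (q.1, x)) q.2).eventually hq
    rw [h3.fderiv_eq]
    refine HasFDerivAt.fderiv ?_
    have h4 : HasFDerivAt (fun x : E => (c q.1, x)) (ContinuousLinearMap.inr ℝ P E) q.2 :=
      hasFDerivAt_prodMk_right _ _
    exact hd.hasFDerivAt.comp q.2 h4

theorem IsSmoothFamily.continuous_left {F : Type*} [NormedAddCommGroup F] [NormedSpace ℝ F]
    {f : K → E → F} {U : Set E} (hf : IsSmoothFamily P f U) {x : E} (hx : x ∈ U) :
    Continuous fun k => f k x := by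
  rw [← continuousOn_univ]
  exact hf.continuousOn.comp (by fun_prop : ContinuousOn (fun k => (k, x)) univ)
    fun k _ => ⟨trivial, hx⟩

variable [CompactSpace K] [MeasurableSpace K] [BorelSpace K] (μ : Measure K) [IsFiniteMeasure μ]

theorem Continuous.integrable_of_compactSpace {F : Type*} [NormedAddCommGroup F]
    {f : K → F} (hf : Continuous f) : Integrable f μ :=
  hf.integrable_of_hasCompactSupport (HasCompactSupport.of_compactSpace f)

variable [FiniteDimensional ℝ E]

/-- Differentiation under the integral sign: on the product of `K` with a closed ball the derivative
is continuous, hence bounded by a constant, which is integrable for a finite measure. -/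
theorem IsSmoothFamily.hasFDerivAt_integral {F : Type*} [NormedAddCommGroup F] [NormedSpace ℝ F]
    {f : K → E → F} {U : Set E} (hU : IsOpen U) (hf : IsSmoothFamily P f U) {a : E} (ha : a ∈ U) :
    HasFDerivAt (fun x => ∫ k, f k x ∂μ) (∫ k, fderiv ℝ (f k) a ∂μ) a := by
  obtain ⟨ε, hε, hεU⟩ := Metric.nhds_basis_closedBall.mem_iff.1 (hU.mem_nhds ha)
  obtain ⟨B, hB⟩ := (isCompact_univ.prod (isCompact_closedBall a ε)).exists_bound_of_continuousOn
    (hf.fderiv_right.continuousOn.mono (prod_mono subset_rfl hεU))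
  refine hasFDerivAt_integral_of_dominated_of_fderiv_le (bound := fun _ => B)
    (F' := fun x k => fderiv ℝ (f k) x) (Metric.closedBall_mem_nhds a hε) ?_ ?_ ?_ ?_ ?_ ?_
  · filter_upwards [hU.mem_nhds ha] with x hx
    exact ((hf.continuous_left hx).integrable_of_compactSpace μ).1
  · exact (hf.continuous_left ha).integrable_of_compactSpace μ
  · exact ((hf.fderiv_right.continuous_left ha).integrable_of_compactSpace μ).1
  · exact Eventually.of_forall fun k x hx => hB (k, x) ⟨trivial, hx⟩
  · exact integrable_const B
  · exact Eventually.of_forall fun k x hx => hf.hasFDerivAt k (hεU hx)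

/-- Integrals over compact spaces depend smoothly on parameters. -/
theorem IsSmoothFamily.contDiffOn_integral {F : Type u} [NormedAddCommGroup F] [NormedSpace ℝ F]
    {f : K → E → F} {U : Set E} (hU : IsOpen U) (hf : IsSmoothFamily P f U) :
    ContDiffOn ℝ ∞ (fun x => ∫ k, f k x ∂μ) U := by
  refine contDiffOn_infty.2 fun n => ?_
  -- The induction step replaces `F` by `E →L[ℝ] F`. As `E` and `F` share a universe, this is an
  -- instance of the same statement.
  induction n generalizing F with
  | zero =>
    exact contDiffOn_zero.2 fun a ha =>
      (hf.hasFDerivAt_integral μ hU ha).continuousAt.continuousWithinAt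
  | succ n ih =>
    refine (contDiffOn_succ_iff_fderiv_of_isOpen (n := (n : WithTop ℕ∞)) hU).2 ⟨fun a ha =>
      (hf.hasFDerivAt_integral μ hU ha).differentiableAt.differentiableWithinAt, by simp, ?_⟩
    exact (ih hf.fderiv_right).congr fun a ha => (hf.hasFDerivAt_integral μ hU ha).fderiv

end ParametricIntegral

/-! ### Compact groups and their representations -/

section CompactGroup

open MeasureTheory

/-- A closed subsemigroup of a compact group is a subgroup. -/
theorem inv_mem_of_isClosed_of_mul_mem {G : Type*} [Group G] [TopologicalSpace G]
    [IsTopologicalGroup G] [T2Space G] [CompactSpace G] {T : Set G} (hT : IsClosed T)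
    (hmul : ∀ a ∈ T, ∀ b ∈ T, a * b ∈ T) {g : G} (hg : g ∈ T) : g⁻¹ ∈ T := by
  -- The compact semigroup `g T` contains an idempotent, which in a group can only be `1`; so the
  -- inverse of `g` lies in `T`.
  obtain ⟨m, ⟨t, ht, rfl⟩, hm⟩ := exists_idempotent_in_compact_subsemigroup
    (fun r : G => continuous_mul_const r) ((g * ·) '' T) ⟨_, mem_image_of_mem _ hg⟩
    (hT.isCompact.image (continuous_const_mul g)) (by
      rintro _ ⟨a, ha, rfl⟩ _ ⟨b, hb, rfl⟩
      exact ⟨a * (g * b), hmul _ ha _ (hmul _ hg _ hb), by simp [mul_assoc]⟩)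
  have h1 : g * t = 1 := by simpa using hm
  rwa [inv_eq_of_mul_eq_one_right h1]

/-- A closed subgroup of a compact group which contains a conjugate of itself is equal to that
conjugate. -/
theorem Subgroup.eq_map_conj_of_map_conj_le {G : Type*} [Group G] [TopologicalSpace G]
    [IsTopologicalGroup G] [T2Space G] [CompactSpace G] {H : Subgroup G}
    (hH : IsClosed (H : Set G)) {g : G} (h : H.map (MulAut.conj g).toMonoidHom ≤ H) :
    H.map (MulAut.conj g).toMonoidHom = H := by
  have key : ∀ a : G, H.map (MulAut.conj a).toMonoidHom ≤ H ↔ ∀ x ∈ H, a * x * a⁻¹ ∈ H := by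
    intro a
    rw [Subgroup.map_le_iff_le_comap]
    rfl
  -- The elements conjugating `H` into itself form a closed subsemigroup. It contains `g`, hence
  -- also its inverse.
  have hcl : IsClosed {a : G | ∀ x ∈ H, a * x * a⁻¹ ∈ H} := by
    simp only [ofPred_forall]
    exact isClosed_iInter fun x => isClosed_iInter fun _ => hH.preimage (by fun_prop)
  have hinv := inv_mem_of_isClosed_of_mul_mem hcl (fun a ha b hb x hx => by
    have := ha _ (hb x hx)
    simpa [mul_assoc] using this) ((key g).1 h)
  refine le_antisymm h fun x hx => ⟨g⁻¹ * x * g, ?_, by simp [mul_assoc]⟩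
  simpa using hinv x hx

theorem exists_invariant_probability_measure (K : Type*) [Group K] [TopologicalSpace K]
    [IsTopologicalGroup K] [CompactSpace K] [MeasurableSpace K] [BorelSpace K] :
    ∃ μ : Measure K, IsProbabilityMeasure μ ∧ μ.IsMulLeftInvariant :=
  ⟨Measure.haarMeasure ⊤, ⟨by simpa using Measure.haarMeasure_self (K₀ := ⊤) (G := K)⟩,
    inferInstance⟩

variable {K : Type*} [Group K] [TopologicalSpace K] [IsTopologicalGroup K] [CompactSpace K]
  {V : Type*} [NormedAddCommGroup V] [NormedSpace ℝ V] [FiniteDimensional ℝ V]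

/-- Averages of vectors over a representation of a compact group. -/
theorem exists_average {ρ : K →* (V →L[ℝ] V)} (hρ : Continuous ρ) :
    ∃ A : V →L[ℝ] V, (∀ k v, ρ k (A v) = A v) ∧ (∀ v, (∀ k, ρ k v = v) → A v = v) ∧
      ∀ {W : Type} [NormedAddCommGroup W] [NormedSpace ℝ W] [CompleteSpace W] (l : V →L[ℝ] W)
        (v : V) (c : W), (∀ k, l (ρ k v) = c) → l (A v) = c := by
  borelize K
  obtain ⟨μ, hμ, hμ'⟩ := exists_invariant_probability_measure K
  have hcv : ∀ v, Integrable (fun k => ρ k v) μ := fun v =>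
    (hρ.clm_apply continuous_const).integrable_of_compactSpace μ
  have hA : ∀ v, (∫ k, ρ k ∂μ) v = ∫ k, ρ k v ∂μ := fun v =>
    ContinuousLinearMap.integral_apply (hρ.integrable_of_compactSpace μ) v
  have hl : ∀ {W : Type} [NormedAddCommGroup W] [NormedSpace ℝ W] [CompleteSpace W] (l : V →L[ℝ] W)
        (v : V) (c : W), (∀ k, l (ρ k v) = c) → l (∫ k, ρ k v ∂μ) = c := by
    intro W _ _ _ l v c h
    rw [← l.integral_comp_comm (hcv v)]
    simp [h]
  refine ⟨∫ k, ρ k ∂μ, fun k v => ?_, fun v hv => ?_, fun l v c h => ?_⟩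
  · rw [hA, ← (ρ k).integral_comp_comm (hcv v), ← integral_mul_left_eq_self (fun k => ρ k v) k]
    simp
  · rw [hA]
    simp [hv]
  · rw [hA]
    exact hl l v c h

/-- Invariant subspaces of representations of compact groups have invariant complements. -/
theorem exists_invariant_isCompl {ρ : K →* (V →L[ℝ] V)} (hρ : Continuous ρ) {O : Submodule ℝ V}
    (hO : ∀ k, ∀ v ∈ O, ρ k v ∈ O) :
    ∃ N : Submodule ℝ V, IsCompl O N ∧ ∀ k, ∀ v ∈ N, ρ k v ∈ N := by
  borelize K
  obtain ⟨μ, hμ, hμ'⟩ := exists_invariant_probability_measure K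
  obtain ⟨p, hp⟩ := Submodule.ClosedComplemented.of_finiteDimensional_quotient (p := O)
    (Submodule.closed_of_finiteDimensional O)
  set q : V →L[ℝ] V := O.subtypeL.comp p
  have hqO : ∀ v, q v ∈ O := fun v => (p v).2
  have hq : ∀ v ∈ O, q v = v := fun v hv => congrArg Subtype.val (hp ⟨v, hv⟩)
  -- The average of these conjugates of a projection onto `O` is an equivariant projection onto `O`;
  -- its kernel is the invariant complement.
  set f : K → V → V := fun k v => ρ k (q (ρ k⁻¹ v)) with hf
  have hfc : ∀ v, Integrable (fun k => f k v) μ := fun v => by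
    have : Continuous fun k => f k v := hρ.clm_apply
      (q.continuous.comp ((hρ.comp continuous_inv).clm_apply continuous_const))
    exact this.integrable_of_compactSpace μ
  set P : V →ₗ[ℝ] V :=
    { toFun := fun v => ∫ k, f k v ∂μ
      map_add' := fun v w => by
        rw [← integral_add (hfc v) (hfc w)]
        simp [hf]
      map_smul' := fun c v => by
        rw [RingHom.id_apply, ← integral_smul]
        simp [hf] } with hP
  have hPapp : ∀ v, P v = ∫ k, f k v ∂μ := fun v => rfl
  have hPO : ∀ v, P v ∈ O := by
    intro v
    have h1 : (ContinuousLinearMap.id ℝ V - q) (P v) = 0 := by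
      rw [hPapp, ← (ContinuousLinearMap.id ℝ V - q).integral_comp_comm (hfc v)]
      have : ∀ k, (ContinuousLinearMap.id ℝ V - q) (f k v) = 0 := fun k => by
        have := hq (f k v) (hO k _ (hqO _))
        simp [this]
      simp [this]
    have h2 : P v = q (P v) := sub_eq_zero.1 h1
    rw [h2]
    exact hqO _
  have hPid : ∀ v ∈ O, P v = v := by
    intro v hv
    have : ∀ k, f k v = v := fun k => by
      have h1 : ρ k (ρ k⁻¹ v) = v := by
        rw [← mul_apply_eq_comp, ← map_mul]
        simp
      simp only [hf]
      rw [hq _ (hO _ _ hv), h1]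
    rw [hPapp]
    simp [this]
  have hPeq : ∀ k v, P (ρ k v) = ρ k (P v) := by
    intro k v
    rw [hPapp, hPapp, ← (ρ k).integral_comp_comm (hfc v),
      ← integral_mul_left_eq_self (fun k' => f k' (ρ k v)) k]
    congr 1
    ext k'
    simp only [hf, mul_inv_rev, map_mul, mul_apply_eq_comp]
    congr 3
    rw [← mul_apply_eq_comp (ρ k⁻¹), ← map_mul]
    simp
  refine ⟨LinearMap.ker P, ?_, fun k v hv => ?_⟩
  · have h := LinearMap.isCompl_of_proj (f := P.codRestrict O hPO)
      fun x => Subtype.ext (hPid x x.2)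
    rwa [LinearMap.ker_codRestrict] at h
  · have hv' : P v = 0 := hv
    rw [LinearMap.mem_ker, hPeq, hv', map_zero]

end CompactGroup

/-! ### Charts of manifolds and smooth families -/

section Families

variable {K : Type*} [TopologicalSpace K] {P : Type*} [NormedAddCommGroup P] [NormedSpace ℝ P]
  {E : Type u} [NormedAddCommGroup E] [NormedSpace ℝ E]
  {F : Type*} [NormedAddCommGroup F] [NormedSpace ℝ F] {f : K → E → F} {U : Set E}

theorem IsSmoothFamily.comp_left (hf : IsSmoothFamily P f U) {h : K → K} (hh : Continuous h) :
    IsSmoothFamily P (fun k => f (h k)) U := by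
  intro k a ha
  obtain ⟨c, φ, hc, hφ, he⟩ := hf (h k) a ha
  refine ⟨c ∘ h, φ, hc.comp hh.continuousAt, hφ, ?_⟩
  have : ContinuousAt (fun q : K × E => (h q.1, q.2)) (k, a) := by fun_prop
  exact this.eventually he

/-- Turns functions of the group variable alone, such as differentials at a base point, into
families that can be multiplied with others. -/
theorem IsSmoothFamily.freeze (hf : IsSmoothFamily P f U) {b : E} (hb : b ∈ U) :
    IsSmoothFamily P (fun k (_ : E) => f k b) U := by
  intro k a ha
  obtain ⟨c, φ, hc, hφ, he⟩ := hf k b hb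
  refine ⟨c, fun q => φ (q.1, b), hc, ?_, ?_⟩
  · exact ContDiffAt.comp (c k, a) (g := φ) (f := fun q : P × E => (q.1, b)) hφ (by fun_prop)
  · have : ContinuousAt (fun q : K × E => (q.1, b)) (k, a) := by fun_prop
    exact this.eventually he

theorem IsSmoothFamily.clm_apply {Q : Type*} [NormedAddCommGroup Q] [NormedSpace ℝ Q]
    {G : Type*} [NormedAddCommGroup G] [NormedSpace ℝ G] (hf : IsSmoothFamily P f U)
    {g : K → E → F →L[ℝ] G} (hg : IsSmoothFamily Q g U) :
    IsSmoothFamily (P × Q) (fun k a => g k a (f k a)) U := by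
  intro k a ha
  obtain ⟨c, φ, hc, hφ, he⟩ := hf k a ha
  obtain ⟨c', φ', hc', hφ', he'⟩ := hg k a ha
  refine ⟨fun k => (c k, c' k), fun q => φ' (q.1.2, q.2) (φ (q.1.1, q.2)), hc.prodMk hc', ?_, ?_⟩
  · exact (ContDiffAt.comp ((c k, c' k), a) (g := φ') (f := fun q : (P × Q) × E => (q.1.2, q.2))
      hφ' (by fun_prop)).clm_apply (ContDiffAt.comp ((c k, c' k), a) (g := φ)
        (f := fun q : (P × Q) × E => (q.1.1, q.2)) hφ (by fun_prop))
  · filter_upwards [he, he'] with q h1 h2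
    rw [h1, h2]

theorem IsSmoothFamily.sub_const (hf : IsSmoothFamily P f U) (b : F) :
    IsSmoothFamily P (fun k a => f k a - b) U := by
  intro k a ha
  obtain ⟨c, φ, hc, hφ, he⟩ := hf k a ha
  exact ⟨c, fun q => φ q - b, hc, hφ.sub contDiffAt_const, he.mono fun q hq => congrArg (· - b) hq⟩

end Families

/-- The complement is the projection of a closed set along the compact factor `K`. -/
theorem isOpen_setOf_forall_mem {K M M' : Type*} [TopologicalSpace K] [CompactSpace K]
    [TopologicalSpace M] [TopologicalSpace M'] {m : K → M → M'}
    (hm : Continuous (Function.uncurry m)) {O : Set M'} (hO : IsOpen O) :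
    IsOpen {z : M | ∀ k : K, m k z ∈ O} := by
  have h2 := isClosedMap_snd_of_compactSpace _ (hO.isClosed_compl.preimage hm)
  rw [← isOpen_compl_iff] at h2
  convert h2 using 1
  ext z
  simp

theorem isOpen_setOf_forall_smul_mem {K M : Type*} [Group K] [TopologicalSpace K] [CompactSpace K]
    [TopologicalSpace M] [MulAction K M] [ContinuousSMul K M] {O : Set M} (hO : IsOpen O) :
    IsOpen {z : M | ∀ k : K, k • z ∈ O} :=
  isOpen_setOf_forall_mem continuous_smul hO

section ChartDerivative

variable {n : ℕ} {M : Type*} [TopologicalSpace M] [ChartedSpace (Euc n) M]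

/-- Manifold derivatives are read in preferred charts, so the preferred chart at `y` has the
identity as its derivative there. -/
theorem hasMFDerivAt_chartAt (y : M) :
    HasMFDerivAt (𝓡 n) (𝓡 n) (chartAt (Euc n) y) y (ContinuousLinearMap.id ℝ (Euc n)) := by
  refine ⟨(chartAt (Euc n) y).continuousAt (mem_chart_source _ y), ?_⟩
  refine ((hasFDerivAt_id _).hasFDerivWithinAt).congr_of_eventuallyEq ?_ ?_
  · refine eventually_nhdsWithin_of_eventually_nhds ?_
    filter_upwards [(chartAt (Euc n) y).open_target.mem_nhds (mem_chart_target _ y)] with a ha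
    exact (chartAt (Euc n) y).right_inv ha
  · exact (chartAt (Euc n) y).right_inv (mem_chart_target _ y)

theorem hasMFDerivAt_chartAt_symm (y : M) :
    HasMFDerivAt (𝓡 n) (𝓡 n) (chartAt (Euc n) y).symm (chartAt (Euc n) y y)
      (ContinuousLinearMap.id ℝ (Euc n)) := by
  have hy : (chartAt (Euc n) y).symm (chartAt (Euc n) y y) = y :=
    (chartAt (Euc n) y).left_inv (mem_chart_source _ y)
  refine ⟨(chartAt (Euc n) y).continuousAt_symm (mem_chart_target _ y), ?_⟩
  refine ((hasFDerivAt_id _).hasFDerivWithinAt).congr_of_eventuallyEq ?_ ?_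
  · refine eventually_nhdsWithin_of_eventually_nhds ?_
    filter_upwards [(chartAt (Euc n) y).open_target.mem_nhds (mem_chart_target _ y)] with a ha
    change chartAt (Euc n) ((chartAt (Euc n) y).symm (chartAt (Euc n) y y))
      ((chartAt (Euc n) y).symm a) = a
    rw [hy]
    exact (chartAt (Euc n) y).right_inv ha
  · change chartAt (Euc n) ((chartAt (Euc n) y).symm (chartAt (Euc n) y y))
      ((chartAt (Euc n) y).symm (chartAt (Euc n) y y)) = chartAt (Euc n) y y
    rw [hy]

end ChartDerivative

/-! ### The action of an isotropy group in coordinates -/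

namespace OrbispaceChart

variable {X : Type u} [TopologicalSpace X] (C : OrbispaceChart.{u, v, w} X)

instance : IsTopologicalGroup C.grp := topologicalGroup_of_lieGroup (𝓡 C.gdim) ∞

instance : ContinuousSMul C.grp C.dom :=
  ⟨(ContMDiffSMul.contMDiff_smul (I := 𝓡 C.gdim) (I' := 𝓡 C.dim) (n := ∞)).continuous⟩

theorem isClosed_stabilizer (y : C.dom) :
    IsClosed (MulAction.stabilizer C.grp y : Set C.grp) :=
  isClosed_singleton.preimage (continuous_id.smul continuous_const : Continuous fun g : C.grp => g • y)

instance (y : C.dom) : CompactSpace (MulAction.stabilizer C.grp y) :=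
  isCompact_iff_compactSpace.1 (C.isClosed_stabilizer y).isCompact

theorem contMDiff_smul_left (g : C.grp) :
    ContMDiff (𝓡 C.dim) (𝓡 C.dim) ∞ fun z : C.dom => g • z :=
  (ContMDiffSMul.contMDiff_smul (I := 𝓡 C.gdim) (I' := 𝓡 C.dim) (n := ∞)).comp
    (contMDiff_const.prodMk contMDiff_id)

theorem contMDiff_smul_right (z : C.dom) :
    ContMDiff (𝓡 C.gdim) (𝓡 C.dim) ∞ fun g : C.grp => g • z :=
  (ContMDiffSMul.contMDiff_smul (I := 𝓡 C.gdim) (I' := 𝓡 C.dim) (n := ∞)).comp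
    (contMDiff_id.prodMk contMDiff_const)

/-- The action of the isotropy group of `y` in the chart at `y`. -/
def localAction (y : C.dom) (k : MulAction.stabilizer C.grp y) (a : Euc C.dim) : Euc C.dim :=
  chartAt (Euc C.dim) y (k • (chartAt (Euc C.dim) y).symm a)

/-- The domain of `localAction`. -/
def localDomain (y : C.dom) : Set (Euc C.dim) :=
  (chartAt (Euc C.dim) y).target ∩ (chartAt (Euc C.dim) y).symm ⁻¹'
    {z | ∀ k : MulAction.stabilizer C.grp y, k • z ∈ (chartAt (Euc C.dim) y).source}

theorem isOpen_localDomain (y : C.dom) : IsOpen (C.localDomain y) :=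
  (chartAt (Euc C.dim) y).isOpen_inter_preimage_symm
    (isOpen_setOf_forall_smul_mem (chartAt (Euc C.dim) y).open_source)

theorem mem_localDomain (y : C.dom) : chartAt (Euc C.dim) y y ∈ C.localDomain y := by
  refine ⟨mem_chart_target _ y, fun k => ?_⟩
  rw [(chartAt (Euc C.dim) y).left_inv (mem_chart_source _ y), show k • y = y from k.2]
  exact mem_chart_source _ y

/-- The parameter is a chart of the ambient group around `k`, and the smooth function comes from
smoothness of the full action. No smooth structure on the isotropy group is needed. -/
theorem isSmoothFamily_localAction (y : C.dom) :
    IsSmoothFamily (Euc C.gdim) (C.localAction y) (C.localDomain y) := by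
  intro k a ha
  set e := chartAt (Euc C.dim) y
  set χ := chartAt (Euc C.gdim) (k : C.grp)
  have hχ : χ.symm (χ k) = k := χ.left_inv (mem_chart_source _ _)
  refine ⟨fun k' => χ k', fun q => e (χ.symm q.1 • e.symm q.2), ?_, ?_, ?_⟩
  · exact ContinuousAt.comp (f := Subtype.val) (g := χ) (x := k)
      (χ.continuousAt (mem_chart_source _ _)) continuousAt_subtype_val
  · rw [← contMDiffAt_iff_contDiffAt]
    have h1 : ContMDiffAt (𝓡 C.gdim) (𝓡 C.gdim) ∞ χ.symm (χ k) :=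
      (contMDiffOn_chart_symm (I := 𝓡 C.gdim) (n := ∞)).contMDiffAt
        (χ.open_target.mem_nhds (mem_chart_target _ _))
    have h2 : ContMDiffAt (𝓡 C.dim) (𝓡 C.dim) ∞ e.symm a :=
      (contMDiffOn_chart_symm (I := 𝓡 C.dim) (n := ∞)).contMDiffAt
        (e.open_target.mem_nhds ha.1)
    have h3 : ContMDiffAt (𝓡 C.dim) (𝓡 C.dim) ∞ e (χ.symm (χ k) • e.symm a) := by
      rw [hχ]
      exact (contMDiffOn_chart (I := 𝓡 C.dim) (n := ∞)).contMDiffAt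
        (e.open_source.mem_nhds (ha.2 k))
    have h4 : ContMDiffAt 𝓘(ℝ, Euc C.gdim × Euc C.dim) (𝓡 C.gdim) ∞
        (fun q : Euc C.gdim × Euc C.dim => χ.symm q.1) (χ k, a) :=
      ContMDiffAt.comp (g := χ.symm) (f := Prod.fst) (χ k, a) h1 contDiff_fst.contMDiff.contMDiffAt
    have h5 : ContMDiffAt 𝓘(ℝ, Euc C.gdim × Euc C.dim) (𝓡 C.dim) ∞
        (fun q : Euc C.gdim × Euc C.dim => e.symm q.2) (χ k, a) :=
      ContMDiffAt.comp (g := e.symm) (f := Prod.snd) (χ k, a) h2 contDiff_snd.contMDiff.contMDiffAt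
    exact ContMDiffAt.comp (g := e)
      (f := fun q : Euc C.gdim × Euc C.dim => χ.symm q.1 • e.symm q.2) (χ k, a) h3
      (ContMDiffAt.comp (g := fun p : C.grp × C.dom => p.1 • p.2)
        (f := fun q : Euc C.gdim × Euc C.dim => (χ.symm q.1, e.symm q.2)) (χ k, a)
        ContMDiffSMul.contMDiff_smul.contMDiffAt (h4.prodMk h5))
  · have h1 : ∀ᶠ q : MulAction.stabilizer C.grp y × Euc C.dim in 𝓝 (k, a),
        (q.1 : C.grp) ∈ χ.source :=
      (continuous_subtype_val.comp continuous_fst).continuousAt.eventually_mem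
        (χ.open_source.mem_nhds (mem_chart_source _ _))
    filter_upwards [h1] with q hq
    change e ((q.1 : C.grp) • e.symm q.2) = _
    rw [χ.left_inv hq]

theorem localAction_base (y : C.dom) (k : MulAction.stabilizer C.grp y) :
    C.localAction y k (chartAt (Euc C.dim) y y) = chartAt (Euc C.dim) y y := by
  rw [localAction, (chartAt (Euc C.dim) y).left_inv (mem_chart_source _ y),
    show k • y = y from k.2]

theorem hasFDerivAt_localAction (y : C.dom) (k : MulAction.stabilizer C.grp y) :
    HasFDerivAt (C.localAction y k) (fderiv ℝ (C.localAction y k) (chartAt (Euc C.dim) y y))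
      (chartAt (Euc C.dim) y y) :=
  (C.isSmoothFamily_localAction y).hasFDerivAt k (C.mem_localDomain y)

/-- The representation of the isotropy group of `y` on the tangent space at `y`. -/
def isotropyRep (y : C.dom) : MulAction.stabilizer C.grp y →* (Euc C.dim →L[ℝ] Euc C.dim) where
  toFun k := fderiv ℝ (C.localAction y k) (chartAt (Euc C.dim) y y)
  map_one' := by
    refine HasFDerivAt.fderiv ((hasFDerivAt_id _).congr_of_eventuallyEq ?_)
    filter_upwards [(C.isOpen_localDomain y).mem_nhds (C.mem_localDomain y)] with a ha
    rw [localAction, one_smul, (chartAt (Euc C.dim) y).right_inv ha.1]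
    rfl
  map_mul' k k' := by
    have h1 := C.hasFDerivAt_localAction y k
    rw [← C.localAction_base y k'] at h1
    refine HasFDerivAt.fderiv (HasFDerivAt.congr_of_eventuallyEq (f := C.localAction y k ∘
      C.localAction y k') ((h1.comp _ (C.hasFDerivAt_localAction y k')).congr_fderiv ?_) ?_)
    · rw [C.localAction_base y k']
      rfl
    · filter_upwards [(C.isOpen_localDomain y).mem_nhds (C.mem_localDomain y)] with a ha
      simp only [localAction, Function.comp_apply]
      rw [(chartAt (Euc C.dim) y).left_inv (ha.2 k'), mul_smul]

theorem continuous_isotropyRep (y : C.dom) : Continuous (C.isotropyRep y) :=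
  (C.isSmoothFamily_localAction y).fderiv_right.continuous_left (C.mem_localDomain y)

/-- Identifies the coordinate derivative with the intrinsic one, since the chart at `y` has identity
derivative at `y`. -/
theorem hasMFDerivAt_smul (y : C.dom) (k : MulAction.stabilizer C.grp y) :
    HasMFDerivAt (𝓡 C.dim) (𝓡 C.dim) (fun z : C.dom => (k : C.grp) • z) y (C.isotropyRep y k) := by
  set e := chartAt (Euc C.dim) y
  have h1 : HasMFDerivAt (𝓡 C.dim) (𝓡 C.dim) (C.localAction y k) (e y) (C.isotropyRep y k) :=
    (C.hasFDerivAt_localAction y k).hasMFDerivAt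
  have h2 : HasMFDerivAt (𝓡 C.dim) (𝓡 C.dim) e.symm (C.localAction y k (e y))
      (ContinuousLinearMap.id ℝ (Euc C.dim)) := by
    rw [C.localAction_base y k]
    exact hasMFDerivAt_chartAt_symm y
  refine HasMFDerivAt.congr_of_eventuallyEq ((h2.comp (e y) h1).comp y (hasMFDerivAt_chartAt y)) ?_
  have hW : {z | ∀ k : MulAction.stabilizer C.grp y, k • z ∈ e.source} ∈ 𝓝 y :=
    (isOpen_setOf_forall_smul_mem e.open_source).mem_nhds fun k => by
      rw [show k • y = y from k.2]
      exact mem_chart_source _ y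
  filter_upwards [hW, e.open_source.mem_nhds (mem_chart_source _ y)] with z hz hz'
  change (k : C.grp) • z = e.symm (e ((k : C.grp) • e.symm (e z)))
  rw [e.left_inv hz']
  exact (e.left_inv (hz k)).symm

end OrbispaceChart

/-! ### Linearization of isotropy group actions -/

namespace OrbispaceChart

variable {X : Type u} [TopologicalSpace X] (C : OrbispaceChart.{u, v, w} X)

/-- A smooth coordinate system at `y` in which the isotropy group of `y` acts linearly. -/
structure Linearization (y : C.dom) where
  toHomeo : OpenPartialHomeomorph C.dom (Euc C.dim)
  mem_source : y ∈ toHomeo.source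
  map_base : toHomeo y = 0
  smooth : ContMDiffOn (𝓡 C.dim) (𝓡 C.dim) ∞ toHomeo toHomeo.source
  smooth_symm : ContMDiffOn (𝓡 C.dim) (𝓡 C.dim) ∞ toHomeo.symm toHomeo.target
  hasMFDerivAt : HasMFDerivAt (𝓡 C.dim) (𝓡 C.dim) toHomeo y (ContinuousLinearMap.id ℝ (Euc C.dim))
  smul_mem : ∀ (k : MulAction.stabilizer C.grp y), ∀ z ∈ toHomeo.source,
    (k : C.grp) • z ∈ toHomeo.source
  map_smul : ∀ (k : MulAction.stabilizer C.grp y), ∀ z ∈ toHomeo.source,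
    toHomeo ((k : C.grp) • z) = C.isotropyRep y k (toHomeo z)

open MeasureTheory in
/-- Bochner's linearization theorem. -/
theorem nonempty_linearization (y : C.dom) : Nonempty (C.Linearization y) := by
  let K : Type w := MulAction.stabilizer C.grp y
  set n := C.dim
  set e := chartAt (Euc n) y with he
  set ρ := C.isotropyRep y
  borelize K
  obtain ⟨μ, hμ, hμ'⟩ := exists_invariant_probability_measure K
  -- Acting by the inverse of `k` and then by the linear part of `k` gives a map with identity
  -- derivative at the base point; averaging over `k` makes it intertwine the action with ρ.
  set f : K → Euc n → Euc n := fun k a => ρ k (C.localAction y k⁻¹ a - e y) with hf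
  have hey : e.symm (e y) = y := e.left_inv (mem_chart_source _ y)
  have hfam : IsSmoothFamily (Euc C.gdim × Euc C.gdim) f (C.localDomain y) :=
    (((C.isSmoothFamily_localAction y).comp_left continuous_inv).sub_const (e y)).clm_apply
      ((C.isSmoothFamily_localAction y).fderiv_right.freeze (C.mem_localDomain y))
  set g : Euc n → Euc n := fun a => ∫ k, f k a ∂μ with hg
  have hgs : ContDiffOn ℝ ∞ g (C.localDomain y) :=
    hfam.contDiffOn_integral μ (C.isOpen_localDomain y)
  have hgd : HasFDerivAt g ((ContinuousLinearEquiv.refl ℝ (Euc n) : Euc n ≃L[ℝ] Euc n) :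
      Euc n →L[ℝ] Euc n) (e y) := by
    refine (hfam.hasFDerivAt_integral μ (C.isOpen_localDomain y)
      (C.mem_localDomain y)).congr_fderiv ?_
    have : ∀ k, fderiv ℝ (f k) (e y) = ContinuousLinearMap.id ℝ (Euc n) := by
      intro k
      refine HasFDerivAt.fderiv (((ρ k).hasFDerivAt.comp (e y)
        ((C.hasFDerivAt_localAction y k⁻¹).sub_const (e y))).congr_fderiv ?_)
      change ρ k * ρ k⁻¹ = 1
      rw [← map_mul, mul_inv_cancel, map_one]
    refine (integral_congr_ae (Eventually.of_forall this)).trans ?_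
    rw [integral_const, probReal_univ, one_smul]
    rfl
  obtain ⟨h, hh, hys, hsU, hsm⟩ := hgs.exists_openPartialHomeomorph (C.isOpen_localDomain y)
    (C.mem_localDomain y) hgd
  have hh' : ∀ a, h a = g a := fun a => congrFun hh a
  -- The largest subset of the domain that is invariant under the isotropy group; it is open by
  -- compactness.
  set W : Set C.dom := {z | ∀ k : K, k • z ∈ (e.trans h).source}
  have hW : IsOpen W := isOpen_setOf_forall_smul_mem (e.trans h).open_source
  have hWs : W ⊆ (e.trans h).source := fun z hz => by simpa using hz 1
  have hys' : y ∈ (e.trans h).source := by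
    rw [OpenPartialHomeomorph.trans_source]
    exact ⟨mem_chart_source _ y, hys⟩
  have hyW : y ∈ W := fun k => by
    rw [show k • y = y from k.2]
    exact hys'
  set Φ := (e.trans h).restrOpen W hW with hΦ
  have hΦs : Φ.source = W := by
    rw [hΦ, OpenPartialHomeomorph.restrOpen_source, inter_eq_right]
    exact hWs
  have hΦapp : ∀ z, Φ z = g (e z) := fun z => hh' _
  have hWl : ∀ z ∈ W, ∀ k : K, k • z ∈ e.source := fun z hz k =>
    ((e.trans_source h ▸ hz k : k • z ∈ e.source ∩ e ⁻¹' h.source)).1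
  refine ⟨⟨Φ, hΦs ▸ hyW, ?_, ?_, ?_, ?_, ?_, ?_⟩⟩
  · rw [hΦapp, hg]
    have : ∀ k, f k (e y) = 0 := fun k => by
      simp only [hf]
      rw [C.localAction_base y, sub_self, map_zero]
    simp [this]
  · rw [hΦs]
    refine ContMDiffOn.congr (f := g ∘ e) (ContMDiffOn.comp (g := g) (f := e)
      (t := C.localDomain y) (I' := 𝓡 C.dim) ?_ ?_ ?_) fun z _ => hΦapp z
    · exact contMDiffOn_iff_contDiffOn.2 hgs
    · exact (contMDiffOn_chart (I := 𝓡 C.dim) (n := ∞)).mono fun z hz => (hWs hz).1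
    · intro z hz
      exact hsU (hWs hz).2
  · refine ContMDiffOn.comp (g := e.symm) (f := h.symm) (t := e.target) (I' := 𝓡 C.dim) ?_ ?_ ?_
    · exact contMDiffOn_chart_symm (I := 𝓡 C.dim) (n := ∞)
    · exact (contMDiffOn_iff_contDiffOn.2 hsm).mono fun a ha => ha.1.1
    · intro a ha
      exact ha.1.2
  · have h1 : HasMFDerivAt (𝓡 n) (𝓡 n) g (e y) (ContinuousLinearMap.id ℝ (Euc n)) :=
      hgd.hasMFDerivAt
    have h2 := h1.comp y (hasMFDerivAt_chartAt y)
    exact h2.congr_of_eventuallyEq (Eventually.of_forall hΦapp)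
  · rw [hΦs]
    intro k z hz k'
    have := hz (k' * k)
    rwa [mul_smul] at this
  · rw [hΦs]
    intro k z hz
    rw [hΦapp, hΦapp]
    have hint : Integrable (fun k => f k (e z)) μ :=
      (hfam.continuous_left (hsU (hWs hz).2)).integrable_of_compactSpace μ
    simp only [hg]
    -- Equivariance is left invariance of the measure: `k * k'` is substituted for `k'`.
    rw [← (C.isotropyRep y k).integral_comp_comm hint,
      ← integral_mul_left_eq_self (fun k' => f k' (e ((k : C.grp) • z))) k]
    congr 1
    ext1 k'
    have h1 : e.symm (e ((k : C.grp) • z)) = k • z := e.left_inv (hWl z hz k)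
    have h2 : e.symm (e z) = z := e.left_inv (hWs hz).1
    simp only [hf, localAction]
    rw [h1, h2, map_mul, smul_smul]
    simp only [mul_inv_rev, inv_mul_cancel_right]
    rfl

end OrbispaceChart

/-! ### Orbit maps and the action in linearizing coordinates -/

namespace OrbispaceChart

variable {X : Type u} [TopologicalSpace X] (C : OrbispaceChart.{u, v, w} X)

/-- The derivative of the orbit map of `y`. -/
def orbitDeriv (y : C.dom) : Euc C.gdim →L[ℝ] Euc C.dim :=
  mfderiv (𝓡 C.gdim) (𝓡 C.dim) (fun g : C.grp => g • y) 1

theorem orbitTangent_eq (y : C.dom) : C.orbitTangent y = LinearMap.range (C.orbitDeriv y).toLinearMap :=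
  rfl

theorem hasMFDerivAt_orbitMap (y : C.dom) :
    HasMFDerivAt (𝓡 C.gdim) (𝓡 C.dim) (fun g : C.grp => g • y) 1 (C.orbitDeriv y) :=
  ((C.contMDiff_smul_right y).mdifferentiable (by simp) 1).hasMFDerivAt

/-- For `k` fixing `y`, acting by `k` on `g • y` amounts to acting by the conjugate of `g` on `y`.
Differentiate this at the unit. -/
theorem isotropyRep_mem_orbitTangent (y : C.dom) (k : MulAction.stabilizer C.grp y)
    {v : Euc C.dim} (hv : v ∈ C.orbitTangent y) : C.isotropyRep y k v ∈ C.orbitTangent y := by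
  obtain ⟨w, rfl⟩ := hv
  have hk : (k : C.grp) • y = y := k.2
  set c : C.grp → C.grp := fun g => k * g * (k : C.grp)⁻¹ with hc
  have hcs : ContMDiff (𝓡 C.gdim) (𝓡 C.gdim) ∞ c :=
    (contMDiff_mul_right (I := 𝓡 C.gdim) (n := ∞) (a := (k : C.grp)⁻¹)).comp
      (contMDiff_mul_left (I := 𝓡 C.gdim) (n := ∞) (a := (k : C.grp)))
  have hc1 : c 1 = 1 := by simp [hc]
  have h1 : HasMFDerivAt (𝓡 C.gdim) (𝓡 C.dim) (fun g : C.grp => g • y) (c 1) (C.orbitDeriv y) := by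
    rw [hc1]
    exact C.hasMFDerivAt_orbitMap y
  have h2 := h1.comp 1 (hcs.mdifferentiable (by simp) 1).hasMFDerivAt
  have h3 : HasMFDerivAt (𝓡 C.dim) (𝓡 C.dim) (fun z : C.dom => (k : C.grp) • z) ((1 : C.grp) • y)
      (C.isotropyRep y k) := by
    rw [one_smul]
    exact C.hasMFDerivAt_smul y k
  have h4 := h3.comp 1 (C.hasMFDerivAt_orbitMap y)
  have h5 : (fun z : C.dom => (k : C.grp) • z) ∘ (fun g : C.grp => g • y) =
      (fun g : C.grp => g • y) ∘ c := by
    ext1 g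
    have : (k : C.grp)⁻¹ • y = y := by rw [inv_smul_eq_iff, hk]
    simp only [Function.comp_apply, hc, mul_smul, this]
  rw [h5] at h4
  have h6 := hasMFDerivAt_unique h4 h2
  exact ⟨_, (DFunLike.congr_fun h6 w).symm⟩

/-- Exponential-like coordinates of the group at `1`. -/
def grpParam (u : Euc C.gdim) : C.grp :=
  (chartAt (Euc C.gdim) (1 : C.grp)).symm (chartAt (Euc C.gdim) (1 : C.grp) 1 + u)

/-- The domain of `grpParam`. -/
def grpParamDomain : Set (Euc C.gdim) :=
  (fun u => chartAt (Euc C.gdim) (1 : C.grp) 1 + u) ⁻¹' (chartAt (Euc C.gdim) (1 : C.grp)).target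

theorem isOpen_grpParamDomain : IsOpen C.grpParamDomain :=
  (chartAt (Euc C.gdim) (1 : C.grp)).open_target.preimage (by fun_prop)

theorem zero_mem_grpParamDomain : (0 : Euc C.gdim) ∈ C.grpParamDomain := by
  simp [grpParamDomain]

theorem grpParam_zero : C.grpParam 0 = 1 := by
  simp only [grpParam, add_zero]
  exact (chartAt (Euc C.gdim) (1 : C.grp)).left_inv (mem_chart_source _ _)

theorem contMDiffOn_grpParam :
    ContMDiffOn (𝓡 C.gdim) (𝓡 C.gdim) ∞ C.grpParam C.grpParamDomain := by
  refine ContMDiffOn.comp (contMDiffOn_chart_symm (I := 𝓡 C.gdim) (n := ∞)) ?_ subset_rfl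
  exact contMDiffOn_iff_contDiffOn.2 (by fun_prop)

theorem hasMFDerivAt_grpParam :
    HasMFDerivAt (𝓡 C.gdim) (𝓡 C.gdim) C.grpParam 0 (ContinuousLinearMap.id ℝ (Euc C.gdim)) := by
  have h1 : HasMFDerivAt (𝓡 C.gdim) (𝓡 C.gdim)
      (fun u : Euc C.gdim => chartAt (Euc C.gdim) (1 : C.grp) 1 + u) 0
      (ContinuousLinearMap.id ℝ (Euc C.gdim)) :=
    ((hasFDerivAt_id (0 : Euc C.gdim)).const_add _).hasMFDerivAt
  have h2 : HasMFDerivAt (𝓡 C.gdim) (𝓡 C.gdim) (chartAt (Euc C.gdim) (1 : C.grp)).symm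
      (chartAt (Euc C.gdim) (1 : C.grp) 1 + 0) (ContinuousLinearMap.id ℝ (Euc C.gdim)) := by
    rw [add_zero]
    exact hasMFDerivAt_chartAt_symm 1
  exact h2.comp 0 h1

theorem eventually_exists_grpParam_eq {p : Euc C.gdim → Prop} (hp : ∀ᶠ u in 𝓝 0, p u) :
    ∀ᶠ g in 𝓝 (1 : C.grp), ∃ u, p u ∧ C.grpParam u = g := by
  set χ := chartAt (Euc C.gdim) (1 : C.grp) with hχ
  have h1 : Tendsto (fun g => χ g - χ 1) (𝓝 1) (𝓝 0) := by
    have : Tendsto (fun g => χ g - χ 1) (𝓝 1) (𝓝 (χ 1 - χ 1)) :=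
      (χ.continuousAt (mem_chart_source _ (1 : C.grp))).sub continuousAt_const
    rwa [sub_self] at this
  filter_upwards [χ.open_source.mem_nhds (mem_chart_source _ (1 : C.grp)), h1.eventually hp]
    with g hg hg'
  refine ⟨χ g - χ 1, hg', ?_⟩
  change χ.symm (χ 1 + (χ g - χ 1)) = g
  rw [add_sub_cancel, χ.left_inv hg]

variable {C} {y : C.dom} (Λ : C.Linearization y)

namespace Linearization

/-- The action in the linearizing coordinates. -/
def act (q : Euc C.gdim × Euc C.dim) : Euc C.dim :=
  Λ.toHomeo (C.grpParam q.1 • Λ.toHomeo.symm q.2)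

/-- The domain of `act`. -/
def actDomain : Set (Euc C.gdim × Euc C.dim) :=
  (C.grpParamDomain ×ˢ Λ.toHomeo.target) ∩
    (fun q => C.grpParam q.1 • Λ.toHomeo.symm q.2) ⁻¹' Λ.toHomeo.source

theorem contMDiffOn_act_aux : ContMDiffOn 𝓘(ℝ, Euc C.gdim × Euc C.dim) (𝓡 C.dim) ∞
    (fun q : Euc C.gdim × Euc C.dim => C.grpParam q.1 • Λ.toHomeo.symm q.2)
    (C.grpParamDomain ×ˢ Λ.toHomeo.target) := by
  refine ContMDiffOn.comp (g := fun p : C.grp × C.dom => p.1 • p.2)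
    (f := fun q : Euc C.gdim × Euc C.dim => (C.grpParam q.1, Λ.toHomeo.symm q.2)) (t := univ)
    (ContMDiffSMul.contMDiff_smul (I := 𝓡 C.gdim) (I' := 𝓡 C.dim) (n := ∞)).contMDiffOn ?_
    (fun _ _ => trivial)
  refine ContMDiffOn.prodMk ?_ ?_
  · exact ContMDiffOn.comp (g := C.grpParam) C.contMDiffOn_grpParam
      contDiff_fst.contMDiff.contMDiffOn fun q hq => hq.1
  · exact ContMDiffOn.comp (g := Λ.toHomeo.symm) Λ.smooth_symm
      contDiff_snd.contMDiff.contMDiffOn fun q hq => hq.2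

theorem isOpen_actDomain : IsOpen Λ.actDomain :=
  Λ.contMDiffOn_act_aux.continuousOn.isOpen_inter_preimage
    (C.isOpen_grpParamDomain.prod Λ.toHomeo.open_target) Λ.toHomeo.open_source

theorem contDiffOn_act : ContDiffOn ℝ ∞ Λ.act Λ.actDomain := by
  rw [← contMDiffOn_iff_contDiffOn]
  exact ContMDiffOn.comp (g := Λ.toHomeo) Λ.smooth
    (Λ.contMDiffOn_act_aux.mono inter_subset_left) fun q hq => hq.2

theorem symm_zero : Λ.toHomeo.symm 0 = y := by
  rw [← Λ.map_base, Λ.toHomeo.left_inv Λ.mem_source]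

theorem zero_mem_target : (0 : Euc C.dim) ∈ Λ.toHomeo.target := by
  rw [← Λ.map_base]
  exact Λ.toHomeo.map_source Λ.mem_source

theorem zero_mem_actDomain : (0 : Euc C.gdim × Euc C.dim) ∈ Λ.actDomain := by
  refine ⟨⟨C.zero_mem_grpParamDomain, Λ.zero_mem_target⟩, ?_⟩
  simp only [mem_preimage, Prod.fst_zero, Prod.snd_zero, C.grpParam_zero, one_smul, Λ.symm_zero]
  exact Λ.mem_source

theorem act_zero_left {b : Euc C.dim} (hb : b ∈ Λ.toHomeo.target) : Λ.act (0, b) = b := by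
  simp only [act, C.grpParam_zero, one_smul]
  exact Λ.toHomeo.right_inv hb

theorem hasFDerivAt_act_left : HasFDerivAt (fun u => Λ.act (u, 0)) (C.orbitDeriv y) 0 := by
  have h1 : HasMFDerivAt (𝓡 C.gdim) (𝓡 C.dim) (fun g : C.grp => g • y) (C.grpParam 0)
      (C.orbitDeriv y) := by
    rw [C.grpParam_zero]
    exact C.hasMFDerivAt_orbitMap y
  have h2 : HasMFDerivAt (𝓡 C.dim) (𝓡 C.dim) Λ.toHomeo (C.grpParam 0 • y)
      (ContinuousLinearMap.id ℝ (Euc C.dim)) := by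
    rw [C.grpParam_zero, one_smul]
    exact Λ.hasMFDerivAt
  have h3 : (fun u => Λ.act (u, 0)) = Λ.toHomeo ∘ (fun g : C.grp => g • y) ∘ C.grpParam := by
    ext1 u
    simp [act, Λ.symm_zero]
  rw [h3]
  exact hasMFDerivAt_iff_hasFDerivAt.1 (h2.comp 0 (h1.comp 0 C.hasMFDerivAt_grpParam))

/-- The two partial derivatives at the origin are the derivative of the orbit map and, since the
unit acts trivially, the identity. -/
theorem hasFDerivAt_act : HasFDerivAt Λ.act
    ((C.orbitDeriv y).coprod (ContinuousLinearMap.id ℝ (Euc C.dim))) 0 := by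
  have h0 := Λ.contDiffOn_act.hasFDerivAt_of_isOpen Λ.isOpen_actDomain Λ.zero_mem_actDomain
  refine h0.congr_fderiv ?_
  have h1 : (fderiv ℝ Λ.act 0).comp (ContinuousLinearMap.inl ℝ _ _) = C.orbitDeriv y :=
    (HasFDerivAt.comp (g := Λ.act) (0 : Euc C.gdim) h0
      (hasFDerivAt_prodMk_left (0 : Euc C.gdim) (0 : Euc C.dim))).unique Λ.hasFDerivAt_act_left
  have h2 : (fderiv ℝ Λ.act 0).comp (ContinuousLinearMap.inr ℝ _ _) =
      ContinuousLinearMap.id ℝ (Euc C.dim) := by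
    refine (HasFDerivAt.comp (g := Λ.act) (0 : Euc C.dim) h0
      (hasFDerivAt_prodMk_right (0 : Euc C.gdim) (0 : Euc C.dim))).unique ?_
    refine (hasFDerivAt_id _).congr_of_eventuallyEq ?_
    filter_upwards [Λ.toHomeo.open_target.mem_nhds Λ.zero_mem_target] with b hb
    exact Λ.act_zero_left hb
  ext1
  · rw [h1, ContinuousLinearMap.coprod_comp_inl]
  · rw [h2, ContinuousLinearMap.coprod_comp_inr]

/-- The rank of the orbit map is nowhere greater than at `1`. -/
theorem finrank_range_fderiv_act_le {u : Euc C.gdim} (hu : (u, 0) ∈ Λ.actDomain) :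
    Module.finrank ℝ (LinearMap.range (fderiv ℝ (fun u => Λ.act (u, 0)) u).toLinearMap) ≤
      Module.finrank ℝ (C.orbitTangent y) := by
  set g := C.grpParam u with hg
  have hgs : g • y ∈ Λ.toHomeo.source := by
    have := hu.2
    simpa only [mem_preimage, Λ.symm_zero] using this
  -- By homogeneity of the orbit, a group element near `g` acts on `y` as its left translate by the
  -- inverse of `g`, followed by `g`. So the derivative at `u` factors through the one at the unit.
  have h1 := ((C.contMDiffOn_grpParam.contMDiffAt (C.isOpen_grpParamDomain.mem_nhds
    hu.1.1)).mdifferentiableAt (by simp)).hasMFDerivAt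
  have h2 : MDifferentiableAt (𝓡 C.dim) (𝓡 C.dim) Λ.toHomeo (g • (1 : C.grp) • y) := by
    rw [one_smul]
    exact (Λ.smooth.contMDiffAt (Λ.toHomeo.open_source.mem_nhds hgs)).mdifferentiableAt (by simp)
  have h3 := ((C.contMDiff_smul_left g).mdifferentiable (by simp) ((1 : C.grp) • y)).hasMFDerivAt
  have h4 := ((contMDiff_mul_left (I := 𝓡 C.gdim) (n := ∞) (a := g⁻¹)).mdifferentiable
    (by simp) g).hasMFDerivAt
  have h5 : HasMFDerivAt (𝓡 C.gdim) (𝓡 C.dim) (fun g : C.grp => g • y) (g⁻¹ * g)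
      (C.orbitDeriv y) := by
    rw [inv_mul_cancel]
    exact C.hasMFDerivAt_orbitMap y
  have h6 : HasMFDerivAt (𝓡 C.gdim) (𝓡 C.dim) ((fun g : C.grp => g • y) ∘ (g⁻¹ * ·) ∘ C.grpParam) u
      ((C.orbitDeriv y).comp _) := h5.comp u (h4.comp u h1)
  have h7 : MDifferentiableAt (𝓡 C.dim) (𝓡 C.dim) (fun z => Λ.toHomeo (g • z))
      (((fun g : C.grp => g • y) ∘ (g⁻¹ * ·) ∘ C.grpParam) u) := by
    have : ((fun g : C.grp => g • y) ∘ (g⁻¹ * ·) ∘ C.grpParam) u = (1 : C.grp) • y := by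
      simp [← hg]
    rw [this]
    exact (h2.hasMFDerivAt.comp _ h3).mdifferentiableAt
  have h8 := h7.hasMFDerivAt.comp u h6
  have h9 : (fun z => Λ.toHomeo (g • z)) ∘ ((fun g : C.grp => g • y) ∘ (g⁻¹ * ·) ∘ C.grpParam) =
      fun u => Λ.act (u, 0) := by
    ext1 u
    simp [act, Λ.symm_zero, smul_smul]
  rw [h9] at h8
  obtain ⟨A, B, hAB⟩ : ∃ (A : Euc C.dim →L[ℝ] Euc C.dim) (B : Euc C.gdim →L[ℝ] Euc C.gdim),
      HasFDerivAt (fun u => Λ.act (u, 0)) (A.comp ((C.orbitDeriv y).comp B)) u :=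
    ⟨_, _, hasMFDerivAt_iff_hasFDerivAt.1 h8⟩
  rw [hAB.fderiv, orbitTangent_eq]
  refine (Submodule.finrank_mono (t := (LinearMap.range (C.orbitDeriv y).toLinearMap).map
    A.toLinearMap) ?_).trans (Submodule.finrank_map_le _ _)
  rintro _ ⟨w, rfl⟩
  exact ⟨_, ⟨_, rfl⟩, rfl⟩

end Linearization

end OrbispaceChart

/-! ### The slice theorem -/

namespace OrbispaceChart

variable {X : Type u} [TopologicalSpace X] (C : OrbispaceChart.{u, v, w} X)

/-- Group elements which move points near `y` to points near `y` are near the isotropy group. -/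
theorem exists_nhds_forall_smul_eq_mem (y : C.dom) {O : Set C.grp} (hO : IsOpen O)
    (hHO : ∀ g ∈ MulAction.stabilizer C.grp y, g ∈ O) :
    ∃ V : Set C.dom, IsOpen V ∧ y ∈ V ∧ ∀ z ∈ V, ∀ z' ∈ V, ∀ g : C.grp, g • z = z' → g ∈ O := by
  -- The complement of `O` is compact and none of its elements fixes `y`, so the tube lemma gives a
  -- neighbourhood of `(y, y)` containing no pair that such an element relates.
  obtain ⟨A, B, -, hB, hA1, hB1, hAB⟩ := generalized_tube_lemma (X := C.grp) (Y := C.dom × C.dom)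
    hO.isClosed_compl.isCompact (isCompact_singleton (x := (y, y)))
    (n := {q | q.1 • q.2.1 ≠ q.2.2}) (isOpen_ne_fun (by fun_prop) (by fun_prop)) (by
      rintro ⟨g, q⟩ ⟨hg, hq⟩
      rw [mem_singleton_iff] at hq
      subst hq
      exact fun h => hg (hHO g h))
  obtain ⟨V₁, V₂, hV₁, hV₂, h1, h2, h12⟩ := isOpen_prod_iff.1 hB y y (hB1 rfl)
  refine ⟨V₁ ∩ V₂, hV₁.inter hV₂, ⟨h1, h2⟩, fun z hz z' hz' g hg => ?_⟩
  by_contra hgO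
  exact hAB (show (g, (z, z')) ∈ A ×ˢ B from ⟨hA1 hgO, h12 ⟨hz.1, hz'.2⟩⟩) hg

/-- Orbits are locally parametrized by a complement of the kernel of the derivative of the orbit
map. -/
theorem eventually_exists_smul_eq (y : C.dom) {R : Submodule ℝ (Euc C.gdim)}
    (hR : IsCompl R (LinearMap.ker (C.orbitDeriv y).toLinearMap)) {N : Set (Euc C.gdim)}
    (hN : N ∈ 𝓝 0) : ∀ᶠ g in 𝓝 (1 : C.grp), ∃ u ∈ R, u ∈ N ∧ C.grpParam u • y = g • y := by
  obtain ⟨Λ⟩ := C.nonempty_linearization y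
  set U : Set (Euc C.gdim) := (fun u => (u, (0 : Euc C.dim))) ⁻¹' Λ.actDomain
  have hU : IsOpen U := Λ.isOpen_actDomain.preimage (by fun_prop)
  have h0 : (0 : Euc C.gdim) ∈ U := Λ.zero_mem_actDomain
  have hs : ContDiffOn ℝ ∞ (fun u => Λ.act (u, 0)) U :=
    Λ.contDiffOn_act.comp (by fun_prop : ContDiff ℝ ∞ fun u => (u, (0 : Euc C.dim))).contDiffOn
      fun u hu => hu
  have hd : fderiv ℝ (fun u => Λ.act (u, 0)) 0 = C.orbitDeriv y := Λ.hasFDerivAt_act_left.fderiv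
  -- The rank of the orbit map is maximal at the unit, so near it all values are already taken on
  -- the complement `R`.
  have key := hs.exists_mem_compl_ker hU h0 (fun u hu => by
    rw [hd]
    exact Λ.finrank_range_fderiv_act_le hu) (R := R) (by rwa [hd])
    (N := N ∩ U) (Filter.inter_mem hN (hU.mem_nhds h0))
  filter_upwards [C.eventually_exists_grpParam_eq (key.and (hU.mem_nhds h0))]
  rintro g ⟨x, ⟨⟨u, huR, ⟨huN, huU⟩, hu⟩, hx⟩, rfl⟩
  refine ⟨u, huR, huN, ?_⟩
  rw [zero_add] at hu
  have h1 : C.grpParam u • Λ.toHomeo.symm 0 ∈ Λ.toHomeo.source := huU.2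
  have h2 : C.grpParam x • Λ.toHomeo.symm 0 ∈ Λ.toHomeo.source := hx.2
  have h3 := Λ.toHomeo.injOn h1 h2 hu
  rwa [Λ.symm_zero] at h3

namespace Linearization

variable {C} {y : C.dom} (Λ : C.Linearization y)

theorem isotropyRep_mem_target {b : Euc C.dim} (hb : b ∈ Λ.toHomeo.target)
    (k : MulAction.stabilizer C.grp y) :
    C.isotropyRep y k b ∈ Λ.toHomeo.target ∧
      Λ.toHomeo.symm (C.isotropyRep y k b) = (k : C.grp) • Λ.toHomeo.symm b := by
  have hs := Λ.toHomeo.map_target hb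
  have h1 := Λ.map_smul k _ hs
  rw [Λ.toHomeo.right_inv hb] at h1
  have h2 := Λ.smul_mem k _ hs
  rw [← h1]
  exact ⟨Λ.toHomeo.map_source h2, Λ.toHomeo.left_inv h2⟩

/-- The slice theorem: near `y` there is a slice `symm '' D` for the action, given in linearizing
coordinates by an open subset `D` of an invariant complement `N` of the tangent space of the
orbit. -/
theorem exists_slice : ∃ (N : Submodule ℝ (Euc C.dim)) (W : Set C.dom) (b : C.dom → N) (D : Set N),
    IsCompl (C.orbitTangent y) N ∧ (∀ k, ∀ v ∈ N, C.isotropyRep y k v ∈ N) ∧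
    IsOpen W ∧ y ∈ W ∧ IsOpen D ∧
    ContMDiffOn (𝓡 C.dim) 𝓘(ℝ, N) ∞ b W ∧
    (∀ z ∈ W, b z ∈ D ∧ ∃ g : C.grp, z = g • Λ.toHomeo.symm (b z)) ∧
    (∀ v ∈ D, (v : Euc C.dim) ∈ Λ.toHomeo.target ∧ Λ.toHomeo.symm v ∈ W ∧
      b (Λ.toHomeo.symm v) = v) ∧
    (∀ v ∈ D, ∀ v' ∈ D, ∀ g : C.grp, g • Λ.toHomeo.symm (v : Euc C.dim) = Λ.toHomeo.symm v' →
      g ∈ MulAction.stabilizer C.grp y) ∧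
    (C.gdim = 0 → ∀ z ∈ W, Λ.toHomeo.symm (b z) = z) := by
  set L := C.orbitDeriv y with hL
  set ρ := C.isotropyRep y with hρ
  obtain ⟨R, hR'⟩ := exists_isCompl (LinearMap.ker L.toLinearMap)
  have hR := hR'.symm
  obtain ⟨N, hN, hNinv⟩ := exists_invariant_isCompl (C.continuous_isotropyRep y)
    (fun k v hv => C.isotropyRep_mem_orbitTangent y k hv)
  set ι : R × N →L[ℝ] Euc C.gdim × Euc C.dim := R.subtypeL.prodMap N.subtypeL with hι
  -- The derivative of the action at the origin, restricted to a complement `R` of the infinitesimal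
  -- isotropy and a complement `N` of the orbit directions. It is injective, and the dimensions
  -- match.
  set T : R × N →L[ℝ] Euc C.dim := (L.coprod (ContinuousLinearMap.id ℝ (Euc C.dim))).comp ι
  have hTapp : ∀ q : R × N, T q = L q.1 + q.2 := fun q => rfl
  have hTinj : Function.Injective T := by
    refine (injective_iff_map_eq_zero _).2 fun q hq => ?_
    rw [hTapp] at hq
    have h1 : L q.1 ∈ C.orbitTangent y := ⟨_, rfl⟩
    have h2 : L q.1 = -(q.2 : Euc C.dim) := eq_neg_of_add_eq_zero_left hq
    have h3 : L q.1 ∈ C.orbitTangent y ⊓ N := ⟨h1, h2 ▸ N.neg_mem q.2.2⟩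
    rw [hN.inf_eq_bot, Submodule.mem_bot] at h3
    have h4 : (q.1 : Euc C.gdim) ∈ R ⊓ LinearMap.ker L.toLinearMap := ⟨q.1.2, h3⟩
    rw [hR.inf_eq_bot, Submodule.mem_bot] at h4
    rw [h3, eq_comm, neg_eq_zero] at h2
    exact Prod.ext (Subtype.ext h4) (Subtype.ext h2)
  have hdim : Module.finrank ℝ (R × N) = Module.finrank ℝ (Euc C.dim) := by
    have h1 := Submodule.finrank_add_eq_of_isCompl hR
    have h2 := Submodule.finrank_add_eq_of_isCompl hN
    have h3 := LinearMap.finrank_range_add_finrank_ker L.toLinearMap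
    rw [C.orbitTangent_eq, ← hL] at h2
    rw [Module.finrank_prod]
    omega
  set E : (R × N) ≃L[ℝ] Euc C.dim :=
    (LinearEquiv.ofInjectiveOfFinrankEq T.toLinearMap hTinj hdim).toContinuousLinearEquiv
  have hE : (E : R × N →L[ℝ] Euc C.dim) = T := rfl
  have hd : HasFDerivAt (Λ.act ∘ ι) (E : R × N →L[ℝ] Euc C.dim) 0 := by
    rw [hE]
    refine HasFDerivAt.comp (g := Λ.act) (0 : R × N) ?_ ι.hasFDerivAt
    rw [map_zero]
    exact Λ.hasFDerivAt_act
  obtain ⟨h, hh, h0s, hsU, hsm⟩ := ContDiffOn.exists_openPartialHomeomorph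
    (Λ.isOpen_actDomain.preimage ι.continuous)
    (Λ.contDiffOn_act.comp ι.contDiff.contDiffOn fun q hq => hq)
    (show (0 : R × N) ∈ ι ⁻¹' Λ.actDomain by
      rw [mem_preimage, map_zero]
      exact Λ.zero_mem_actDomain) hd
  have hh' : ∀ q : R × N, h q = Λ.toHomeo (C.grpParam q.1 • Λ.toHomeo.symm q.2) :=
    fun q => congrFun hh q
  have hdom : ∀ q ∈ h.source, (q.2 : Euc C.dim) ∈ Λ.toHomeo.target ∧
      C.grpParam q.1 • Λ.toHomeo.symm (q.2 : Euc C.dim) ∈ Λ.toHomeo.source := fun q hq =>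
    ⟨(hsU hq).1.2, (hsU hq).2⟩
  obtain ⟨A, B, hA, hB, h0A, h0B, hAB⟩ := isOpen_prod_iff.1 h.open_source 0 0 h0s
  obtain ⟨A', hA', rfl⟩ := isOpen_induced_iff.1 hA
  obtain ⟨B', hB', rfl⟩ := isOpen_induced_iff.1 hB
  -- group elements near the isotropy group
  obtain ⟨O₁, hO₁, hO₁o, h1O₁⟩ := eventually_nhds_iff.1
    (C.eventually_exists_smul_eq y hR (hA'.mem_nhds h0A))
  set O : Set C.grp := ⋃ k : MulAction.stabilizer C.grp y, (fun g => g * (k : C.grp)⁻¹) ⁻¹' O₁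
  obtain ⟨V, hV, hyV, hVO⟩ := C.exists_nhds_forall_smul_eq_mem y (O := O)
    (isOpen_iUnion fun k => hO₁o.preimage (by fun_prop))
    (fun g hg => mem_iUnion.2 ⟨⟨g, hg⟩, by simpa using h1O₁⟩)
  have hDo : IsOpen {v : Euc C.dim | ∀ k, ρ k v ∈ B'} :=
    isOpen_setOf_forall_mem (m := fun k v => ρ k v)
      (((C.continuous_isotropyRep y).comp continuous_fst).clm_apply continuous_snd) hB'
  -- Two conditions on `D`: all isotropy translates of its points remain in the product
  -- neighbourhood where `h` is injective, and its points lie in `V`, so that only elements of `O`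
  -- relate them.
  set D : Set N := Subtype.val ⁻¹' ({v : Euc C.dim | ∀ k, ρ k v ∈ B'} ∩
    (Λ.toHomeo.target ∩ Λ.toHomeo.symm ⁻¹' V)) with hD
  have hDopen : IsOpen D := (hDo.inter (Λ.toHomeo.isOpen_inter_preimage_symm hV)).preimage
    continuous_subtype_val
  have h0D : (0 : N) ∈ D := by
    refine ⟨fun k => ?_, Λ.zero_mem_target, ?_⟩
    · rw [show ((0 : N) : Euc C.dim) = 0 from rfl, map_zero]
      exact h0B
    · change Λ.toHomeo.symm 0 ∈ V
      rwa [Λ.symm_zero]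
  have hsource : ∀ v ∈ D, ∀ u ∈ (Subtype.val ⁻¹' A' : Set R), (u, v) ∈ h.source := fun v hv u hu =>
    hAB ⟨hu, by simpa using hv.1 1⟩
  have hfst : ∀ v : N, (v : Euc C.dim) ∈ Λ.toHomeo.target → h (0, v) = v := fun v hv => by
    rw [hh']
    exact Λ.act_zero_left hv
  set b : C.dom → N := fun z => (h.symm (Λ.toHomeo z)).2 with hb
  set S : Set (Euc C.dim) := h.target ∩ h.symm ⁻¹' ((Subtype.val ⁻¹' A') ×ˢ D)
  have hS : IsOpen S := h.isOpen_inter_preimage_symm (hA.prod hDopen)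
  set W : Set C.dom := Λ.toHomeo.source ∩ Λ.toHomeo ⁻¹' S
  have hslice : ∀ v ∈ D, Λ.toHomeo.symm (v : Euc C.dim) ∈ W ∧ b (Λ.toHomeo.symm v) = v := by
    intro v hv
    have h1 := hsource v hv 0 h0A
    have h2 : Λ.toHomeo (Λ.toHomeo.symm (v : Euc C.dim)) = h (0, v) := by
      rw [hfst v hv.2.1, Λ.toHomeo.right_inv hv.2.1]
    refine ⟨⟨Λ.toHomeo.map_target hv.2.1, ?_⟩, ?_⟩
    · rw [mem_preimage, h2]
      refine ⟨h.map_source h1, ?_⟩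
      rw [mem_preimage, h.left_inv h1]
      exact ⟨h0A, hv⟩
    · rw [hb]
      simp only [h2, h.left_inv h1]
  have hpoint : ∀ z ∈ W, z = C.grpParam (h.symm (Λ.toHomeo z)).1 • Λ.toHomeo.symm (b z) := by
    intro z hz
    have h1 := h.map_target hz.2.1
    have h2 := h.right_inv hz.2.1
    rw [hh'] at h2
    exact (Λ.toHomeo.injOn (hdom _ h1).2 hz.1 h2).symm
  refine ⟨N, W, b, D, hN, hNinv, Λ.toHomeo.isOpen_inter_preimage hS, ?_, hDopen, ?_, ?_, ?_, ?_, ?_⟩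
  · have := (hslice 0 h0D).1
    rwa [show ((0 : N) : Euc C.dim) = 0 from rfl, Λ.symm_zero] at this
  · refine ContMDiffOn.comp (g := fun a => (h.symm a).2) (f := Λ.toHomeo) (t := h.target)
      (I' := 𝓡 C.dim) ?_ (Λ.smooth.mono inter_subset_left) fun z hz => hz.2.1
    exact contMDiffOn_iff_contDiffOn.2 (contDiff_snd.comp_contDiffOn hsm)
  · exact fun z hz => ⟨hz.2.2.2, _, hpoint z hz⟩
  · exact fun v hv => ⟨hv.2.1, hslice v hv⟩
  · intro v hv v' hv' g hg
    obtain ⟨k, hk⟩ := mem_iUnion.1 (hVO _ hv.2.2 _ hv'.2.2 g hg)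
    -- This writes `g` as `grpParam u` times an isotropy element `k₂`, with small `u ∈ R`. Then `(u,
    -- k₂ v)` and `(0, v')` have the same image under `h`, which forces `u = 0`.
    obtain ⟨u, huR, huA, hu⟩ := hO₁ _ hk
    set k₁ : C.grp := (C.grpParam u)⁻¹ * (g * (k : C.grp)⁻¹)
    have hk₁ : k₁ ∈ MulAction.stabilizer C.grp y := by
      rw [MulAction.mem_stabilizer_iff, mul_smul, ← hu, inv_smul_smul]
    set k₂ : MulAction.stabilizer C.grp y := ⟨k₁, hk₁⟩ * k
    have hg2 : g = C.grpParam u * k₂ := by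
      simp [k₂, k₁, mul_assoc]
    set v₂ : N := ⟨ρ k₂ v, hNinv k₂ v v.2⟩
    have hv₂ := Λ.isotropyRep_mem_target hv.2.1 k₂
    have h1 : ((⟨u, huR⟩ : R), v₂) ∈ h.source := hAB ⟨huA, hv.1 k₂⟩
    have h2 : h (⟨u, huR⟩, v₂) = h (0, v') := by
      rw [hfst v' hv'.2.1, hh']
      change Λ.toHomeo (C.grpParam u • Λ.toHomeo.symm (ρ k₂ v)) = v'
      rw [hv₂.2, smul_smul, ← hg2, hg, Λ.toHomeo.right_inv hv'.2.1]
    have h3 := h.injOn h1 (hsource v' hv' 0 h0A) h2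
    have h4 : u = 0 := congrArg (fun q : R × N => (q.1 : Euc C.gdim)) h3
    rw [hg2, h4, C.grpParam_zero, one_mul]
    exact k₂.2
  -- If the group has dimension zero, the only group coordinate is `0`, whose group element is the
  -- unit.
  · intro hg0 z hz
    have h1 := hpoint z hz
    have h2 : ((h.symm (Λ.toHomeo z)).1 : Euc C.gdim) = 0 := by
      have : Subsingleton (Euc C.gdim) := by
        rw [hg0]
        infer_instance
      exact Subsingleton.elim _ _
    rw [h2, C.grpParam_zero, one_smul] at h1
    exact h1.symm

end Linearization

end OrbispaceChart

/-! ### Two-forms -/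

section Forms

variable {n : ℕ}

theorem vecCons_update_zero {E : Type*} (a b c : E) : Function.update ![a, b] 0 c = ![c, b] := by
  ext i; fin_cases i <;> rfl

theorem vecCons_update_one {E : Type*} (a b c : E) : Function.update ![a, b] 1 c = ![a, c] := by
  ext i; fin_cases i <;> rfl

theorem ContinuousAlternatingMap.map_add_zero (η : Euc n [⋀^Fin 2]→L[ℝ] ℝ) (a a' b : Euc n) :
    η ![a + a', b] = η ![a, b] + η ![a', b] := by
  have := η.map_update_add ![a, b] 0 a a'
  simpa only [vecCons_update_zero] using this

theorem ContinuousAlternatingMap.map_smul_zero (η : Euc n [⋀^Fin 2]→L[ℝ] ℝ) (c : ℝ) (a b : Euc n) :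
    η ![c • a, b] = c * η ![a, b] := by
  have := η.map_update_smul ![a, b] 0 c a
  simpa only [vecCons_update_zero, smul_eq_mul] using this

theorem ContinuousAlternatingMap.map_add_one (η : Euc n [⋀^Fin 2]→L[ℝ] ℝ) (a b b' : Euc n) :
    η ![a, b + b'] = η ![a, b] + η ![a, b'] := by
  have := η.map_update_add ![a, b] 1 b b'
  simpa only [vecCons_update_one] using this

theorem ContinuousAlternatingMap.map_smul_one (η : Euc n [⋀^Fin 2]→L[ℝ] ℝ) (c : ℝ) (a b : Euc n) :
    η ![a, c • b] = c * η ![a, b] := by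
  have := η.map_update_smul ![a, b] 1 c b
  simpa only [vecCons_update_one, smul_eq_mul] using this

theorem vecCons_eta {E : Type*} (v : Fin 2 → E) : ![v 0, v 1] = v := by
  ext i; fin_cases i <;> rfl

/-- Values on basis vectors. -/
def formCoords (n : ℕ) : (Euc n [⋀^Fin 2]→L[ℝ] ℝ) →ₗ[ℝ] (Fin n → Fin n → ℝ) where
  toFun η i j := η ![EuclideanSpace.basisFun (Fin n) ℝ i, EuclideanSpace.basisFun (Fin n) ℝ j]
  map_add' _ _ := rfl
  map_smul' _ _ := rfl

theorem formCoords_injective : Function.Injective (formCoords n) := by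
  intro η η' h
  apply ContinuousAlternatingMap.toAlternatingMap_injective
  refine Module.Basis.ext_alternating (EuclideanSpace.basisFun (Fin n) ℝ).toBasis fun v _ => ?_
  have h1 := congrFun (congrFun h (v 0)) (v 1)
  have h2 : (fun i => (EuclideanSpace.basisFun (Fin n) ℝ).toBasis (v i)) =
      ![EuclideanSpace.basisFun (Fin n) ℝ (v 0), EuclideanSpace.basisFun (Fin n) ℝ (v 1)] := by
    ext1 i
    fin_cases i <;> simp
  rw [h2]
  exact h1

instance : FiniteDimensional ℝ (Euc n [⋀^Fin 2]→L[ℝ] ℝ) :=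
  FiniteDimensional.of_injective (formCoords n) formCoords_injective

/-- A two-form as a bilinear map. -/
def flatAux (η : Euc n [⋀^Fin 2]→L[ℝ] ℝ) : Euc n →L[ℝ] Euc n →L[ℝ] ℝ :=
  LinearMap.toContinuousLinearMap
    { toFun := fun a => LinearMap.toContinuousLinearMap
        { toFun := fun b => η ![a, b]
          map_add' := η.map_add_one a
          map_smul' := fun c b => η.map_smul_one c a b }
      map_add' := fun a a' => by
        ext b
        exact η.map_add_zero a a' b
      map_smul' := fun c a => by
        ext b
        exact η.map_smul_zero c a b }

/-- The linear map which takes two-forms to bilinear maps. -/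
def flatL : (Euc n [⋀^Fin 2]→L[ℝ] ℝ) →L[ℝ] Euc n →L[ℝ] Euc n →L[ℝ] ℝ :=
  LinearMap.toContinuousLinearMap
    { toFun := flatAux
      map_add' := fun _ _ => rfl
      map_smul' := fun _ _ => rfl }

theorem flatL_swap (η : Euc n [⋀^Fin 2]→L[ℝ] ℝ) (a b : Euc n) : flatL η a b = -flatL η b a := by
  have h := η.map_swap ![b, a] (i := 0) (j := 1) (by simp)
  have h2 : (![b, a] ∘ Equiv.swap (0 : Fin 2) 1) = ![a, b] := by
    ext1 i
    fin_cases i <;> rfl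
  rw [h2] at h
  exact h

theorem flatL_injective : Function.Injective (flatL (n := n)) := by
  intro η η' h
  ext v
  rw [← vecCons_eta v]
  exact DFunLike.congr_fun (DFunLike.congr_fun h (v 0)) (v 1)

/-- The evaluation of two-forms at a pair of vectors. -/
def evalL (a b : Euc n) : (Euc n [⋀^Fin 2]→L[ℝ] ℝ) →L[ℝ] ℝ :=
  LinearMap.toContinuousLinearMap
    { toFun := fun η => η ![a, b]
      map_add' := fun _ _ => rfl
      map_smul' := fun _ _ => rfl }

/-- Only finitely many basis coefficients matter, and the map to coefficients has a linear left
inverse. -/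
theorem contDiffOn_form_iff {E : Type*} [NormedAddCommGroup E] [NormedSpace ℝ E]
    {η : E → Euc n [⋀^Fin 2]→L[ℝ] ℝ} {s : Set E} :
    ContDiffOn ℝ ∞ η s ↔ ∀ a b, ContDiffOn ℝ ∞ (fun x => flatL (η x) a b) s := by
  constructor
  · intro h a b
    exact (evalL a b).contDiff.comp_contDiffOn h
  · intro h
    have h1 : ContDiffOn ℝ ∞ (fun x => formCoords n (η x)) s :=
      contDiffOn_pi.2 fun a => contDiffOn_pi.2 fun b => h _ _
    obtain ⟨l, hl⟩ := (formCoords n).exists_leftInverse_of_injective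
      (LinearMap.ker_eq_bot.2 formCoords_injective)
    have h2 : η = fun x => l.toContinuousLinearMap (formCoords n (η x)) := by
      ext1 x
      exact (LinearMap.congr_fun hl (η x)).symm
    rw [h2]
    exact l.toContinuousLinearMap.contDiff.comp_contDiffOn h1

theorem ContDiffOn.flatL {E : Type*} [NormedAddCommGroup E] [NormedSpace ℝ E]
    {η : E → Euc n [⋀^Fin 2]→L[ℝ] ℝ} {s : Set E} (h : ContDiffOn ℝ ∞ η s) :
    ContDiffOn ℝ ∞ (fun x => flatL (η x)) s :=
  contDiffOn_clm_apply.2 fun a => contDiffOn_clm_apply.2 fun b => contDiffOn_form_iff.1 h a b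

theorem flatL_compContinuousLinearMap {m : ℕ} (η : Euc n [⋀^Fin 2]→L[ℝ] ℝ)
    (D : Euc m →L[ℝ] Euc n) (a b : Euc m) :
    flatL (η.compContinuousLinearMap D) a b = flatL η (D a) (D b) := by
  change η (D ∘ ![a, b]) = η ![D a, D b]
  congr 1
  ext1 j
  fin_cases j <;> rfl

/-- Presents the derivative as a map of model spaces instead of tangent spaces, which keeps later
compositions free of type identifications. -/
theorem MDifferentiableAt.exists_hasMFDerivAt {m : ℕ} {N M : Type*} [TopologicalSpace N]
    [ChartedSpace (Euc m) N] [TopologicalSpace M] [ChartedSpace (Euc n) M] {i : N → M} {z : N}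
    (h : MDifferentiableAt (𝓡 m) (𝓡 n) i z) :
    ∃ D : Euc m →L[ℝ] Euc n, HasMFDerivAt (𝓡 m) (𝓡 n) i z D :=
  ⟨_, h.hasMFDerivAt⟩

theorem ContMDiffOn.exists_hasMFDerivAt {m : ℕ} {N M : Type*} [TopologicalSpace N]
    [ChartedSpace (Euc m) N] [TopologicalSpace M] [ChartedSpace (Euc n) M] {i : N → M} {s : Set N}
    (h : ContMDiffOn (𝓡 m) (𝓡 n) ∞ i s) (hs : IsOpen s) {z : N} (hz : z ∈ s) :
    ∃ D : Euc m →L[ℝ] Euc n, HasMFDerivAt (𝓡 m) (𝓡 n) i z D :=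
  ((h.contMDiffAt (hs.mem_nhds hz)).mdifferentiableAt (by simp)).exists_hasMFDerivAt

variable {M : Type*} [TopologicalSpace M] [ChartedSpace (Euc n) M]

/-- The value of a two-form at a point as a bilinear map. -/
def TwoForm.flat (Ω : TwoForm n M) (x : M) : Euc n →L[ℝ] Euc n →L[ℝ] ℝ :=
  flatL (show Euc n [⋀^Fin 2]→L[ℝ] ℝ from Ω x)

theorem TwoForm.ext_flat {Ω Ω' : TwoForm n M} {x : M} (h : ∀ a b, Ω.flat x a b = Ω'.flat x a b) :
    Ω x = Ω' x := by
  refine flatL_injective (n := n) ?_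
  ext1 a
  ext1 b
  exact h a b

theorem TwoForm.flat_pullback {m : ℕ} {N : Type*} [TopologicalSpace N] [ChartedSpace (Euc m) N]
    (Ω : TwoForm n M) {i : N → M} {z : N} {D : Euc m →L[ℝ] Euc n}
    (h : HasMFDerivAt (𝓡 m) (𝓡 n) i z D) (a b : Euc m) :
    (Ω.pullback i).flat z a b = Ω.flat (i z) (D a) (D b) := by
  have h1 : mfderiv (𝓡 m) (𝓡 n) i z = D := h.mfderiv
  change Ω (i z) (mfderiv (𝓡 m) (𝓡 n) i z ∘ ![a, b]) = Ω (i z) ![D a, D b]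
  rw [h1]
  congr 1
  ext1 j
  fin_cases j <;> rfl

theorem TwoForm.flat_swap (Ω : TwoForm n M) (x : M) (a b : Euc n) :
    Ω.flat x a b = -Ω.flat x b a := flatL_swap _ a b

variable [IsManifold (𝓡 n) ∞ M]

theorem hasMFDerivAt_atlas {e : OpenPartialHomeomorph M (Euc n)} (he : e ∈ atlas (Euc n) M) {x : M}
    (hx : x ∈ e.source) : ∃ (D : Euc n →L[ℝ] Euc n) (D' : Euc n →L[ℝ] Euc n),
      HasMFDerivAt (𝓡 n) (𝓡 n) e x D ∧ HasMFDerivAt (𝓡 n) (𝓡 n) e.symm (e x) D' ∧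
      (∀ v, D' (D v) = v) ∧ ∀ v, D (D' v) = v := by
  have h1 : MDifferentiableAt (𝓡 n) (𝓡 n) e x := mdifferentiableAt_atlas he hx
  have h2 : MDifferentiableAt (𝓡 n) (𝓡 n) e.symm (e x) :=
    mdifferentiableAt_atlas_symm he (e.map_source hx)
  have h1' : HasMFDerivAt (𝓡 n) (𝓡 n) e (e.symm (e x)) (mfderiv (𝓡 n) (𝓡 n) e x) := by
    rw [e.left_inv hx]
    exact h1.hasMFDerivAt
  refine ⟨mfderiv (𝓡 n) (𝓡 n) e x, mfderiv (𝓡 n) (𝓡 n) e.symm (e x), h1.hasMFDerivAt,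
    h2.hasMFDerivAt, fun v => ?_, fun v => ?_⟩
  · have h3 := h2.hasMFDerivAt.comp x h1.hasMFDerivAt
    have h4 : HasMFDerivAt (𝓡 n) (𝓡 n) (e.symm ∘ e) x (ContinuousLinearMap.id ℝ (Euc n)) :=
      (hasMFDerivAt_id x).congr_of_eventuallyEq
        (Filter.eventually_of_mem (e.open_source.mem_nhds hx) fun z hz => e.left_inv hz)
    exact DFunLike.congr_fun (hasMFDerivAt_unique h3 h4) v
  · have h3 := h1'.comp (e x) h2.hasMFDerivAt
    have h4 : HasMFDerivAt (𝓡 n) (𝓡 n) (e ∘ e.symm) (e x) (ContinuousLinearMap.id ℝ (Euc n)) :=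
      (hasMFDerivAt_id (e x)).congr_of_eventuallyEq
        (Filter.eventually_of_mem (e.open_target.mem_nhds (e.map_source hx))
          fun z hz => e.right_inv hz)
    exact DFunLike.congr_fun (hasMFDerivAt_unique h3 h4) v

theorem IsSymplecticForm.eq_zero {Ω : TwoForm n M} (hΩ : IsSymplecticForm Ω) {x : M} {v : Euc n}
    (h : ∀ w, Ω.flat x v w = 0) : v = 0 := by
  set e := chartAt (Euc n) x
  have hx : x ∈ e.source := mem_chart_source _ x
  obtain ⟨D, D', -, hD', h1, h2⟩ := hasMFDerivAt_atlas (chart_mem_atlas (Euc n) x) hx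
  have h3 := (hΩ e (chart_mem_atlas (Euc n) x)).nondegenerate (e x) (e.map_source hx) (D v)
    (fun w => by
      change (Ω.pullback e.symm).flat (e x) (D v) w = 0
      rw [Ω.flat_pullback hD', e.left_inv hx, h1]
      exact h _)
  rw [← h1 v, h3, map_zero]

/-- The pullback of a symplectic form to an open subset of a Euclidean space is smooth and
closed. -/
theorem IsSymplecticForm.pullback {Ω : TwoForm n M} (hΩ : IsSymplecticForm Ω) {k : ℕ}
    {O : Set (Euc k)} (hO : IsOpen O) {i : Euc k → M} (hi : ContMDiffOn (𝓡 k) (𝓡 n) ∞ i O) :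
    ContDiffOn ℝ ∞ (F := Euc k [⋀^Fin 2]→L[ℝ] ℝ) (TwoForm.pullback (m := k) i Ω) O ∧
      ∀ z ∈ O, extDeriv (TwoForm.pullback (m := k) i Ω : Euc k → Euc k [⋀^Fin 2]→L[ℝ] ℝ) z = 0 := by
  -- Locally the form is the pullback of a symplectic form ξ on a Euclidean open set along a smooth
  -- map ψ. There the exterior derivative commutes with pullback.
  have key : ∀ z ∈ O, ∃ (U : Set (Euc k)) (ψ : Euc k → Euc n)
      (ξ : Euc n → Euc n [⋀^Fin 2]→L[ℝ] ℝ) (T : Set (Euc n)), IsOpen U ∧ z ∈ U ∧ IsOpen T ∧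
      ContDiffOn ℝ ∞ ψ U ∧ MapsTo ψ U T ∧ IsSymplecticOn ξ T ∧
      ∀ x ∈ U, (TwoForm.pullback (m := k) i Ω) x =
        (ξ (ψ x)).compContinuousLinearMap (fderiv ℝ ψ x) := by
    intro z hz
    set e := chartAt (Euc n) (i z) with he
    set U := O ∩ i ⁻¹' e.source
    have hU : IsOpen U := hi.continuousOn.isOpen_inter_preimage hO e.open_source
    have hψm : ContMDiffOn (𝓡 k) (𝓡 n) ∞ (e ∘ i) U :=
      ContMDiffOn.comp (g := e) (t := e.source) (contMDiffOn_chart (I := 𝓡 n) (n := ∞))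
        (hi.mono inter_subset_left) fun x hx => hx.2
    have hψ : ContDiffOn ℝ ∞ (e ∘ i) U := contMDiffOn_iff_contDiffOn.1 hψm
    refine ⟨U, e ∘ i, TwoForm.pullback (m := n) e.symm Ω, e.target, hU,
      ⟨hz, mem_chart_source _ _⟩, e.open_target, hψ, fun x hx => e.map_source hx.2,
      hΩ e (chart_mem_atlas _ _), fun x hx => ?_⟩
    obtain ⟨D, D', hD, hD', h1, h2⟩ := hasMFDerivAt_atlas (chart_mem_atlas (Euc n) (i z)) hx.2
    obtain ⟨D₀, hix⟩ := hi.exists_hasMFDerivAt hO hx.1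
    have hd : HasFDerivAt (e ∘ i) (D.comp D₀) x := hasMFDerivAt_iff_hasFDerivAt.1 (hD.comp x hix)
    rw [hd.fderiv]
    refine flatL_injective (n := k) ?_
    ext1 a
    ext1 b
    refine Eq.trans ?_ (flatL_compContinuousLinearMap _ _ a b).symm
    have h3 := Ω.flat_pullback hD' (D (D₀ a)) (D (D₀ b))
    rw [e.left_inv hx.2, h1, h1] at h3
    exact (Ω.flat_pullback hix a b).trans h3.symm
  constructor
  · intro z hz
    obtain ⟨U, ψ, ξ, T, hU, hzU, hT, hψ, hψT, hξ, heq⟩ := key z hz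
    have h1 : ContDiffOn ℝ ∞ (fun x => (ξ (ψ x)).compContinuousLinearMap (fderiv ℝ ψ x)) U := by
      refine contDiffOn_form_iff.2 fun a b => ?_
      have h2 : ContDiffOn ℝ ∞ (fun x => flatL (ξ (ψ x)) (fderiv ℝ ψ x a) (fderiv ℝ ψ x b)) U := by
        have h3 := hψ.fderiv_of_isOpen hU (m := ∞) (by simp)
        exact ((hξ.smooth.comp hψ hψT).flatL.clm_apply
          (h3.clm_apply contDiffOn_const)).clm_apply (h3.clm_apply contDiffOn_const)
      exact h2.congr fun x _ => flatL_compContinuousLinearMap _ _ a b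
    exact ((h1.congr fun x hx => heq x hx).contDiffAt (hU.mem_nhds hzU)).contDiffWithinAt
  · intro z hz
    obtain ⟨U, ψ, ξ, T, hU, hzU, hT, hψ, hψT, hξ, heq⟩ := key z hz
    have h1 : (TwoForm.pullback (m := k) i Ω : Euc k → Euc k [⋀^Fin 2]→L[ℝ] ℝ) =ᶠ[𝓝 z]
        fun x => (ξ (ψ x)).compContinuousLinearMap (fderiv ℝ ψ x) :=
      Filter.eventually_of_mem (hU.mem_nhds hzU) heq
    have hξd : DifferentiableAt ℝ ξ (ψ z) :=
      (hξ.smooth.contDiffAt (hT.mem_nhds (hψT hzU))).differentiableAt (by simp)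
    have h2 := extDeriv_pullback (r := ∞) hξd
      (hψ.contDiffAt (hU.mem_nhds hzU)) (by
        rw [minSmoothness_of_isRCLikeNormedField]
        exact ENat.LEInfty.out)
    rw [hξ.closed _ (hψT hzU)] at h2
    rw [h1.extDeriv_eq, h2]
    rfl

end Forms

/-! ### Local parametrizations -/

section LocalParametrization

variable {n k : ℕ} {M : Type*} [TopologicalSpace M] [ChartedSpace (Euc n) M]
  {A : Set M} {O : Set (Euc k)} {i : Euc k → M}

theorem IsLocalParametrization.map_mem (h : IsLocalParametrization n A O i) {z : Euc k}
    (hz : z ∈ O) : i z ∈ A := by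
  obtain ⟨V, -, hV⟩ := h.open_image
  exact ((hV ▸ mem_image_of_mem i hz : i z ∈ A ∩ V)).1

theorem IsLocalParametrization.restrict (h : IsLocalParametrization n A O i) {W : Set M}
    (hW : IsOpen W) : IsLocalParametrization n A (O ∩ i ⁻¹' W) i where
  isOpen := h.smooth.continuousOn.isOpen_inter_preimage h.isOpen hW
  smooth := h.smooth.mono inter_subset_left
  immersive z hz := h.immersive z hz.1
  embedding := h.embedding.comp (IsEmbedding.inclusion (inter_subset_left (s := O) (t := i ⁻¹' W)))
  open_image := by
    obtain ⟨V, hV, hiV⟩ := h.open_image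
    refine ⟨V ∩ W, hV.inter hW, ?_⟩
    rw [image_inter_preimage, hiV, inter_assoc]

variable [IsManifold (𝓡 n) ∞ M]

/-- Parametrizations of a subset have smooth local left inverses on the ambient manifold. -/
theorem IsLocalParametrization.exists_retract (h : IsLocalParametrization n A O i) {z : Euc k}
    (hz : z ∈ O) : ∃ (r : M → Euc k) (V : Set M), IsOpen V ∧ i z ∈ V ∧
      ContMDiffOn (𝓡 n) (𝓡 k) ∞ r V ∧ (∀ᶠ z' in 𝓝 z, r (i z') = z') ∧
      ∀ᶠ q in 𝓝 (i z), q ∈ A → r q ∈ O ∧ i (r q) = q := by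
  set e := chartAt (Euc n) (i z) with he
  set U := O ∩ i ⁻¹' e.source
  have hU : IsOpen U := h.smooth.continuousOn.isOpen_inter_preimage h.isOpen e.open_source
  have hzU : z ∈ U := ⟨hz, mem_chart_source _ _⟩
  have hψm : ContMDiffOn (𝓡 k) (𝓡 n) ∞ (e ∘ i) U :=
    ContMDiffOn.comp (g := e) (t := e.source) (contMDiffOn_chart (I := 𝓡 n) (n := ∞))
      (h.smooth.mono inter_subset_left) fun x hx => hx.2
  have hψ : ContDiffOn ℝ ∞ (e ∘ i) U := contMDiffOn_iff_contDiffOn.1 hψm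
  obtain ⟨D, hD⟩ := h.smooth.exists_hasMFDerivAt h.isOpen hz
  have hDinj : Function.Injective D := by
    have := h.immersive z hz
    rwa [hD.mfderiv] at this
  have hd : HasFDerivAt (e ∘ i) D z :=
    hasMFDerivAt_iff_hasFDerivAt.1 ((hasMFDerivAt_chartAt (i z)).comp z hD)
  obtain ⟨r, V, hV, hzV, hr, hri⟩ := hψ.exists_left_inverse hU hzU (by rwa [hd.fderiv])
  refine ⟨r ∘ e, e.source ∩ e ⁻¹' V, e.isOpen_inter_preimage hV, ⟨mem_chart_source _ _, hzV⟩, ?_,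
    hri, ?_⟩
  · exact ContMDiffOn.comp (g := r) (t := V) (contMDiffOn_iff_contDiffOn.2 hr)
      ((contMDiffOn_chart (I := 𝓡 n) (n := ∞)).mono inter_subset_left) fun x hx => hx.2
  -- As `i` is an embedding, points of its image that are close to `i z` in `M` have parameters
  -- close to `z`, where `r` is known to invert `i`.
  · have h1 : {p : O | r (e (i p)) = p} ∈ 𝓝 (⟨z, hz⟩ : O) :=
      continuousAt_subtype_val.eventually (p := fun z' => r (e (i z')) = z') hri
    rw [h.embedding.nhds_eq_comap, mem_comap] at h1
    obtain ⟨V₁, hV₁, hV₁s⟩ := h1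
    obtain ⟨V₂, hV₂, hiV₂⟩ := h.open_image
    have hzV₂ : i z ∈ V₂ := (hiV₂ ▸ mem_image_of_mem i hz : i z ∈ A ∩ V₂).2
    have hV₁' : V₁ ∈ 𝓝 (i z) := hV₁
    filter_upwards [hV₁', hV₂.mem_nhds hzV₂] with q hq1 hq2 hqA
    obtain ⟨z', hz', rfl⟩ : q ∈ i '' O := hiV₂ ▸ ⟨hqA, hq2⟩
    have : r (e (i z')) = z' := hV₁s (show (⟨z', hz'⟩ : O) ∈ O.domRestrict i ⁻¹' V₁ from hq1)
    simp only [Function.comp_apply, this]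
    exact ⟨hz', trivial⟩

/-- Subsets which are given by linear subspaces in smooth coordinates have local
parametrizations. -/
theorem isLocalParametrization_of_linear {Φ : OpenPartialHomeomorph M (Euc n)}
    (hΦ : ContMDiffOn (𝓡 n) (𝓡 n) ∞ Φ Φ.source)
    (hΦ' : ContMDiffOn (𝓡 n) (𝓡 n) ∞ Φ.symm Φ.target) {ι : Euc k →L[ℝ] Euc n}
    (hι : Function.Injective ι) {V : Set M} (hV : IsOpen V) (hVs : V ⊆ Φ.source)
    (hA : ∀ z ∈ V, z ∈ A ↔ Φ z ∈ range ι) :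
    IsLocalParametrization n A (ι ⁻¹' (Φ.target ∩ Φ.symm ⁻¹' V)) (Φ.symm ∘ ι) := by
  obtain ⟨l, hl⟩ := ι.toLinearMap.exists_leftInverse_of_injective (LinearMap.ker_eq_bot.2 hι)
  set L : Euc n →L[ℝ] Euc k := l.toContinuousLinearMap
  have hLι : ∀ v, L (ι v) = v := fun v => LinearMap.congr_fun hl v
  set O : Set (Euc k) := ι ⁻¹' (Φ.target ∩ Φ.symm ⁻¹' V) with hO
  have hOo : IsOpen O := (Φ.isOpen_inter_preimage_symm hV).preimage ι.continuous
  have hsm : ContMDiffOn (𝓡 k) (𝓡 n) ∞ (Φ.symm ∘ ι) O :=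
    ContMDiffOn.comp (g := Φ.symm) (t := Φ.target) hΦ'
      (contMDiffOn_iff_contDiffOn.2 ι.contDiff.contDiffOn) fun u hu => hu.1
  have hleft : ∀ u ∈ O, L (Φ (Φ.symm (ι u))) = u := fun u hu => by
    rw [Φ.right_inv hu.1, hLι]
  have hLΦ : ContMDiffOn (𝓡 n) (𝓡 k) ∞ (L ∘ Φ) Φ.source :=
    ContMDiffOn.comp (g := L) (t := univ) (contMDiffOn_iff_contDiffOn.2 L.contDiff.contDiffOn) hΦ
      fun _ _ => trivial
  refine ⟨hOo, hsm, fun u hu => ?_, ?_, V, hV, ?_⟩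
  · obtain ⟨D, hD⟩ := hsm.exists_hasMFDerivAt hOo hu
    obtain ⟨D', hD'⟩ := hLΦ.exists_hasMFDerivAt Φ.open_source (hVs hu.2)
    have h1 := hD'.comp u hD
    have h2 : HasMFDerivAt (𝓡 k) (𝓡 k) ((L ∘ Φ) ∘ (Φ.symm ∘ ι)) u
        (ContinuousLinearMap.id ℝ (Euc k)) :=
      (hasMFDerivAt_id u).congr_of_eventuallyEq (Filter.eventually_of_mem (hOo.mem_nhds hu) hleft)
    have h3 := hasMFDerivAt_unique h1 h2
    rw [hD.mfderiv]
    exact Function.LeftInverse.injective (g := D') fun v => DFunLike.congr_fun h3 v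
  · set f' : O → V := fun u => ⟨Φ.symm (ι u), u.2.2⟩
    have hf' : Continuous f' := (continuousOn_iff_continuous_domRestrict.1 hsm.continuousOn).subtype_mk _
    have hg' : Continuous fun q : V => L (Φ q) :=
      continuousOn_iff_continuous_domRestrict.1 (hLΦ.continuousOn.mono hVs)
    have h1 : IsEmbedding f' := by
      refine IsEmbedding.of_comp hf' hg' ?_
      have : (fun q : V => L (Φ q)) ∘ f' = Subtype.val := by
        ext1 u
        exact hleft u u.2
      rw [this]
      exact IsEmbedding.subtypeVal
    exact IsEmbedding.subtypeVal.comp h1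
  · ext q
    constructor
    · rintro ⟨u, hu, rfl⟩
      refine ⟨(hA _ hu.2).2 ?_, hu.2⟩
      exact ⟨u, (Φ.right_inv hu.1).symm⟩
    · rintro ⟨hqA, hqV⟩
      obtain ⟨u, hu⟩ := (hA q hqV).1 hqA
      have h1 : Φ.symm (ι u) = q := by rw [hu, Φ.left_inv (hVs hqV)]
      refine ⟨u, ⟨?_, ?_⟩, h1⟩
      · rw [hu]
        exact Φ.map_source (hVs hqV)
      · rw [mem_preimage, h1]
        exact hqV

end LocalParametrization

/-! ### Isotropy submanifolds -/

namespace OrbispaceChart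

variable {X : Type u} [TopologicalSpace X] (C : OrbispaceChart.{u, v, w} X)

/-- The tangent vectors at `y` which are fixed by the isotropy group of `y`. -/
def fixedSpace (y : C.dom) : Submodule ℝ (Euc C.dim) where
  carrier := {v | ∀ k, C.isotropyRep y k v = v}
  add_mem' ha hb k := by rw [map_add, ha k, hb k]
  zero_mem' k := map_zero _
  smul_mem' c v hv k := by rw [map_smul, hv k]

/-- Isotropy groups of points near `y` are subconjugate to the isotropy group of `y`. -/
theorem exists_nhds_stabilizer_le (y : C.dom) : ∃ V : Set C.dom, IsOpen V ∧ y ∈ V ∧ ∀ z ∈ V,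
    ∃ g : C.grp, MulAction.stabilizer C.grp z ≤
      (MulAction.stabilizer C.grp y).map (MulAut.conj g).toMonoidHom := by
  obtain ⟨Λ⟩ := C.nonempty_linearization y
  obtain ⟨N, W, b, D, -, -, hW, hyW, -, -, hb, -, hD, -⟩ := Λ.exists_slice
  refine ⟨W, hW, hyW, fun z hz => ?_⟩
  obtain ⟨hbD, g, hg⟩ := hb z hz
  refine ⟨g, ?_⟩
  conv_lhs => rw [hg]
  rw [MulAction.stabilizer_smul_eq_stabilizer_map_conj]
  exact Subgroup.map_mono fun h hh => hD _ hbD _ hbD h hh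

/-- Conjugating the chain of inclusions back places a conjugate of the isotropy group of `y` inside
that group; compactness makes the two equal, and the chain collapses. -/
theorem stabilizer_eq_of_le_of_le_map_conj {y z : C.dom}
    (h1 : MulAction.stabilizer C.grp y ≤ MulAction.stabilizer C.grp z) {g : C.grp}
    (h2 : MulAction.stabilizer C.grp z ≤
      (MulAction.stabilizer C.grp y).map (MulAut.conj g).toMonoidHom) :
    MulAction.stabilizer C.grp z = MulAction.stabilizer C.grp y := by
  set H := MulAction.stabilizer C.grp y
  have h3 : H.map (MulAut.conj g⁻¹).toMonoidHom ≤ H := by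
    have := Subgroup.map_mono (f := (MulAut.conj g⁻¹).toMonoidHom) (h1.trans h2)
    refine this.trans ?_
    rw [Subgroup.map_map]
    rintro _ ⟨x, hx, rfl⟩
    simpa [mul_assoc] using hx
  have h4 : H.map (MulAut.conj g⁻¹).toMonoidHom = H :=
    Subgroup.eq_map_conj_of_map_conj_le (C.isClosed_stabilizer y) h3
  have h5 : H.map (MulAut.conj g).toMonoidHom = H := by
    conv_lhs => rw [← h4]
    rw [Subgroup.map_map]
    ext x
    simp [Subgroup.mem_map, mul_assoc]
  exact le_antisymm (h2.trans h5.le) h1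

variable {C} in
/-- In linearizing coordinates, the set of points with the same isotropy group as `y` is the space
of fixed vectors. -/
theorem Linearization.exists_nhds_mem_isotropySet_iff {y : C.dom} (Λ : C.Linearization y) :
    ∃ V : Set C.dom, IsOpen V ∧ y ∈ V ∧ V ⊆ Λ.toHomeo.source ∧ ∀ z ∈ V,
      (z ∈ C.isotropySet (MulAction.stabilizer C.grp y) ↔ Λ.toHomeo z ∈ C.fixedSpace y) := by
  obtain ⟨V, hV, hyV, hVs⟩ := C.exists_nhds_stabilizer_le y
  refine ⟨V ∩ Λ.toHomeo.source, hV.inter Λ.toHomeo.open_source, ⟨hyV, Λ.mem_source⟩,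
    inter_subset_right, ?_⟩
  rintro z ⟨hzV, hzs⟩
  constructor
  · intro hz k
    have hz' : MulAction.stabilizer C.grp z = MulAction.stabilizer C.grp y := hz
    have h0 : (k : C.grp) ∈ MulAction.stabilizer C.grp z := by
      rw [hz']
      exact k.2
    have h1 : (k : C.grp) • z = z := h0
    rw [← Λ.map_smul k z hzs, h1]
  · intro hz
    obtain ⟨g, hg⟩ := hVs z hzV
    refine C.stabilizer_eq_of_le_of_le_map_conj (fun k hk => ?_) hg
    have h1 := hz ⟨k, hk⟩
    rw [← Λ.map_smul ⟨k, hk⟩ z hzs] at h1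
    exact Λ.toHomeo.injOn (Λ.smul_mem ⟨k, hk⟩ z hzs) hzs h1

variable {C} in
theorem Linearization.hasMFDerivAt_symm {y : C.dom} (Λ : C.Linearization y) :
    HasMFDerivAt (𝓡 C.dim) (𝓡 C.dim) Λ.toHomeo.symm 0 (ContinuousLinearMap.id ℝ (Euc C.dim)) := by
  obtain ⟨D, hD⟩ := Λ.smooth_symm.exists_hasMFDerivAt Λ.toHomeo.open_target Λ.zero_mem_target
  have h1 : HasMFDerivAt (𝓡 C.dim) (𝓡 C.dim) Λ.toHomeo (Λ.toHomeo.symm 0)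
      (ContinuousLinearMap.id ℝ (Euc C.dim)) := by
    rw [Λ.symm_zero]
    exact Λ.hasMFDerivAt
  have h2 : HasMFDerivAt (𝓡 C.dim) (𝓡 C.dim) (Λ.toHomeo ∘ Λ.toHomeo.symm) 0
      (ContinuousLinearMap.id ℝ (Euc C.dim)) :=
    (hasMFDerivAt_id _).congr_of_eventuallyEq (Filter.eventually_of_mem
      (Λ.toHomeo.open_target.mem_nhds Λ.zero_mem_target) fun z hz => Λ.toHomeo.right_inv hz)
  have h3 : D = ContinuousLinearMap.id ℝ (Euc C.dim) := hasMFDerivAt_unique (h1.comp 0 hD) h2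
  rwa [h3] at hD

theorem exists_linear_param {n : ℕ} (F : Submodule ℝ (Euc n)) {k : ℕ}
    (hk : Module.finrank ℝ F = k) :
    ∃ ι : Euc k →L[ℝ] Euc n, Function.Injective ι ∧ range ι = F := by
  have e : Euc k ≃ₗ[ℝ] F := LinearEquiv.ofFinrankEq _ _ (by simp [hk])
  refine ⟨(F.subtype.comp e.toLinearMap).toContinuousLinearMap,
    F.injective_subtype.comp e.injective, ?_⟩
  change range (Subtype.val ∘ e) = _
  rw [range_comp, e.surjective.range_eq, image_univ]
  exact Subtype.range_coe

theorem isEmbeddedSubmanifold_isotropySet (H : Subgroup C.grp) :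
    IsEmbeddedSubmanifold C.dim (C.isotropySet H) := by
  rintro y rfl
  obtain ⟨Λ⟩ := C.nonempty_linearization y
  obtain ⟨V, hV, hyV, hVs, hVi⟩ := Λ.exists_nhds_mem_isotropySet_iff
  -- The dimension of the parameter space is that of the fixed space at this `y`; it may vary from
  -- component to component.
  obtain ⟨ι, hι, hιr⟩ := exists_linear_param (C.fixedSpace y) rfl
  refine ⟨_, _, _, isLocalParametrization_of_linear Λ.smooth Λ.smooth_symm hι hV hVs
    (fun z hz => by rw [hιr]; exact hVi z hz), 0, ⟨?_, ?_⟩, ?_⟩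
  · rw [map_zero]
    exact Λ.zero_mem_target
  · rw [mem_preimage, map_zero, Λ.symm_zero]
    exact hyV
  · rw [Function.comp_apply, map_zero, Λ.symm_zero]

variable {C}

/-- The tangent spaces of the isotropy submanifolds are the spaces of fixed vectors. -/
theorem range_eq_fixedSpace {H : Subgroup C.grp} {k : ℕ} {O : Set (Euc k)} {i : Euc k → C.dom}
    (h : IsLocalParametrization C.dim (C.isotropySet H) O i) {z : Euc k} (hz : z ∈ O)
    {D : Euc k →L[ℝ] Euc C.dim} (hD : HasMFDerivAt (𝓡 k) (𝓡 C.dim) i z D) :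
    range D = C.fixedSpace (i z) := by
  have hiz : MulAction.stabilizer C.grp (i z) = H := h.map_mem hz
  subst hiz
  ext v
  constructor
  -- Every point `i z'` is fixed by κ; differentiate this identity at `z`.
  · rintro ⟨w, rfl⟩ κ
    have h1 := (C.hasMFDerivAt_smul (i z) κ).comp z hD
    have h2 : (fun q : C.dom => (κ : C.grp) • q) ∘ i =ᶠ[𝓝 z] i := by
      filter_upwards [h.isOpen.mem_nhds hz] with z' hz'
      have h3 : MulAction.stabilizer C.grp (i z') = MulAction.stabilizer C.grp (i z) := h.map_mem hz'
      have h4 : (κ : C.grp) ∈ MulAction.stabilizer C.grp (i z') := by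
        rw [h3]
        exact κ.2
      exact h4
    exact DFunLike.congr_fun (hasMFDerivAt_unique h1 (hD.congr_of_eventuallyEq h2)) w
  · intro hv
    obtain ⟨Λ⟩ := C.nonempty_linearization (i z)
    obtain ⟨V, hV, hyV, hVs, hVi⟩ := Λ.exists_nhds_mem_isotropySet_iff
    obtain ⟨r, V', hV', hzV', hr, hri, hrA⟩ := h.exists_retract hz
    obtain ⟨ι, hι, hιr⟩ := exists_linear_param (C.fixedSpace (i z)) rfl
    obtain ⟨w, rfl⟩ : v ∈ range ι := hιr ▸ hv
    obtain ⟨R, hR⟩ := hr.exists_hasMFDerivAt hV' hzV'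
    -- Near `0`, the points with fixed coordinates lie in the isotropy set, so `i ∘ r` restores
    -- them. Differentiating shows that fixed vectors are in the range of `D`.
    set c := Λ.toHomeo.symm ∘ ι with hc
    have hc0 : c 0 = i z := by rw [hc, Function.comp_apply, map_zero, Λ.symm_zero]
    have h1 : HasMFDerivAt (𝓡 _) (𝓡 C.dim) c 0 ι := by
      have h2 : HasMFDerivAt (𝓡 C.dim) (𝓡 C.dim) Λ.toHomeo.symm (ι 0)
          (ContinuousLinearMap.id ℝ (Euc C.dim)) := by
        rw [map_zero]
        exact Λ.hasMFDerivAt_symm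
      exact h2.comp 0 ι.hasFDerivAt.hasMFDerivAt
    have hriz : r (i z) = z := hri.self_of_nhds
    have hRc : HasMFDerivAt (𝓡 _) (𝓡 k) (r ∘ c) 0 (R.comp ι) := by
      refine HasMFDerivAt.comp (g := r) (f := c) 0 ?_ h1
      rw [hc0]
      exact hR
    have h3 : HasMFDerivAt (𝓡 _) (𝓡 C.dim) (i ∘ r ∘ c) 0 (D.comp (R.comp ι)) := by
      refine HasMFDerivAt.comp (g := i) (f := r ∘ c) 0 ?_ hRc
      rw [Function.comp_apply, hc0, hriz]
      exact hD
    have h4 : i ∘ r ∘ c =ᶠ[𝓝 0] c := by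
      have h5 : ContinuousAt c 0 := h1.continuousAt
      rw [ContinuousAt, hc0] at h5
      have h6 : ∀ᶠ u in 𝓝 (0 : Euc _), ι u ∈ Λ.toHomeo.target := by
        refine ι.continuous.continuousAt.eventually_mem (Λ.toHomeo.open_target.mem_nhds ?_)
        rw [map_zero]
        exact Λ.zero_mem_target
      filter_upwards [h5.eventually hrA, h5.eventually (hV.mem_nhds hyV), h6] with u hu1 hu2 hu3
      refine (hu1 ((hVi _ hu2).2 ?_)).2
      rw [hc, Function.comp_apply, Λ.toHomeo.right_inv hu3, ← SetLike.mem_coe, ← hιr]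
      exact mem_range_self u
    have h7 := hasMFDerivAt_unique h3 (h1.congr_of_eventuallyEq h4)
    exact ⟨R (ι w), DFunLike.congr_fun h7 w⟩

/-- Invariance of the form, evaluated at a point which `k` does not move. -/
theorem flat_isotropyRep {Ω : TwoForm C.dim C.dom} {y : C.dom}
    (hΩ : ∀ g : C.grp, TwoForm.pullback (fun y : C.dom => g • y) Ω = Ω)
    (k : MulAction.stabilizer C.grp y) (a b : Euc C.dim) :
    Ω.flat y (C.isotropyRep y k a) (C.isotropyRep y k b) = Ω.flat y a b := by
  have h1 := Ω.flat_pullback (C.hasMFDerivAt_smul y k) a b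
  rw [hΩ k] at h1
  rw [h1, show (k : C.grp) • y = y from k.2]

/-- Averaging over the isotropy group at a point. -/
theorem exists_isotropy_average (C : OrbispaceChart.{u, v, w} X) (y : C.dom) :
    ∃ A : Euc C.dim → Euc C.dim, (∀ v, A v ∈ C.fixedSpace y) ∧
      (∀ {m : ℕ} (l : Euc C.dim →L[ℝ] Euc m) (v : Euc C.dim) (c : Euc m),
        (∀ k, l (C.isotropyRep y k v) = c) → l (A v) = c) ∧
      ∀ {Ω : TwoForm C.dim C.dom},
        (∀ g : C.grp, TwoForm.pullback (fun y : C.dom => g • y) Ω = Ω) →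
        ∀ a ∈ C.fixedSpace y, ∀ v, Ω.flat y a (A v) = Ω.flat y a v := by
  obtain ⟨A, hA, -, hAl⟩ := exists_average (C.continuous_isotropyRep y)
  refine ⟨A, fun v k => hA k v, fun l v c h => hAl l v c h, fun hΩ a ha v => ?_⟩
  refine hAl _ v _ fun k => ?_
  -- Since `a` is fixed, ω(a, kv) = ω(ka, kv) = ω(a, v), so the average over `k` gives the same
  -- value.
  conv_lhs => rw [← ha k]
  exact flat_isotropyRep hΩ k a v

/-- Pairing a fixed vector with `w` is the same as pairing it with the average of `w`, which is
tangent to the isotropy set. So a tangent vector in the kernel of the restriction is in the kernel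
of Ω. -/
theorem restrictsToSymplectic_isotropySet {Ω : TwoForm C.dim C.dom} (hΩ : IsSymplecticForm Ω)
    (hinv : ∀ g : C.grp, TwoForm.pullback (fun y : C.dom => g • y) Ω = Ω) (H : Subgroup C.grp) :
    RestrictsToSymplectic Ω (C.isotropySet H) := by
  intro k O i h
  obtain ⟨h1, h2⟩ := hΩ.pullback h.isOpen h.smooth
  refine ⟨h1, h2, fun z hz v hv => ?_⟩
  obtain ⟨D, hD⟩ := h.smooth.exists_hasMFDerivAt h.isOpen hz
  have hinj : Function.Injective D := by
    have := h.immersive z hz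
    rwa [hD.mfderiv] at this
  have hr := range_eq_fixedSpace h hz hD
  obtain ⟨A, hA, -, hAΩ⟩ := C.exists_isotropy_average (i z)
  refine (map_eq_zero_iff D hinj).1 (hΩ.eq_zero (x := i z) fun w => ?_)
  rw [← hAΩ hinv _ (hr ▸ mem_range_self v : D v ∈ (C.fixedSpace (i z) : Set _)) w]
  obtain ⟨w', hw'⟩ : A w ∈ range D := by
    rw [hr]
    exact hA w
  rw [← hw', ← Ω.flat_pullback hD]
  exact hv w'

end OrbispaceChart

/-! ### Transfer between charts of an orbispace -/

theorem OrbispaceChart.continuous_proj {X : Type u} [TopologicalSpace X]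
    (C : OrbispaceChart.{u, v, w} X) : Continuous C.proj :=
  C.isOpenEmbedding.continuous.comp continuous_quotient_mk'

theorem OrbispaceChart.isOpenMap_proj {X : Type u} [TopologicalSpace X]
    (C : OrbispaceChart.{u, v, w} X) : IsOpenMap C.proj :=
  C.isOpenEmbedding.isOpenMap.comp (isOpenMap_quotient_mk'_mul (Γ := C.grp) (T := C.dom))

theorem OrbispaceChart.exists_smul_eq {X : Type u} [TopologicalSpace X]
    (C : OrbispaceChart.{u, v, w} X) {p p' : C.dom} (h : C.proj p = C.proj p') :
    ∃ g : C.grp, g • p' = p :=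
  MulAction.orbitRel_apply.1 (Quotient.exact (C.isOpenEmbedding.injective
    (a₁ := Quotient.mk _ p) (a₂ := Quotient.mk _ p') h))

/-- An immersion detects smoothness of continuous maps into its domain; apply this to φ composed
with its inverse. -/
theorem Manifold.IsSmoothEmbedding.contMDiffOn_symm {m n : ℕ} {N M : Type*} [TopologicalSpace N]
    [ChartedSpace (Euc m) N] [IsManifold (𝓡 m) ∞ N] [TopologicalSpace M] [ChartedSpace (Euc n) M]
    [IsManifold (𝓡 n) ∞ M]
    {φ : OpenPartialHomeomorph N M} (h : Manifold.IsSmoothEmbedding (𝓡 m) (𝓡 n) ∞ φ) :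
    ContMDiffOn (𝓡 n) (𝓡 m) ∞ φ.symm φ.target := by
  intro x hx
  refine ContMDiffAt.contMDiffWithinAt ?_
  rw [ContMDiffAt.iff_comp_isImmersionAt (h.isImmersion.isImmersionAt _)]
  refine ⟨φ.symm.continuousAt hx, ?_⟩
  exact contMDiffAt_id.congr_of_eventuallyEq
    (Filter.eventually_of_mem (φ.open_target.mem_nhds hx) fun z hz => φ.right_inv hz)

namespace Orbispace

variable {X : Type u} [TopologicalSpace X] {𝒳 : Orbispace.{u, v, w} X}

/-- Unite the two finite families and take the component of their intersection through `x`. -/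
theorem exists_obj_subset {U U' : 𝒳.Obj} {x : X} (hx : x ∈ U.1) (hx' : x ∈ U'.1) :
    ∃ V : 𝒳.Obj, V.1 ⊆ U.1 ∧ V.1 ⊆ U'.1 ∧ x ∈ V.1 := by
  obtain ⟨U, F, hF, hFn, hFc, y, hy, rfl⟩ := U
  obtain ⟨U', F', hF', hFn', hFc', y', hy', rfl⟩ := U'
  have hxF : x ∈ ⋂₀ F := connectedComponentIn_subset _ _ hx
  have hxF' : x ∈ ⋂₀ F' := connectedComponentIn_subset _ _ hx'
  have hxx : x ∈ ⋂₀ (F ∪ F') := by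
    rw [sInter_union]
    exact ⟨hxF, hxF'⟩
  refine ⟨⟨connectedComponentIn (⋂₀ (F ∪ F')) x, F ∪ F', hF.union hF', hFn.inl,
    union_subset hFc hFc', x, hxx, rfl⟩, ?_, ?_, mem_connectedComponentIn hxx⟩
  · change _ ⊆ connectedComponentIn (⋂₀ F) y
    rw [connectedComponentIn_eq hx]
    refine connectedComponentIn_mono x ?_
    rw [sInter_union]
    exact inter_subset_left
  · change _ ⊆ connectedComponentIn (⋂₀ F') y'
    rw [connectedComponentIn_eq hx']
    refine connectedComponentIn_mono x ?_
    rw [sInter_union]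
    exact inter_subset_right

theorem proj_mem (U : 𝒳.Obj) (p : (𝒳.chart U).dom) : (𝒳.chart U).proj p ∈ U.1 :=
  𝒳.range_proj U ▸ mem_range_self p

variable (Ω : 𝒳.SymplecticForm)

/-- A local symplectomorphism over the identity of `X` between domains of charts. -/
structure SymplecticForm.IsTransfer {U' U : 𝒳.Obj}
    (θ : OpenPartialHomeomorph (𝒳.chart U').dom (𝒳.chart U).dom) : Prop where
  smooth : ContMDiffOn (𝓡 (𝒳.chart U').dim) (𝓡 (𝒳.chart U).dim) ∞ θ θ.source
  smooth_symm : ContMDiffOn (𝓡 (𝒳.chart U).dim) (𝓡 (𝒳.chart U').dim) ∞ θ.symm θ.target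
  proj_eq : ∀ z ∈ θ.source, (𝒳.chart U).proj (θ z) = (𝒳.chart U').proj z
  flat_eq : ∀ z ∈ θ.source, ∀ D : Euc (𝒳.chart U').dim →L[ℝ] Euc (𝒳.chart U).dim,
    HasMFDerivAt (𝓡 (𝒳.chart U').dim) (𝓡 (𝒳.chart U).dim) θ z D → ∀ a b,
      (Ω.form U).flat (θ z) (D a) (D b) = (Ω.form U').flat z a b

namespace SymplecticForm.IsTransfer

variable {Ω} {U'' U' U : 𝒳.Obj} {θ : OpenPartialHomeomorph (𝒳.chart U').dom (𝒳.chart U).dom}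

/-- The derivatives of a transfer map and of its inverse. -/
theorem exists_hasMFDerivAt (h : Ω.IsTransfer θ) {z : (𝒳.chart U').dom} (hz : z ∈ θ.source) :
    ∃ (D : Euc (𝒳.chart U').dim →L[ℝ] Euc (𝒳.chart U).dim)
      (D' : Euc (𝒳.chart U).dim →L[ℝ] Euc (𝒳.chart U').dim),
      HasMFDerivAt (𝓡 (𝒳.chart U').dim) (𝓡 (𝒳.chart U).dim) θ z D ∧
      HasMFDerivAt (𝓡 (𝒳.chart U).dim) (𝓡 (𝒳.chart U').dim) θ.symm (θ z) D' ∧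
      (∀ v, D' (D v) = v) ∧ ∀ v, D (D' v) = v := by
  obtain ⟨D, hD⟩ := h.smooth.exists_hasMFDerivAt θ.open_source hz
  obtain ⟨D', hD'⟩ := h.smooth_symm.exists_hasMFDerivAt θ.open_target (θ.map_source hz)
  refine ⟨D, D', hD, hD', fun v => ?_, fun v => ?_⟩
  · have h4 : HasMFDerivAt (𝓡 (𝒳.chart U').dim) (𝓡 (𝒳.chart U').dim) (θ.symm ∘ θ) z
        (ContinuousLinearMap.id ℝ (Euc (𝒳.chart U').dim)) :=
      (hasMFDerivAt_id z).congr_of_eventuallyEq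
        (Filter.eventually_of_mem (θ.open_source.mem_nhds hz) fun z hz => θ.left_inv hz)
    exact DFunLike.congr_fun (hasMFDerivAt_unique (hD'.comp z hD) h4) v
  · have h1 : HasMFDerivAt (𝓡 (𝒳.chart U').dim) (𝓡 (𝒳.chart U).dim) θ (θ.symm (θ z)) D := by
      rwa [θ.left_inv hz]
    have h4 : HasMFDerivAt (𝓡 (𝒳.chart U).dim) (𝓡 (𝒳.chart U).dim) (θ ∘ θ.symm) (θ z)
        (ContinuousLinearMap.id ℝ (Euc (𝒳.chart U).dim)) :=
      (hasMFDerivAt_id (θ z)).congr_of_eventuallyEq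
        (Filter.eventually_of_mem (θ.open_target.mem_nhds (θ.map_source hz))
          fun z hz => θ.right_inv hz)
    exact DFunLike.congr_fun (hasMFDerivAt_unique (h1.comp (θ z) hD') h4) v

protected theorem symm (h : Ω.IsTransfer θ) : Ω.IsTransfer θ.symm where
  smooth := h.smooth_symm
  smooth_symm := h.smooth
  proj_eq z hz := by rw [← h.proj_eq _ (θ.map_target hz), θ.right_inv hz]
  flat_eq z hz E hE a b := by
    have hs := θ.map_target hz
    obtain ⟨D, D', hD, hD', h1, h2⟩ := h.exists_hasMFDerivAt hs
    rw [θ.right_inv hz] at hD'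
    have hE' : E = D' := hasMFDerivAt_unique hE hD'
    have h3 := h.flat_eq _ hs D hD (D' a) (D' b)
    rw [h2, h2, θ.right_inv hz] at h3
    rw [hE', ← h3]

protected theorem trans {θ' : OpenPartialHomeomorph (𝒳.chart U'').dom (𝒳.chart U').dom}
    (h' : Ω.IsTransfer θ') (h : Ω.IsTransfer θ) : Ω.IsTransfer (θ'.trans θ) where
  smooth := by
    rw [OpenPartialHomeomorph.trans_source]
    exact h.smooth.comp' (g := θ) h'.smooth
  smooth_symm := by
    rw [OpenPartialHomeomorph.trans_target]
    exact h'.smooth_symm.comp' (g := θ'.symm) h.smooth_symm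
  proj_eq z hz := by
    rw [OpenPartialHomeomorph.trans_source] at hz
    exact (h.proj_eq _ hz.2).trans (h'.proj_eq _ hz.1)
  flat_eq z hz E hE a b := by
    rw [OpenPartialHomeomorph.trans_source] at hz
    obtain ⟨D', -, hD', -⟩ := h'.exists_hasMFDerivAt hz.1
    obtain ⟨D, -, hD, -⟩ := h.exists_hasMFDerivAt hz.2
    have hE' : E = D.comp D' := hasMFDerivAt_unique hE (hD.comp z hD')
    rw [hE']
    exact (h.flat_eq _ hz.2 D hD _ _).trans (h'.flat_eq _ hz.1 D' hD' _ _)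

end SymplecticForm.IsTransfer

theorem SymplecticForm.isTransfer_smul (U : 𝒳.Obj) (g : (𝒳.chart U).grp) :
    Ω.IsTransfer (U' := U) (U := U) (Homeomorph.smul g).toOpenPartialHomeomorph where
  smooth := ((𝒳.chart U).contMDiff_smul_left g).contMDiffOn
  smooth_symm := ((𝒳.chart U).contMDiff_smul_left g⁻¹).contMDiffOn
  proj_eq z _ := (𝒳.chart U).proj_smul g z
  flat_eq z _ D hD a b := by
    have h1 := (Ω.form U).flat_pullback hD a b
    have h2 : TwoForm.pullback (fun y : (𝒳.chart U).dom => g • y) (Ω.form U) = Ω.form U :=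
      Ω.invariant U g
    rw [← h1]
    exact congrArg (fun Θ : TwoForm _ _ => Θ.flat z a b) h2

theorem SymplecticForm.exists_isTransfer_map {V U : 𝒳.Obj} (h : V.1 ⊆ U.1) (p : (𝒳.chart V).dom) :
    ∃ θ : OpenPartialHomeomorph (𝒳.chart V).dom (𝒳.chart U).dom, Ω.IsTransfer θ ∧
      p ∈ θ.source ∧ θ p = (𝒳.map h).toFun p := by
  have h1 := 𝒳.map_isOpenEmb h
  have : Nonempty (𝒳.chart V).dom := ⟨p⟩
  have h2 : IsOpenEmbedding (𝒳.map h).toFun :=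
    .of_isEmbedding_isOpenMap h1.smoothEmbedding.isEmbedding h1.isOpenMap
  refine ⟨h2.toOpenPartialHomeomorph, ⟨(𝒳.map h).smooth.contMDiffOn, ?_, fun z _ =>
    (𝒳.map h).proj_comp z, fun z _ D hD a b => ?_⟩, trivial, rfl⟩
  · exact Manifold.IsSmoothEmbedding.contMDiffOn_symm (φ := h2.toOpenPartialHomeomorph)
      h1.smoothEmbedding
  · have h3 := (Ω.form U).flat_pullback hD a b
    rw [← h3]
    exact congrArg (fun Θ : TwoForm _ _ => Θ.flat z a b) (Ω.compatible h)

/-- Points over the same point of `X` in domains of charts are related by a local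
symplectomorphism. -/
theorem SymplecticForm.exists_isTransfer {U' U : 𝒳.Obj} {p' : (𝒳.chart U').dom}
    {p : (𝒳.chart U).dom} (hp : (𝒳.chart U').proj p' = (𝒳.chart U).proj p) :
    ∃ θ : OpenPartialHomeomorph (𝒳.chart U').dom (𝒳.chart U).dom, Ω.IsTransfer θ ∧
      p' ∈ θ.source ∧ θ p' = p := by
  obtain ⟨V, hVU, hVU', hxV⟩ := exists_obj_subset (𝒳.proj_mem U p) (hp ▸ 𝒳.proj_mem U' p')
  obtain ⟨z, hz⟩ : (𝒳.chart U).proj p ∈ range (𝒳.chart V).proj := (𝒳.range_proj V).symm ▸ hxV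
  obtain ⟨θ₁, h₁, hz₁, he₁⟩ := Ω.exists_isTransfer_map hVU z
  obtain ⟨θ₂, h₂, hz₂, he₂⟩ := Ω.exists_isTransfer_map hVU' z
  obtain ⟨g₁, hg₁⟩ := (𝒳.chart U).exists_smul_eq (p := p) (p' := θ₁ z)
    (by rw [h₁.proj_eq z hz₁, hz])
  obtain ⟨g₂, hg₂⟩ := (𝒳.chart U').exists_smul_eq (p := θ₂ z) (p' := p')
    (by rw [h₂.proj_eq z hz₂, hz, hp])
  -- Move `p'` within its orbit to the image of `z`, descend to the common smaller chart, ascend to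
  -- the other chart, and correct by a group element there.
  refine ⟨_, (((Ω.isTransfer_smul U' g₂).trans h₂.symm).trans h₁).trans (Ω.isTransfer_smul U g₁),
    ?_, ?_⟩
  · simp only [OpenPartialHomeomorph.trans_source, mem_inter_iff, mem_preimage,
      OpenPartialHomeomorph.coe_trans, Function.comp_apply]
    change ((True ∧ g₂ • p' ∈ θ₂.target) ∧ θ₂.symm (g₂ • p') ∈ θ₁.source) ∧ True
    rw [hg₂, θ₂.left_inv hz₂]
    exact ⟨⟨⟨trivial, θ₂.map_source hz₂⟩, hz₁⟩, trivial⟩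
  · change g₁ • θ₁ (θ₂.symm (g₂ • p')) = p
    rw [hg₂, θ₂.left_inv hz₂, hg₁]

end Orbispace

/-! ### Charts of strata -/

namespace OrbispaceChart

variable {X : Type u} [TopologicalSpace X] (C : OrbispaceChart.{u, v, w} X)

variable {C} in
theorem mem_sliceFixed {y : C.dom} {v : Euc C.dim} :
    v ∈ C.sliceFixed y ↔ ∀ k, C.isotropyRep y k v - v ∈ C.orbitTangent y := by
  have key : ∀ k : MulAction.stabilizer C.grp y,
      (mfderiv (𝓡 C.dim) (𝓡 C.dim) (fun y' : C.dom => (k : C.grp) • y') y :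
        Euc C.dim →L[ℝ] Euc C.dim) = C.isotropyRep y k := fun k => (C.hasMFDerivAt_smul y k).mfderiv
  rw [sliceFixed, Submodule.mem_iInf]
  refine forall_congr' fun k => ?_
  rw [key k]
  rfl

/-- The complement `N` models the slice representation: if the class of `a + n` is fixed, then `k n
- n` lies both in `N` and in the orbit directions, so `n` itself is fixed. -/
theorem finrank_fixedSpace_inf {y : C.dom} {d : ℕ} (hd : C.HasStratumDim y d)
    {N : Submodule ℝ (Euc C.dim)} (hN : IsCompl (C.orbitTangent y) N)
    (hNi : ∀ k, ∀ v ∈ N, C.isotropyRep y k v ∈ N) :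
    Module.finrank ℝ (C.fixedSpace y ⊓ N : Submodule ℝ (Euc C.dim)) = d := by
  have h1 : C.sliceFixed y = C.orbitTangent y ⊔ C.fixedSpace y ⊓ N := by
    ext v
    rw [mem_sliceFixed, Submodule.mem_sup]
    constructor
    · intro hv
      obtain ⟨a, ha, n, hn, rfl⟩ : ∃ a ∈ C.orbitTangent y, ∃ n ∈ N, a + n = v :=
        Submodule.mem_sup.1 (hN.sup_eq_top ▸ Submodule.mem_top)
      refine ⟨a, ha, n, ⟨fun k => ?_, hn⟩, rfl⟩
      have h2 : C.isotropyRep y k n - n ∈ C.orbitTangent y ⊓ N := by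
        refine ⟨?_, N.sub_mem (hNi k n hn) hn⟩
        have h3 := (C.orbitTangent y).sub_mem (hv k)
          ((C.orbitTangent y).sub_mem (C.isotropyRep_mem_orbitTangent y k ha) ha)
        rw [map_add] at h3
        have h4 : ∀ a' n' : Euc C.dim, a' + n' - (a + n) - (a' - a) = n' - n := fun a' n' => by abel
        rwa [h4] at h3
      rw [hN.inf_eq_bot, Submodule.mem_bot] at h2
      exact sub_eq_zero.1 h2
    · rintro ⟨a, ha, n, hn, rfl⟩ k
      rw [map_add, hn.1 k, add_sub_add_right_eq_sub]
      exact (C.orbitTangent y).sub_mem (C.isotropyRep_mem_orbitTangent y k ha) ha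
  have h2 : C.orbitTangent y ⊓ (C.fixedSpace y ⊓ N) = ⊥ := by
    refine eq_bot_iff.2 (le_trans ?_ hN.inf_eq_bot.le)
    exact inf_le_inf_left _ inf_le_right
  have h3 := Submodule.finrank_sup_add_finrank_inf_eq (C.orbitTangent y) (C.fixedSpace y ⊓ N)
  rw [h2, finrank_bot, ← h1, hd] at h3
  omega

variable {C} in
theorem smul_mem_orbitTypeSet {H : Subgroup C.grp} {z : C.dom} (hz : z ∈ C.orbitTypeSet H)
    (g : C.grp) : g • z ∈ C.orbitTypeSet H := by
  obtain ⟨g', hg'⟩ := hz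
  refine ⟨g * g', ?_⟩
  rw [MulAction.stabilizer_smul_eq_stabilizer_map_conj, hg', Subgroup.map_map, map_mul]
  rfl

variable {C} in
theorem proj_mem_image_orbitTypeSet_iff {H : Subgroup C.grp} {z : C.dom} :
    C.proj z ∈ C.proj '' C.orbitTypeSet H ↔ z ∈ C.orbitTypeSet H := by
  refine ⟨?_, fun h => mem_image_of_mem _ h⟩
  rintro ⟨z', hz', h⟩
  obtain ⟨g, rfl⟩ := C.exists_smul_eq h.symm
  exact smul_mem_orbitTypeSet hz' g

/-- A chart of the set `S` of points of orbit type `y`: a smooth section `j` of the projection and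
a smooth invariant function `s` inducing the inverse of `proj ∘ j`. -/
structure StratumChart (S : Set X) (d : ℕ) (y : C.dom) where
  W : Set C.dom
  s : C.dom → Euc d
  O : Set (Euc d)
  j : Euc d → C.dom
  isOpen_W : IsOpen W
  mem_W : y ∈ W
  smooth_s : ContMDiffOn (𝓡 C.dim) (𝓡 d) ∞ s W
  isOpen_O : IsOpen O
  smooth_j : ContMDiffOn (𝓡 d) (𝓡 C.dim) ∞ j O
  j_mem : ∀ u ∈ O, j u ∈ W
  proj_j_mem : ∀ u ∈ O, C.proj (j u) ∈ S
  s_j : ∀ u ∈ O, s (j u) = u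
  s_mem : ∀ z ∈ W, C.proj z ∈ S → s z ∈ O
  proj_j_s : ∀ z ∈ W, C.proj z ∈ S → C.proj (j (s z)) = C.proj z
  s_eq : ∀ z ∈ W, ∀ z' ∈ W, C.proj z ∈ S → C.proj z = C.proj z' → s z = s z'
  proj_mem : ∀ z ∈ W, z ∈ C.isotropySet (MulAction.stabilizer C.grp y) → C.proj z ∈ S
  j_isotropy : ∀ u ∈ O, j u ∈ C.isotropySet (MulAction.stabilizer C.grp y)
  j_s : C.gdim = 0 → ∀ z ∈ W, C.proj z ∈ S → j (s z) = z

/-- The coordinates are linear coordinates ι on the fixed part of the slice: `s` is the slice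
coordinate `b` followed by a left inverse of ι, and `j` is ι followed by the inverse of the
linearization. -/
theorem nonempty_stratumChart {S : Set X} {d : ℕ} {y : C.dom} (hd : C.HasStratumDim y d)
    (hS : S =ᶠ[𝓝 (C.proj y)] C.proj '' C.orbitTypeSet (MulAction.stabilizer C.grp y)) :
    Nonempty (C.StratumChart S d y) := by
  obtain ⟨Λ⟩ := C.nonempty_linearization y
  obtain ⟨N, W, b, D, hN, hNi, hW, hyW, hD, hb, hbW, hDW, hDs, hfin⟩ := Λ.exists_slice
  obtain ⟨V, hVs, hV, hyV⟩ := mem_nhds_iff.1 hS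
  obtain ⟨ι, hι, hιr⟩ := exists_linear_param _ (C.finrank_fixedSpace_inf hd hN hNi)
  obtain ⟨l, hl⟩ := ι.toLinearMap.exists_leftInverse_of_injective (LinearMap.ker_eq_bot.2 hι)
  set L : Euc C.dim →L[ℝ] Euc d := l.toContinuousLinearMap
  have hLι : ∀ v, L (ι v) = v := fun v => LinearMap.congr_fun hl v
  have hιF : ∀ u k, C.isotropyRep y k (ι u) = ι u := fun u k =>
    ((hιr ▸ mem_range_self u : ι u ∈ ((C.fixedSpace y ⊓ N : Submodule ℝ (Euc C.dim)) : Set _))).1 k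
  have hιN : ∀ u, ι u ∈ N := fun u =>
    ((hιr ▸ mem_range_self u : ι u ∈ ((C.fixedSpace y ⊓ N : Submodule ℝ (Euc C.dim)) : Set _))).2
  set ι' : Euc d →L[ℝ] N := ι.codRestrict N hιN
  set Φ := Λ.toHomeo
  set H := MulAction.stabilizer C.grp y with hH
  have hle : ∀ v ∈ D, MulAction.stabilizer C.grp (Φ.symm (v : Euc C.dim)) ≤ H :=
    fun v hv g hg => hDs v hv v hv g hg
  have hfix : ∀ v ∈ D, (v : Euc C.dim) ∈ C.fixedSpace y →
      MulAction.stabilizer C.grp (Φ.symm (v : Euc C.dim)) = H := by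
    refine fun v hv hvF => le_antisymm (hle v hv) fun k hk => ?_
    have h1 := (Λ.isotropyRep_mem_target (hDW v hv).1 ⟨k, hk⟩).2
    rw [hvF ⟨k, hk⟩] at h1
    exact h1.symm
  -- The isotropy group of the slice point under `z` is contained in `H`. If it is conjugate to `H`
  -- it equals `H`, which means that the slice coordinate is a fixed vector.
  have hiff : ∀ z ∈ W ∩ C.proj ⁻¹' V, C.proj z ∈ S ↔ (b z : Euc C.dim) ∈ C.fixedSpace y := by
    rintro z ⟨hzW, hzV⟩
    have h0 : C.proj z ∈ S ↔ C.proj z ∈ C.proj '' C.orbitTypeSet H := iff_of_eq (hVs hzV)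
    rw [h0, proj_mem_image_orbitTypeSet_iff]
    obtain ⟨hbD, g, hg⟩ := hbW z hzW
    have hst : MulAction.stabilizer C.grp z =
        (MulAction.stabilizer C.grp (Φ.symm (b z : Euc C.dim))).map (MulAut.conj g).toMonoidHom := by
      conv_lhs => rw [hg]
      exact MulAction.stabilizer_smul_eq_stabilizer_map_conj _ _
    constructor
    · rintro ⟨g', hg'⟩
      have h1 : H.map (MulAut.conj (g⁻¹ * g')).toMonoidHom =
          MulAction.stabilizer C.grp (Φ.symm (b z : Euc C.dim)) := by
        have h2 := hst.symm.trans hg'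
        have h3 := congrArg (Subgroup.map (MulAut.conj g⁻¹).toMonoidHom) h2
        rw [Subgroup.map_map, Subgroup.map_map] at h3
        have h4 : (MulAut.conj g⁻¹).toMonoidHom.comp (MulAut.conj g).toMonoidHom =
            MonoidHom.id C.grp := by
          ext x
          simp [mul_assoc]
        rw [h4, Subgroup.map_id] at h3
        rw [h3, map_mul]
        rfl
      have h5 : MulAction.stabilizer C.grp (Φ.symm (b z : Euc C.dim)) = H :=
        h1.symm.trans (Subgroup.eq_map_conj_of_map_conj_le (C.isClosed_stabilizer y)
          (h1.le.trans (hle _ hbD)))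
      intro k
      have h6 : (k : C.grp) • Φ.symm (b z : Euc C.dim) = Φ.symm (b z : Euc C.dim) := by
        have : (k : C.grp) ∈ MulAction.stabilizer C.grp (Φ.symm (b z : Euc C.dim)) := by
          rw [h5]
          exact k.2
        exact this
      have h7 := Λ.map_smul k _ (Φ.map_target (hDW _ hbD).1)
      rw [h6, Φ.right_inv (hDW _ hbD).1] at h7
      exact h7.symm
    · intro hF
      refine ⟨g, ?_⟩
      rw [hst, hfix _ hbD hF]
  have hlift : ∀ z ∈ W ∩ C.proj ⁻¹' V, C.proj z ∈ S → ι (L (b z)) = b z := by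
    intro z hz hzS
    obtain ⟨u, hu⟩ : (b z : Euc C.dim) ∈ range ι := by
      rw [hιr]
      exact ⟨(hiff z hz).1 hzS, (b z).2⟩
    rw [← hu, hLι]
  have hsl : ∀ z ∈ W ∩ C.proj ⁻¹' V, C.proj (Φ.symm (b z : Euc C.dim)) = C.proj z := by
    intro z hz
    obtain ⟨-, g, hg⟩ := hbW z hz.1
    conv_rhs => rw [hg]
    exact (C.proj_smul _ _).symm
  have hWo : IsOpen (W ∩ C.proj ⁻¹' V) := hW.inter (hV.preimage C.continuous_proj)
  have hWsub : W ∩ C.proj ⁻¹' V ⊆ W := inter_subset_left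
  have hbj : ∀ u, ι' u ∈ D → b (Φ.symm (ι u)) = ι' u := fun u hu => (hDW (ι' u) hu).2.2
  exact ⟨{
    W := W ∩ C.proj ⁻¹' V
    s := fun z => L (b z)
    O := ι' ⁻¹' D ∩ ι ⁻¹' (Φ.target ∩ Φ.symm ⁻¹' (W ∩ C.proj ⁻¹' V))
    j := fun u => Φ.symm (ι u)
    isOpen_W := hWo
    mem_W := ⟨hyW, hyV⟩
    smooth_s := by
      have h1 : ContDiff ℝ ∞ (fun v : N => L v) := (L.comp N.subtypeL).contDiff
      exact ContMDiffOn.comp (g := fun v : N => L v) (t := univ)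
        (contMDiffOn_iff_contDiffOn.2 h1.contDiffOn) (hb.mono hWsub) fun _ _ => trivial
    isOpen_O := (hD.preimage ι'.continuous).inter
      ((Φ.isOpen_inter_preimage_symm hWo).preimage ι.continuous)
    smooth_j := ContMDiffOn.comp (g := Φ.symm) (t := Φ.target) Λ.smooth_symm
      (contMDiffOn_iff_contDiffOn.2 ι.contDiff.contDiffOn) fun u hu => hu.2.1
    j_mem := fun u hu => hu.2.2
    proj_j_mem := fun u hu => by
      rw [hiff _ hu.2.2, hbj u hu.1]
      exact hιF u
    s_j := fun u hu => by
      rw [hbj u hu.1]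
      exact hLι u
    s_mem := fun z hz hzS => by
      have h1 := hlift z hz hzS
      have h2 := hDW _ (hbW z hz.1).1
      have h3 : ι' (L (b z)) = b z := Subtype.ext h1
      refine ⟨?_, ?_, ?_, ?_⟩
      · rw [mem_preimage, h3]
        exact (hbW z hz.1).1
      · rw [h1]
        exact h2.1
      · rw [h1]
        exact h2.2.1
      · rw [mem_preimage, h1, hsl z hz]
        exact hz.2
    proj_j_s := fun z hz hzS => by rw [hlift z hz hzS, hsl z hz]
    s_eq := fun z hz z' hz' hzS h => by
      have h1 : C.proj (Φ.symm (b z' : Euc C.dim)) = C.proj (Φ.symm (b z : Euc C.dim)) := by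
        rw [hsl z hz, hsl z' hz', h]
      -- Slice points over the same point of `X` differ by an element of `H`, which fixes the first
      -- of them; so they coincide.
      obtain ⟨g, hg⟩ := C.exists_smul_eq h1
      have h2 : g ∈ H := hDs _ (hbW z hz.1).1 _ (hbW z' hz'.1).1 g hg
      rw [← hfix _ (hbW z hz.1).1 ((hiff z hz).1 hzS)] at h2
      have h3 : g • Φ.symm (b z : Euc C.dim) = Φ.symm (b z : Euc C.dim) := h2
      rw [h3] at hg
      have h4 := (hDW _ (hbW z hz.1).1).2.2
      rw [hg, (hDW _ (hbW z' hz'.1).1).2.2] at h4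
      rw [h4]
    proj_mem := fun z hz hzH => by
      have h0 : C.proj z ∈ S ↔ C.proj z ∈ C.proj '' C.orbitTypeSet H := iff_of_eq (hVs hz.2)
      refine h0.2 (mem_image_of_mem _ ⟨1, ?_⟩)
      have h1 : MulAction.stabilizer C.grp z = H := hzH
      rw [h1, map_one]
      exact (Subgroup.map_id H).symm
    j_isotropy := fun u hu => hfix (ι' u) hu.1 (hιF u)
    j_s := fun h0 z hz hzS => by
      rw [hlift z hz hzS]
      exact hfin h0 z hz.1 }⟩

/-- The group is discrete, so a chart makes a single point open in the model space; this is
impossible in positive dimension. -/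
theorem gdim_eq_zero_of_finite [Finite C.grp] : C.gdim = 0 := by
  by_contra h0
  have : Nontrivial (Euc C.gdim) := by
    have : Nonempty (Fin C.gdim) := ⟨⟨0, Nat.pos_of_ne_zero h0⟩⟩
    infer_instance
  set e := chartAt (Euc C.gdim) (1 : C.grp)
  have h1 : IsOpen ({1} : Set C.grp) := isOpen_discrete _
  have h2 : IsOpen (e '' {1}) :=
    e.isOpen_image_of_subset_source h1 (singleton_subset_iff.2 (mem_chart_source _ _))
  rw [image_singleton] at h2
  exact not_isOpen_singleton (e 1) h2

namespace StratumChart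

variable {C} {S : Set X} {d : ℕ} {y : C.dom} (σ : C.StratumChart S d y)

/-- The smooth left inverse `s` makes `j` an immersion and an embedding. Dimension zero of the group
is needed for the image to be all of the isotropy set in `W`. -/
theorem isLocalParametrization (h0 : C.gdim = 0) :
    IsLocalParametrization C.dim (C.isotropySet (MulAction.stabilizer C.grp y)) σ.O σ.j where
  isOpen := σ.isOpen_O
  smooth := σ.smooth_j
  immersive u hu := by
    obtain ⟨D, hD⟩ := σ.smooth_j.exists_hasMFDerivAt σ.isOpen_O hu
    obtain ⟨D', hD'⟩ := σ.smooth_s.exists_hasMFDerivAt σ.isOpen_W (σ.j_mem u hu)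
    have h2 : HasMFDerivAt (𝓡 d) (𝓡 d) (σ.s ∘ σ.j) u (ContinuousLinearMap.id ℝ (Euc d)) :=
      (hasMFDerivAt_id u).congr_of_eventuallyEq
        (Filter.eventually_of_mem (σ.isOpen_O.mem_nhds hu) σ.s_j)
    have h3 := hasMFDerivAt_unique (hD'.comp u hD) h2
    rw [hD.mfderiv]
    exact Function.LeftInverse.injective (g := D') fun v => DFunLike.congr_fun h3 v
  embedding := by
    set f' : σ.O → σ.W := fun u => ⟨σ.j u, σ.j_mem u u.2⟩
    have hf' : Continuous f' :=
      (continuousOn_iff_continuous_domRestrict.1 σ.smooth_j.continuousOn).subtype_mk _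
    have hg' : Continuous fun q : σ.W => σ.s q :=
      continuousOn_iff_continuous_domRestrict.1 σ.smooth_s.continuousOn
    have h1 : IsEmbedding f' := by
      refine IsEmbedding.of_comp hf' hg' ?_
      have : (fun q : σ.W => σ.s q) ∘ f' = Subtype.val := by
        ext1 u
        exact σ.s_j u u.2
      rw [this]
      exact IsEmbedding.subtypeVal
    exact IsEmbedding.subtypeVal.comp h1
  open_image := by
    refine ⟨σ.W, σ.isOpen_W, ?_⟩
    ext z
    constructor
    · rintro ⟨u, hu, rfl⟩
      exact ⟨σ.j_isotropy u hu, σ.j_mem u hu⟩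
    · rintro ⟨hz, hzW⟩
      have hzS := σ.proj_mem z hzW hz
      exact ⟨σ.s z, σ.s_mem z hzW hzS, σ.j_s h0 z hzW hzS⟩

end StratumChart

end OrbispaceChart

/-! ### Patches and the smooth structure of a stratum -/

namespace Orbispace

variable {X : Type u} [TopologicalSpace X] (𝒳 : Orbispace.{u, v, w} X)

/-- A chart of an orbispace together with a chart of the part of the stratum `S` in its image. -/
structure StratumPatch (S : Set X) (d : ℕ) where
  U : 𝒳.Obj
  y : (𝒳.chart U).dom
  σ : (𝒳.chart U).StratumChart S d y

variable {𝒳}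

theorem IsStratum.exists_patch {S : Set X} {d : ℕ} (hS : 𝒳.IsStratum S d) (x : S) :
    ∃ D : 𝒳.StratumPatch S d, (𝒳.chart D.U).proj D.y = x := by
  obtain ⟨U, y, hy, hS', hd⟩ := hS.2 x x.2
  obtain ⟨σ⟩ := (𝒳.chart U).nonempty_stratumChart hd (hy ▸ hS')
  exact ⟨⟨U, y, σ⟩, hy⟩

namespace StratumPatch

variable {S : Set X} {d : ℕ} (D : 𝒳.StratumPatch S d)

/-- The projection of the domain of a patch to `X`. -/
abbrev proj : (𝒳.chart D.U).dom → X := (𝒳.chart D.U).proj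

open Classical in
/-- The coordinates on the stratum given by a patch. -/
def coord (x : S) : Euc d :=
  if h : ∃ z ∈ D.σ.W, D.proj z = x then D.σ.s h.choose else 0

/-- The chosen lift is irrelevant, because `s` takes the same value at all lifts in `W` of a point
of `S`. -/
theorem coord_eq {x : S} {z : (𝒳.chart D.U).dom} (hz : z ∈ D.σ.W) (h : D.proj z = x) :
    D.coord x = D.σ.s z := by
  have h1 : ∃ z ∈ D.σ.W, D.proj z = x := ⟨z, hz, h⟩
  rw [coord, dif_pos h1]
  have h2 := h1.choose_spec
  refine D.σ.s_eq _ h2.1 _ hz ?_ (h2.2.trans h.symm)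
  rw [show (𝒳.chart D.U).proj h1.choose = x from h2.2]
  exact x.2

theorem proj_y_mem : D.proj D.y ∈ S := D.σ.proj_mem _ D.σ.mem_W rfl

open Classical in
/-- The parametrization of the stratum given by a patch. -/
def param (u : Euc d) : S :=
  -- Off `D.σ.O` any point of `S` would do; the base point of the patch is at hand.
  if h : u ∈ D.σ.O then ⟨D.proj (D.σ.j u), D.σ.proj_j_mem u h⟩ else ⟨_, D.proj_y_mem⟩

theorem param_eq {u : Euc d} (hu : u ∈ D.σ.O) : (D.param u : X) = D.proj (D.σ.j u) := by
  rw [param, dif_pos hu]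

/-- The chart of the stratum given by a patch. -/
def chart : OpenPartialHomeomorph S (Euc d) where
  toFun := D.coord
  invFun := D.param
  source := {x | ∃ z ∈ D.σ.W, D.proj z = x}
  target := D.σ.O
  map_source' := by
    rintro x ⟨z, hz, h⟩
    rw [D.coord_eq hz h]
    exact D.σ.s_mem z hz (by rw [show (𝒳.chart D.U).proj z = x from h]; exact x.2)
  map_target' u hu := ⟨D.σ.j u, D.σ.j_mem u hu, (D.param_eq hu).symm⟩
  left_inv' := by
    rintro x ⟨z, hz, h⟩
    have hzS : (𝒳.chart D.U).proj z ∈ S := by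
      rw [show (𝒳.chart D.U).proj z = x from h]
      exact x.2
    refine Subtype.ext ?_
    rw [D.coord_eq hz h, D.param_eq (D.σ.s_mem z hz hzS)]
    exact (D.σ.proj_j_s z hz hzS).trans h
  right_inv' u hu := by
    rw [D.coord_eq (D.σ.j_mem u hu) (D.param_eq hu).symm, D.σ.s_j u hu]
  open_source := by
    have h1 : {x : S | ∃ z ∈ D.σ.W, D.proj z = x} = Subtype.val ⁻¹' (D.proj '' D.σ.W) := rfl
    rw [h1]
    exact ((𝒳.chart D.U).isOpenMap_proj _ D.σ.isOpen_W).preimage continuous_subtype_val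
  open_target := D.σ.isOpen_O
  -- Continuity descends because the projection is open: it maps neighbourhoods of a lift to
  -- neighbourhoods in `X`.
  continuousOn_toFun := by
    rintro x ⟨z, hz, h⟩
    refine ContinuousAt.continuousWithinAt ?_
    intro T hT
    rw [D.coord_eq hz h] at hT
    have h1 : D.σ.s ⁻¹' T ∩ D.σ.W ∈ 𝓝 z :=
      inter_mem ((D.σ.smooth_s.continuousOn.continuousAt (D.σ.isOpen_W.mem_nhds hz)) hT)
        (D.σ.isOpen_W.mem_nhds hz)
    have h2 : D.proj '' (D.σ.s ⁻¹' T ∩ D.σ.W) ∈ 𝓝 (x : X) :=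
      h ▸ (𝒳.chart D.U).isOpenMap_proj.image_mem_nhds h1
    have h3 : Subtype.val ⁻¹' (D.proj '' (D.σ.s ⁻¹' T ∩ D.σ.W)) ∈ 𝓝 x :=
      continuous_subtype_val.continuousAt h2
    refine mem_map.2 (mem_of_superset h3 ?_)
    rintro x' ⟨z', ⟨hz', hz'W⟩, h'⟩
    change D.coord x' ∈ T
    rw [D.coord_eq hz'W h']
    exact hz'
  continuousOn_invFun := by
    rw [IsInducing.subtypeVal.continuousOn_iff]
    refine ContinuousOn.congr (f := D.proj ∘ D.σ.j) ?_ fun u hu => D.param_eq hu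
    exact (𝒳.chart D.U).continuous_proj.comp_continuousOn D.σ.smooth_j.continuousOn

theorem mem_chart_source_of_proj_y {x : S} (h : D.proj D.y = x) : x ∈ D.chart.source :=
  ⟨D.y, D.σ.mem_W, h⟩

theorem chart_apply {x : S} {z : (𝒳.chart D.U).dom} (hz : z ∈ D.σ.W) (h : D.proj z = x) :
    D.chart x = D.σ.s z := D.coord_eq hz h

theorem chart_symm_apply {u : Euc d} (hu : u ∈ D.σ.O) :
    (D.chart.symm u : X) = D.proj (D.σ.j u) := D.param_eq hu

variable {D}

/-- The points of the domain of a chart over a point in the domain of a patch can be moved into the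
section of that patch. -/
theorem exists_transfer (Ω : 𝒳.SymplecticForm) {U : 𝒳.Obj} {p : (𝒳.chart U).dom} {x : S}
    (hp : (𝒳.chart U).proj p = x) (hx : x ∈ D.chart.source) :
    ∃ θ : OpenPartialHomeomorph (𝒳.chart U).dom (𝒳.chart D.U).dom, Ω.IsTransfer θ ∧
      p ∈ θ.source ∧ θ p = D.σ.j (D.chart x) ∧ D.chart x ∈ D.σ.O ∧ θ p ∈ D.σ.W := by
  have h1 : D.chart x ∈ D.σ.O := D.chart.map_source hx
  have h2 : (𝒳.chart U).proj p = (𝒳.chart D.U).proj (D.σ.j (D.chart x)) := by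
    rw [hp]
    refine Eq.trans ?_ (D.chart_symm_apply h1)
    rw [D.chart.left_inv hx]
  obtain ⟨θ, hθ, hpθ, h3⟩ := Ω.exists_isTransfer h2
  exact ⟨θ, hθ, hpθ, h3, h1, h3 ▸ D.σ.j_mem _ h1⟩

theorem chart_eq {Ω : 𝒳.SymplecticForm} {U : 𝒳.Obj}
    {θ : OpenPartialHomeomorph (𝒳.chart U).dom (𝒳.chart D.U).dom} (hθ : Ω.IsTransfer θ)
    {x : S} {p : (𝒳.chart U).dom} (hpx : (𝒳.chart U).proj p = x) (hp : p ∈ θ.source)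
    (hpW : θ p ∈ D.σ.W) : x ∈ D.chart.source ∧ D.chart x = D.σ.s (θ p) :=
  ⟨⟨θ p, hpW, (hθ.proj_eq p hp).trans hpx⟩, D.chart_apply hpW ((hθ.proj_eq p hp).trans hpx)⟩

theorem contMDiffOn_s_comp {Ω : 𝒳.SymplecticForm} {U : 𝒳.Obj}
    {θ : OpenPartialHomeomorph (𝒳.chart U).dom (𝒳.chart D.U).dom} (hθ : Ω.IsTransfer θ) :
    ContMDiffOn (𝓡 (𝒳.chart U).dim) (𝓡 d) ∞ (D.σ.s ∘ θ) (θ.source ∩ θ ⁻¹' D.σ.W) :=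
  ContMDiffOn.comp (g := D.σ.s) D.σ.smooth_s (hθ.smooth.mono inter_subset_left) fun _ hz => hz.2

/-- Maps to a stratum which lift to smooth maps to charts are smooth in the charts of the
stratum. -/
theorem contDiffOn_chart_comp (Ω : 𝒳.SymplecticForm) (D : 𝒳.StratumPatch S d) {U : 𝒳.Obj} {k : ℕ}
    {O : Set (Euc k)} (hO : IsOpen O) {f : Euc k → (𝒳.chart U).dom} {q : Euc k → S}
    (hf : ContMDiffOn (𝓡 k) (𝓡 (𝒳.chart U).dim) ∞ f O)
    (hq : ∀ z ∈ O, (q z : X) = (𝒳.chart U).proj (f z)) :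
    ContinuousOn q O ∧ ContDiffOn ℝ ∞ (D.chart ∘ q) (O ∩ q ⁻¹' D.chart.source) := by
  constructor
  · rw [IsInducing.subtypeVal.continuousOn_iff]
    exact ((𝒳.chart U).continuous_proj.comp_continuousOn hf.continuousOn).congr hq
  · rintro z ⟨hz, hzs⟩
    obtain ⟨θ, hθ, hzθ, -, -, hzW⟩ := D.exists_transfer Ω (hq z hz).symm hzs
    set T := θ.source ∩ θ ⁻¹' D.σ.W
    have h1 : IsOpen (O ∩ f ⁻¹' T) :=
      hf.continuousOn.isOpen_inter_preimage hO (θ.isOpen_inter_preimage D.σ.isOpen_W)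
    have h2 : ContDiffOn ℝ ∞ ((D.σ.s ∘ θ) ∘ f) (O ∩ f ⁻¹' T) :=
      contMDiffOn_iff_contDiffOn.1 (ContMDiffOn.comp (g := D.σ.s ∘ θ) (contMDiffOn_s_comp hθ)
        (hf.mono inter_subset_left) fun _ h => h.2)
    have h3 : ContDiffOn ℝ ∞ (D.chart ∘ q) (O ∩ f ⁻¹' T) := h2.congr fun z' hz' =>
      (chart_eq hθ (hq z' hz'.1).symm hz'.2.1 hz'.2.2).2
    exact (h3.contDiffAt (h1.mem_nhds ⟨hz, hzθ, hzW⟩)).contDiffWithinAt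

end StratumPatch

namespace IsStratum

variable {S : Set X} {d : ℕ} (hS : 𝒳.IsStratum S d)

/-- The charts of a stratum. -/
@[reducible]
def chartedSpace : ChartedSpace (Euc d) S where
  atlas := range fun D : 𝒳.StratumPatch S d => D.chart
  chartAt x := (hS.exists_patch x).choose.chart
  mem_chart_source x :=
    (hS.exists_patch x).choose.mem_chart_source_of_proj_y (hS.exists_patch x).choose_spec
  chart_mem_atlas _ := mem_range_self _

/-- The inverse of a patch chart lifts to the smooth section `j`, so its composition with any other
patch chart is smooth by `contDiffOn_chart_comp`. -/
theorem isManifold (Ω : 𝒳.SymplecticForm) :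
    @IsManifold ℝ _ _ _ _ _ _ (𝓡 d) ∞ S _ hS.chartedSpace := by
  let := hS.chartedSpace
  refine isManifold_of_contDiffOn _ _ _ ?_
  rintro _ _ ⟨D, rfl⟩ ⟨D', rfl⟩
  have h1 := (D'.contDiffOn_chart_comp Ω D.σ.isOpen_O (q := D.chart.symm) D.σ.smooth_j
    fun u hu => D.chart_symm_apply hu).2
  refine h1.mono ?_
  simp only [modelWithCornersSelf_coe_symm, preimage_id_eq, id, OpenPartialHomeomorph.trans_source,
    OpenPartialHomeomorph.symm_source]
  rintro u ⟨hu, -⟩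
  exact hu

end IsStratum

end Orbispace

namespace Orbispace

variable {X : Type u} [TopologicalSpace X] {𝒳 : Orbispace.{u, v, w} X} {S : Set X} {d : ℕ}

/-! ### Projections to strata -/

/-- There are parametrized projections onto neighbourhoods of all points of a stratum. -/
theorem IsStratum.exists_parametrizedProjection (hS : 𝒳.IsStratum S d) (x : S) :
    ∃ (P : 𝒳.ParametrizedProjection S) (z : Euc P.k), z ∈ P.O ∧ P.q z = x := by
  classical
  obtain ⟨D, hD⟩ := hS.exists_patch x
  obtain ⟨k, O, i, hi, z, hz, hzy⟩ := (𝒳.chart D.U).isEmbeddedSubmanifold_isotropySet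
    (MulAction.stabilizer (𝒳.chart D.U).grp D.y) D.y rfl
  have hi' := hi.restrict D.σ.isOpen_W
  have hq : ∀ z ∈ O ∩ i ⁻¹' D.σ.W, (𝒳.chart D.U).proj (i z) ∈ S := fun z hz =>
    D.σ.proj_mem _ hz.2 (hi.map_mem hz.1)
  have hz' : z ∈ O ∩ i ⁻¹' D.σ.W := ⟨hz, by rw [mem_preimage, hzy]; exact D.σ.mem_W⟩
  refine ⟨{
    U := D.U
    H := _
    k := k
    O := O ∩ i ⁻¹' D.σ.W
    i := i
    isLocalParametrization := hi'
    q := fun z => if h : z ∈ O ∩ i ⁻¹' D.σ.W then ⟨_, hq z h⟩ else x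
    q_eq := fun z hz => by rw [dif_pos hz] }, z, hz', ?_⟩
  refine Subtype.ext ?_
  simp only [dif_pos hz']
  rw [hzy]
  exact hD

namespace ParametrizedProjection

variable (P : 𝒳.ParametrizedProjection S)

theorem exists_hasMFDerivAt_i {z : Euc P.k} (hz : z ∈ P.O) :
    ∃ D : Euc P.k →L[ℝ] Euc (𝒳.chart P.U).dim,
      HasMFDerivAt (𝓡 P.k) (𝓡 (𝒳.chart P.U).dim) P.i z D :=
  P.isLocalParametrization.smooth.exists_hasMFDerivAt P.isLocalParametrization.isOpen hz

/-- In the charts of a stratum the projections are submersions. -/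
theorem surjective_fderiv (Ω : 𝒳.SymplecticForm) (D : 𝒳.StratumPatch S d) {z : Euc P.k}
    (hz : z ∈ P.O) (hzs : P.q z ∈ D.chart.source) :
    Function.Surjective (fderiv ℝ (D.chart ∘ P.q) z) := by
  obtain ⟨θ, hθ, hzθ, hθz, hO, hW⟩ := D.exists_transfer Ω (P.q_eq z hz).symm hzs
  set u₀ := D.chart (P.q z)
  obtain ⟨I, hI⟩ := P.exists_hasMFDerivAt_i hz
  obtain ⟨T, T', hT, hT', -, hTT'⟩ := hθ.exists_hasMFDerivAt hzθ
  obtain ⟨E, hE⟩ := D.σ.smooth_s.exists_hasMFDerivAt D.σ.isOpen_W hW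
  obtain ⟨J, hJ⟩ := D.σ.smooth_j.exists_hasMFDerivAt D.σ.isOpen_O hO
  have hfd : HasFDerivAt (D.chart ∘ P.q) (E.comp (T.comp I)) z := by
    have h1 := hasMFDerivAt_iff_hasFDerivAt.1 (HasMFDerivAt.comp (g := D.σ.s) (f := θ ∘ P.i) z hE
      (hT.comp z hI))
    refine h1.congr_of_eventuallyEq ?_
    have h2 : P.O ∩ P.i ⁻¹' (θ.source ∩ θ ⁻¹' D.σ.W) ∈ 𝓝 z :=
      (P.isLocalParametrization.smooth.continuousOn.isOpen_inter_preimage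
        P.isLocalParametrization.isOpen (θ.isOpen_inter_preimage D.σ.isOpen_W)).mem_nhds
        ⟨hz, hzθ, hW⟩
    filter_upwards [h2] with z' hz'
    exact (StratumPatch.chart_eq hθ (P.q_eq z' hz'.1).symm hz'.2.1 hz'.2.2).2
  rw [hfd.fderiv]
  have hK : HasMFDerivAt (𝓡 d) (𝓡 (𝒳.chart P.U).dim) (θ.symm ∘ D.σ.j) u₀ (T'.comp J) := by
    rw [hθz] at hT'
    exact hT'.comp u₀ hJ
  have hKu : (θ.symm ∘ D.σ.j) u₀ = P.i z := by
    rw [Function.comp_apply, ← hθz, θ.left_inv hzθ]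
  obtain ⟨A, hA, hAl, -⟩ := (𝒳.chart P.U).exists_isotropy_average (P.i z)
  -- The vector `T' (J t)` lifts `t` but need not be tangent to the isotropy submanifold. Its
  -- isotropy translates lift `t` too, hence so does its average, which is tangent.
  have key : ∀ t κ, (E.comp T) ((𝒳.chart P.U).isotropyRep (P.i z) κ (T' (J t))) = t := by
    intro t κ
    set f := fun p : (𝒳.chart P.U).dom => (κ : (𝒳.chart P.U).grp) • p
    have hf : f (P.i z) = P.i z := κ.2
    have h1 := (𝒳.chart P.U).hasMFDerivAt_smul (P.i z) κ
    have h2 : HasMFDerivAt (𝓡 d) (𝓡 (𝒳.chart P.U).dim) (f ∘ θ.symm ∘ D.σ.j) u₀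
        (((𝒳.chart P.U).isotropyRep (P.i z) κ).comp (T'.comp J)) := by
      refine HasMFDerivAt.comp (g := f) u₀ ?_ hK
      rw [hKu]
      exact h1
    have h2u : (f ∘ θ.symm ∘ D.σ.j) u₀ = P.i z := by
      rw [Function.comp_apply, hKu, hf]
    have h3 : HasMFDerivAt (𝓡 d) (𝓡 d) ((D.σ.s ∘ θ) ∘ f ∘ θ.symm ∘ D.σ.j) u₀
        ((E.comp T).comp (((𝒳.chart P.U).isotropyRep (P.i z) κ).comp (T'.comp J))) := by
      refine HasMFDerivAt.comp (g := D.σ.s ∘ θ) u₀ ?_ h2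
      rw [h2u]
      exact hE.comp (P.i z) hT
    -- All the maps involved lie over the identity of `X`, and over `S` the value of `s` depends
    -- only on the projection to `X`.
    have h4 : (D.σ.s ∘ θ) ∘ f ∘ θ.symm ∘ D.σ.j =ᶠ[𝓝 u₀] id := by
      have h5 : ∀ᶠ u in 𝓝 u₀, (f ∘ θ.symm ∘ D.σ.j) u ∈ θ.source ∩ θ ⁻¹' D.σ.W := by
        refine h2.continuousAt.eventually_mem
          ((θ.isOpen_inter_preimage D.σ.isOpen_W).mem_nhds ?_)
        rw [h2u]
        exact ⟨hzθ, hW⟩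
      have h6 : ∀ᶠ u in 𝓝 u₀, D.σ.j u ∈ θ.target := by
        refine hJ.continuousAt.eventually_mem (θ.open_target.mem_nhds ?_)
        rw [← hθz]
        exact θ.map_source hzθ
      filter_upwards [h5, h6, D.σ.isOpen_O.mem_nhds hO] with u hu1 hu2 hu3
      have h7 : (𝒳.chart D.U).proj (D.σ.j u) =
          (𝒳.chart D.U).proj (((θ ∘ f) ∘ θ.symm ∘ D.σ.j) u) := by
        have h8 := hθ.proj_eq _ hu1.1
        refine Eq.trans ?_ h8.symm
        refine Eq.trans ?_ ((𝒳.chart P.U).proj_smul _ _).symm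
        rw [Function.comp_apply, ← hθ.proj_eq _ (θ.map_target hu2), θ.right_inv hu2]
      exact (D.σ.s_eq _ (D.σ.j_mem u hu3) _ hu1.2 (D.σ.proj_j_mem u hu3) h7).symm.trans
        (D.σ.s_j u hu3)
    exact DFunLike.congr_fun (hasMFDerivAt_unique h3 ((hasMFDerivAt_id u₀).congr_of_eventuallyEq h4)) t
  intro t
  have h1 := hAl (E.comp T) (T' (J t)) t (key t)
  obtain ⟨v, hv⟩ : A (T' (J t)) ∈ range I := by
    rw [OrbispaceChart.range_eq_fixedSpace P.isLocalParametrization hz hI]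
    exact hA _
  refine ⟨v, ?_⟩
  rw [← h1, ← hv]
  rfl

end ParametrizedProjection

theorem IsStratum.projectionsAreSubmersions (hS : 𝒳.IsStratum S d) (Ω : 𝒳.SymplecticForm) :
    @ProjectionsAreSubmersions X _ 𝒳 S d hS.chartedSpace := by
  let := hS.chartedSpace
  have := hS.isManifold Ω
  intro P
  have key : ∀ z ∈ P.O, ContMDiffAt (𝓡 P.k) (𝓡 d) ∞ P.q z ∧
      Function.Surjective (mfderiv (𝓡 P.k) (𝓡 d) P.q z) := by
    intro z hz
    obtain ⟨D, hD⟩ := hS.exists_patch (P.q z)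
    have hzs := D.mem_chart_source_of_proj_y hD
    have hDa : D.chart ∈ atlas (Euc d) S := mem_range_self D
    obtain ⟨h1, h2⟩ := D.contDiffOn_chart_comp Ω P.isLocalParametrization.isOpen
      P.isLocalParametrization.smooth P.q_eq
    have h3 : IsOpen (P.O ∩ P.q ⁻¹' D.chart.source) :=
      h1.isOpen_inter_preimage P.isLocalParametrization.isOpen D.chart.open_source
    have h4 : ContMDiffOn (𝓡 P.k) (𝓡 d) ∞ (D.chart.symm ∘ D.chart ∘ P.q)
        (P.O ∩ P.q ⁻¹' D.chart.source) :=
      ContMDiffOn.comp (g := D.chart.symm) (t := D.chart.target)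
        (contMDiffOn_symm_of_mem_maximalAtlas (IsManifold.subset_maximalAtlas hDa))
        (contMDiffOn_iff_contDiffOn.2 h2) fun z' hz' => D.chart.map_source hz'.2
    have h5 : ContMDiffOn (𝓡 P.k) (𝓡 d) ∞ P.q (P.O ∩ P.q ⁻¹' D.chart.source) :=
      h4.congr fun z' hz' => (D.chart.left_inv hz'.2).symm
    refine ⟨h5.contMDiffAt (h3.mem_nhds ⟨hz, hzs⟩), ?_⟩
    obtain ⟨Q, hQ⟩ := h5.exists_hasMFDerivAt h3 ⟨hz, hzs⟩
    obtain ⟨E, E', hE, -, hEE, -⟩ := hasMFDerivAt_atlas hDa hzs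
    have h6 := P.surjective_fderiv Ω D hz hzs
    have h7 : HasFDerivAt (D.chart ∘ P.q) (E.comp Q) z :=
      hasMFDerivAt_iff_hasFDerivAt.1 (hE.comp z hQ)
    rw [h7.fderiv] at h6
    rw [hQ.mfderiv]
    intro t
    obtain ⟨v, hv⟩ := h6 (E t)
    refine ⟨v, ?_⟩
    exact (hEE (Q v)).symm.trans ((congrArg E' hv).trans (hEE t))
  exact ⟨fun z hz => (key z hz).1.contMDiffWithinAt, fun z hz => (key z hz).2⟩

section Submersions

variable [ChartedSpace (Euc d) S] [IsManifold (𝓡 d) ∞ S]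

theorem ProjectionsAreSubmersions.exists_hasMFDerivAt (h : 𝒳.ProjectionsAreSubmersions S d)
    (P : 𝒳.ParametrizedProjection S) {z : Euc P.k} (hz : z ∈ P.O) :
    ∃ Q : Euc P.k →L[ℝ] Euc d, HasMFDerivAt (𝓡 P.k) (𝓡 d) P.q z Q ∧ Function.Surjective Q := by
  obtain ⟨Q, hQ⟩ := (h P).1.exists_hasMFDerivAt P.isLocalParametrization.isOpen hz
  have h1 := (h P).2 z hz
  rw [hQ.mfderiv] at h1
  exact ⟨Q, hQ, h1⟩

/-- The projections have smooth local sections. -/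
theorem ProjectionsAreSubmersions.exists_section (h : 𝒳.ProjectionsAreSubmersions S d)
    (P : 𝒳.ParametrizedProjection S) {z : Euc P.k} (hz : z ∈ P.O) :
    ∃ (r : S → Euc P.k) (V : Set S), IsOpen V ∧ P.q z ∈ V ∧ ContMDiffOn (𝓡 d) (𝓡 P.k) ∞ r V ∧
      ∀ x ∈ V, r x ∈ P.O ∧ P.q (r x) = x := by
  set e := chartAt (Euc d) (P.q z)
  have hO := P.isLocalParametrization.isOpen
  have hzs : P.q z ∈ e.source := mem_chart_source _ _
  have h1 : IsOpen (P.O ∩ P.q ⁻¹' e.source) :=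
    (h P).1.continuousOn.isOpen_inter_preimage hO e.open_source
  have h2 : ContDiffOn ℝ ∞ (e ∘ P.q) (P.O ∩ P.q ⁻¹' e.source) :=
    contMDiffOn_iff_contDiffOn.1 (ContMDiffOn.comp (g := e) (t := e.source)
      (contMDiffOn_chart (I := 𝓡 d) (n := ∞)) ((h P).1.mono inter_subset_left) fun _ h => h.2)
  obtain ⟨Q, hQ, hQs⟩ := h.exists_hasMFDerivAt P hz
  obtain ⟨E, E', hE, -, -, hEE⟩ := hasMFDerivAt_atlas (chart_mem_atlas (Euc d) (P.q z)) hzs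
  have h3 : HasFDerivAt (e ∘ P.q) (E.comp Q) z := hasMFDerivAt_iff_hasFDerivAt.1 (hE.comp z hQ)
  have h4 : Function.Surjective (fderiv ℝ (e ∘ P.q) z) := by
    rw [h3.fderiv]
    intro t
    obtain ⟨v, hv⟩ := hQs (E' t)
    refine ⟨v, ?_⟩
    change E (Q v) = t
    rw [hv, hEE]
  obtain ⟨r, V, hV, hzV, hr, -, hrV⟩ := h2.exists_right_inverse h1 ⟨hz, hzs⟩ h4
  refine ⟨r ∘ e, e.source ∩ e ⁻¹' V, e.isOpen_inter_preimage hV, ⟨hzs, hzV⟩, ?_, ?_⟩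
  · exact ContMDiffOn.comp (g := r) (t := V) (contMDiffOn_iff_contDiffOn.2 hr)
      ((contMDiffOn_chart (I := 𝓡 d) (n := ∞)).mono inter_subset_left) fun _ h => h.2
  · rintro x ⟨hx, hxV⟩
    obtain ⟨⟨h5, h6⟩, h7⟩ := hrV _ hxV
    exact ⟨h5, e.injOn h6 hx h7⟩

/-- Maps on a stratum are smooth if their compositions with the projections are smooth. -/
theorem ProjectionsAreSubmersions.contMDiff_of_comp (hS : 𝒳.IsStratum S d)
    (h : 𝒳.ProjectionsAreSubmersions S d) {E' H' N : Type*} [NormedAddCommGroup E']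
    [NormedSpace ℝ E'] [TopologicalSpace H'] {I' : ModelWithCorners ℝ E' H'} [TopologicalSpace N]
    [ChartedSpace H' N] {f : S → N}
    (hf : ∀ P : 𝒳.ParametrizedProjection S, ContMDiffOn (𝓡 P.k) I' ∞ (f ∘ P.q) P.O) :
    ContMDiff (𝓡 d) I' ∞ f := by
  intro x
  obtain ⟨P, z, hz, rfl⟩ := hS.exists_parametrizedProjection x
  obtain ⟨r, V, hV, hzV, hr, hrV⟩ := h.exists_section P hz
  have h1 : ContMDiffOn (𝓡 d) I' ∞ ((f ∘ P.q) ∘ r) V :=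
    (hf P).comp hr fun x hx => (hrV x hx).1
  have h2 : ContMDiffOn (𝓡 d) I' ∞ f V := h1.congr fun x hx => by
    simp only [Function.comp_apply, (hrV x hx).2]
  exact h2.contMDiffAt (hV.mem_nhds hzV)

end Submersions

end Orbispace

/-- Diffeomorphisms pull back the charts of the maximal atlas. -/
theorem Homeomorph.trans_mem_maximalAtlas {M M' : Type*} [TopologicalSpace M] [TopologicalSpace M']
    {d : ℕ} [ChartedSpace (Euc d) M] [ChartedSpace (Euc d) M'] [IsManifold (𝓡 d) ∞ M]
    [IsManifold (𝓡 d) ∞ M'] (f : M ≃ₜ M') (hf : ContMDiff (𝓡 d) (𝓡 d) ∞ f)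
    (hf' : ContMDiff (𝓡 d) (𝓡 d) ∞ f.symm) {e : OpenPartialHomeomorph M' (Euc d)}
    (he : e ∈ IsManifold.maximalAtlas (𝓡 d) ∞ M') :
    f.transOpenPartialHomeomorph e ∈ IsManifold.maximalAtlas (𝓡 d) ∞ M := by
  refine OpenPartialHomeomorph.mem_maximalAtlas_of_contMDiffOn _ ?_ ?_
  · exact ContMDiffOn.comp (g := e) (t := e.source) (contMDiffOn_of_mem_maximalAtlas he)
      hf.contMDiffOn fun _ h => h
  · exact ContMDiffOn.comp (g := f.symm) (t := univ) hf'.contMDiffOn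
      (contMDiffOn_symm_of_mem_maximalAtlas he) fun _ _ => trivial

/-- Two smooth structures between which the identity is smooth have the same maximal atlas. -/
theorem maximalAtlas_subset_of_contMDiff_id {M : Type*} [TopologicalSpace M] {d : ℕ}
    (c c' : ChartedSpace (Euc d) M) (hc : @IsManifold ℝ _ _ _ _ _ _ (𝓡 d) ∞ M _ c)
    (hc' : @IsManifold ℝ _ _ _ _ _ _ (𝓡 d) ∞ M _ c')
    (h : @ContMDiff ℝ _ _ _ _ _ _ (𝓡 d) M _ c _ _ _ _ _ (𝓡 d) M _ c' ∞ id)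
    (h' : @ContMDiff ℝ _ _ _ _ _ _ (𝓡 d) M _ c' _ _ _ _ _ (𝓡 d) M _ c ∞ id) :
    @IsManifold.maximalAtlas ℝ _ _ _ _ _ _ (𝓡 d) ∞ M _ c' ⊆
      @IsManifold.maximalAtlas ℝ _ _ _ _ _ _ (𝓡 d) ∞ M _ c := fun e he => by
  have h1 := @Homeomorph.trans_mem_maximalAtlas M M _ _ d c c' hc hc' (Homeomorph.refl M) h h' e he
  have h2 : (Homeomorph.refl M).transOpenPartialHomeomorph e = e := by
    ext x
    · rfl
    · rfl
    · rfl
  rwa [h2] at h1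

/-! ### Uniqueness of the smooth structure -/

namespace Orbispace

variable {X : Type u} [TopologicalSpace X] {𝒳 : Orbispace.{u, v, w} X} {S : Set X} {d : ℕ}

/-- The smooth structure of a stratum is unique. -/
theorem IsStratum.maximalAtlas_eq (hS : 𝒳.IsStratum S d) (c c' : ChartedSpace (Euc d) S)
    (hc : @IsManifold ℝ _ _ _ _ _ _ (𝓡 d) ∞ S _ c) (hc' : @IsManifold ℝ _ _ _ _ _ _ (𝓡 d) ∞ S _ c')
    (h : @ProjectionsAreSubmersions X _ 𝒳 S d c) (h' : @ProjectionsAreSubmersions X _ 𝒳 S d c') :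
    @IsManifold.maximalAtlas ℝ _ _ _ _ _ _ (𝓡 d) ∞ S _ c' =
      @IsManifold.maximalAtlas ℝ _ _ _ _ _ _ (𝓡 d) ∞ S _ c := by
  -- The identity is tested on projections: composed with it they are smooth for the other structure
  -- by hypothesis.
  have h1 := @ProjectionsAreSubmersions.contMDiff_of_comp X _ 𝒳 S d c hc hS h (Euc d) (Euc d) S
    _ _ _ (𝓡 d) _ c' id fun P => (h' P).1
  have h2 := @ProjectionsAreSubmersions.contMDiff_of_comp X _ 𝒳 S d c' hc' hS h' (Euc d) (Euc d) S
    _ _ _ (𝓡 d) _ c id fun P => (h P).1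
  exact (maximalAtlas_subset_of_contMDiff_id c c' hc hc' h1 h2).antisymm
    (maximalAtlas_subset_of_contMDiff_id c' c hc' hc h2 h1)

end Orbispace

/-! ### Poisson brackets on open subsets of Euclidean spaces -/

section Bracket

variable {k : ℕ} {η : Euc k → Euc k [⋀^Fin 2]→L[ℝ] ℝ} {O : Set (Euc k)} {φ ψ χ : Euc k → ℝ}
  {z : Euc k}

theorem IsSymplecticOn.isInvertible_flatL (h : IsSymplecticOn η O) (hz : z ∈ O) :
    (flatL (η z)).IsInvertible := by
  have hdim : Module.finrank ℝ (Euc k) = Module.finrank ℝ (Euc k →L[ℝ] ℝ) := by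
    rw [← (LinearMap.toContinuousLinearMap (𝕜 := ℝ) (E := Euc k) (F' := ℝ)).finrank_eq]
    exact (Subspace.dual_finrank_eq (K := ℝ) (V := Euc k)).symm
  have hinj : Function.Injective (flatL (η z)).toLinearMap := by
    refine (injective_iff_map_eq_zero _).2 fun v hv => h.nondegenerate z hz v fun v' => ?_
    exact DFunLike.congr_fun hv v'
  refine ⟨(LinearMap.linearEquivOfInjective _ hinj hdim).toContinuousLinearEquiv, ?_⟩
  ext1 v
  rfl

/-- The Hamiltonian vector field of a function. -/
def hamiltonianField (η : Euc k → Euc k [⋀^Fin 2]→L[ℝ] ℝ) (φ : Euc k → ℝ) (z : Euc k) : Euc k :=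
  (flatL (η z)).inverse (fderiv ℝ φ z)

/-- The Poisson bracket of two functions. -/
def poissonBracket (η : Euc k → Euc k [⋀^Fin 2]→L[ℝ] ℝ) (φ ψ : Euc k → ℝ) (z : Euc k) : ℝ :=
  flatL (η z) (hamiltonianField η φ z) (hamiltonianField η ψ z)

theorem IsSymplecticOn.flatL_hamiltonianField (h : IsSymplecticOn η O) (hz : z ∈ O) :
    flatL (η z) (hamiltonianField η φ z) = fderiv ℝ φ z := by
  obtain ⟨e, he⟩ := h.isInvertible_flatL hz
  rw [hamiltonianField, ← he, ContinuousLinearMap.inverse_equiv]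
  exact e.apply_symm_apply _

theorem IsSymplecticOn.eq_of_flatL_eq (h : IsSymplecticOn η O) (hz : z ∈ O) {a b : Euc k}
    (hab : flatL (η z) a = flatL (η z) b) : a = b := by
  obtain ⟨e, he⟩ := h.isInvertible_flatL hz
  rw [← he] at hab
  exact e.injective hab

theorem IsSymplecticOn.contDiffOn_hamiltonianField (h : IsSymplecticOn η O) (hO : IsOpen O)
    (hφ : ContDiffOn ℝ ∞ φ O) : ContDiffOn ℝ ∞ (hamiltonianField η φ) O := by
  have h1 : ContDiffOn ℝ ∞ (fun z => (flatL (η z)).inverse) O := fun z hz =>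
    (ContDiffAt.comp (g := ContinuousLinearMap.inverse) (f := fun z => flatL (η z)) z
      (h.isInvertible_flatL hz).contDiffAt_map_inverse
      (h.smooth.flatL.contDiffAt (hO.mem_nhds hz))).contDiffWithinAt
  exact h1.clm_apply (hφ.fderiv_of_isOpen hO (m := ∞) (by simp))

theorem IsSymplecticOn.contDiffOn_poissonBracket (h : IsSymplecticOn η O) (hO : IsOpen O)
    (hφ : ContDiffOn ℝ ∞ φ O) (hψ : ContDiffOn ℝ ∞ ψ O) :
    ContDiffOn ℝ ∞ (poissonBracket η φ ψ) O :=
  (h.smooth.flatL.clm_apply (h.contDiffOn_hamiltonianField hO hφ)).clm_apply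
    (h.contDiffOn_hamiltonianField hO hψ)

theorem poissonBracket_swap (φ ψ : Euc k → ℝ) (z : Euc k) :
    poissonBracket η φ ψ z = -poissonBracket η ψ φ z := flatL_swap _ _ _

theorem IsSymplecticOn.poissonBracket_eq (h : IsSymplecticOn η O) (hz : z ∈ O) :
    poissonBracket η φ ψ z = fderiv ℝ φ z (hamiltonianField η ψ z) := by
  rw [poissonBracket, h.flatL_hamiltonianField hz]

/-- Differentiating the defining equation of a Hamiltonian field expresses its derivative, paired by
η, through second derivatives of the function and the derivative of η. No derivative of a field
remains. -/
theorem IsSymplecticOn.hasFDerivAt_poissonBracket (h : IsSymplecticOn η O) (hO : IsOpen O)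
    (hz : z ∈ O) (hφ : ContDiffOn ℝ ∞ φ O) (hψ : ContDiffOn ℝ ∞ ψ O) (t : Euc k) :
    fderiv ℝ (poissonBracket η φ ψ) z t =
      fderiv ℝ (fderiv ℝ φ) z t (hamiltonianField η ψ z) -
        fderiv ℝ (fderiv ℝ ψ) z t (hamiltonianField η φ z) -
        flatL (fderiv ℝ η z t) (hamiltonianField η φ z) (hamiltonianField η ψ z) := by
  have hOz := hO.mem_nhds hz
  have hη : HasFDerivAt (fun z => flatL (η z)) (flatL.comp (fderiv ℝ η z)) z :=
    HasFDerivAt.comp (g := flatL) (f := η) z (ContinuousLinearMap.hasFDerivAt (𝕜 := ℝ)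
      (E := Euc k [⋀^Fin 2]→L[ℝ] ℝ) (F := Euc k →L[ℝ] Euc k →L[ℝ] ℝ) (flatL (n := k)))
      ((h.smooth.contDiffAt hOz).differentiableAt (by simp)).hasFDerivAt
  have key : ∀ {φ : Euc k → ℝ}, ContDiffOn ℝ ∞ φ O → ∃ A : Euc k →L[ℝ] Euc k,
      HasFDerivAt (hamiltonianField η φ) A z ∧ ∀ t s, flatL (η z) (A t) s =
        fderiv ℝ (fderiv ℝ φ) z t s - flatL (fderiv ℝ η z t) (hamiltonianField η φ z) s := by
    intro φ hφ
    have h1 := (((h.contDiffOn_hamiltonianField hO hφ).contDiffAt hOz).differentiableAt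
      (by simp)).hasFDerivAt
    refine ⟨_, h1, fun t s => ?_⟩
    have h2 := hη.clm_apply h1
    have h3 : (fun z => flatL (η z) (hamiltonianField η φ z)) =ᶠ[𝓝 z] fderiv ℝ φ :=
      Filter.eventually_of_mem hOz fun z' hz' => h.flatL_hamiltonianField hz'
    have h4 := DFunLike.congr_fun (DFunLike.congr_fun (h2.fderiv.symm.trans h3.fderiv_eq) t) s
    have h5 : flatL (η z) (fderiv ℝ (hamiltonianField η φ) z t) s +
        flatL (fderiv ℝ η z t) (hamiltonianField η φ z) s = fderiv ℝ (fderiv ℝ φ) z t s := h4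
    exact eq_sub_of_add_eq h5
  obtain ⟨A, hA, hA'⟩ := key hφ
  obtain ⟨B, hB, hB'⟩ := key hψ
  have h1 := ((hη.clm_apply hA).clm_apply hB).fderiv
  have h2 := DFunLike.congr_fun h1 t
  have h3 : fderiv ℝ (poissonBracket η φ ψ) z t =
      flatL (η z) (hamiltonianField η φ z) (B t) +
        (flatL (η z) (A t) (hamiltonianField η ψ z) +
          flatL (fderiv ℝ η z t) (hamiltonianField η φ z) (hamiltonianField η ψ z)) := h2
  rw [h3, hA', flatL_swap (η z) _ (B t), hB',
    flatL_swap (fderiv ℝ η z t) (hamiltonianField η ψ z)]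
  ring

theorem extDeriv_apply_three (hη : DifferentiableAt ℝ η z) (a b c : Euc k) :
    extDeriv η z ![a, b, c] = flatL (fderiv ℝ η z a) b c - flatL (fderiv ℝ η z b) a c +
      flatL (fderiv ℝ η z c) a b := by
  have key : ∀ (u : Fin 2 → Euc k) (t : Euc k),
      fderiv ℝ (fun x => η x u) z t = flatL (fderiv ℝ η z t) (u 0) (u 1) := by
    intro u t
    have h1 := ((evalL (u 0) (u 1)).hasFDerivAt.comp z hη.hasFDerivAt).fderiv
    have h2 : (fun x => η x u) = evalL (u 0) (u 1) ∘ η := by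
      ext1 x
      change η x u = η x ![u 0, u 1]
      rw [vecCons_eta]
    rw [h2, h1]
    rfl
  rw [extDeriv_apply hη, Fin.sum_univ_three]
  simp only [key]
  simp [Fin.removeNth, Fin.succAbove]
  ring

/-- The Jacobi identity for the Poisson bracket of a symplectic form. -/
theorem IsSymplecticOn.jacobi (h : IsSymplecticOn η O) (hO : IsOpen O) (hz : z ∈ O)
    (hφ : ContDiffOn ℝ ∞ φ O) (hψ : ContDiffOn ℝ ∞ ψ O) (hχ : ContDiffOn ℝ ∞ χ O) :
    poissonBracket η φ (poissonBracket η ψ χ) z + poissonBracket η ψ (poissonBracket η χ φ) z +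
      poissonBracket η χ (poissonBracket η φ ψ) z = 0 := by
  have hOz := hO.mem_nhds hz
  have hsymm : ∀ {φ : Euc k → ℝ}, ContDiffOn ℝ ∞ φ O → ∀ a b,
      fderiv ℝ (fderiv ℝ φ) z a b = fderiv ℝ (fderiv ℝ φ) z b a := fun hφ a b =>
    (hφ.contDiffAt hOz).isSymmSndFDerivAt (by
      rw [minSmoothness_of_isRCLikeNormedField]
      exact ENat.LEInfty.out) a b
  have h1 := extDeriv_apply_three ((h.smooth.contDiffAt hOz).differentiableAt (by simp))
    (hamiltonianField η φ z) (hamiltonianField η ψ z) (hamiltonianField η χ z)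
  rw [h.closed z hz] at h1
  have h2 : (0 : ℝ) = _ := h1
  -- Second derivatives cancel in pairs by symmetry; what remains is the exterior derivative of η on
  -- the three Hamiltonian vectors.
  rw [poissonBracket_swap φ, poissonBracket_swap ψ (poissonBracket η χ φ),
    poissonBracket_swap χ (poissonBracket η φ ψ), h.poissonBracket_eq hz, h.poissonBracket_eq hz,
    h.poissonBracket_eq hz, h.hasFDerivAt_poissonBracket hO hz hψ hχ,
    h.hasFDerivAt_poissonBracket hO hz hχ hφ, h.hasFDerivAt_poissonBracket hO hz hφ hψ,
    hsymm hψ (hamiltonianField η φ z), hsymm hχ (hamiltonianField η φ z),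
    hsymm hφ (hamiltonianField η ψ z),
    flatL_swap (fderiv ℝ η z (hamiltonianField η ψ z)) (hamiltonianField η χ z)]
  linarith

theorem IsSymplecticOn.isBracketValue_iff (h : IsSymplecticOn η O) (hz : z ∈ O) {r : ℝ} :
    IsBracketValue (n := k) η φ ψ z r ↔ r = poissonBracket η φ ψ z := by
  have key : ∀ {φ : Euc k → ℝ} {X : Euc k},
      (∀ t : Euc k, η z ![X, t] = (mfderiv (𝓡 k) 𝓘(ℝ, ℝ) φ z t : ℝ)) ↔
        X = hamiltonianField η φ z := by
    intro φ X
    rw [mfderiv_eq_fderiv]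
    constructor
    · intro hX
      refine h.eq_of_flatL_eq hz ?_
      rw [h.flatL_hamiltonianField hz]
      ext1 t
      exact hX t
    · rintro rfl t
      exact DFunLike.congr_fun (h.flatL_hamiltonianField hz) t
  constructor
  · rintro ⟨Xf, Xg, hf, hg, rfl⟩
    rw [key.1 hf, key.1 hg]
    rfl
  · rintro rfl
    exact ⟨hamiltonianField η φ z, hamiltonianField η ψ z, key.2 rfl, key.2 rfl, rfl⟩

end Bracket

namespace Orbispace

variable {X : Type u} [TopologicalSpace X] {𝒳 : Orbispace.{u, v, w} X} {S : Set X} {d : ℕ}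

/-! ### The Poisson bracket on a stratum -/

/-- The derivative of a path in a stratum in terms of a lift to a chart. -/
theorem StratumPatch.hasFDerivAt_lift {Ω : 𝒳.SymplecticForm} {D : 𝒳.StratumPatch S d} {U : 𝒳.Obj}
    {θ : OpenPartialHomeomorph (𝒳.chart U).dom (𝒳.chart D.U).dom} (hθ : Ω.IsTransfer θ)
    {m : ℕ} {c : Euc m → (𝒳.chart U).dom} {x : Euc m → S} {w₀ : Euc m}
    (hx : ∀ᶠ w in 𝓝 w₀, (𝒳.chart U).proj (c w) = x w) (hcθ : c w₀ ∈ θ.source)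
    (hcW : θ (c w₀) ∈ D.σ.W) {E : Euc (𝒳.chart D.U).dim →L[ℝ] Euc d}
    {T : Euc (𝒳.chart U).dim →L[ℝ] Euc (𝒳.chart D.U).dim} {C : Euc m →L[ℝ] Euc (𝒳.chart U).dim}
    (hE : HasMFDerivAt (𝓡 (𝒳.chart D.U).dim) (𝓡 d) D.σ.s (θ (c w₀)) E)
    (hT : HasMFDerivAt (𝓡 (𝒳.chart U).dim) (𝓡 (𝒳.chart D.U).dim) θ (c w₀) T)
    (hC : HasMFDerivAt (𝓡 m) (𝓡 (𝒳.chart U).dim) c w₀ C) :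
    HasFDerivAt (D.chart ∘ x) (E.comp (T.comp C)) w₀ ∧ ∀ᶠ w in 𝓝 w₀, x w ∈ D.chart.source := by
  have h1 := hasMFDerivAt_iff_hasFDerivAt.1 (HasMFDerivAt.comp (g := D.σ.s) (f := θ ∘ c) w₀ hE
    (hT.comp w₀ hC))
  have h2 : ∀ᶠ w in 𝓝 w₀, c w ∈ θ.source ∩ θ ⁻¹' D.σ.W :=
    hC.continuousAt.eventually_mem ((θ.isOpen_inter_preimage D.σ.isOpen_W).mem_nhds ⟨hcθ, hcW⟩)
  constructor
  · refine h1.congr_of_eventuallyEq ?_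
    filter_upwards [h2, hx] with w hw hxw
    exact (StratumPatch.chart_eq hθ hxw hw.1 hw.2).2
  · filter_upwards [h2, hx] with w hw hxw
    exact (StratumPatch.chart_eq hθ hxw hw.1 hw.2).1

namespace ParametrizedProjection

variable (P : 𝒳.ParametrizedProjection S)

/-- The restriction of the symplectic form in the local parametrization. -/
def form (Ω : 𝒳.SymplecticForm) : Euc P.k → Euc P.k [⋀^Fin 2]→L[ℝ] ℝ :=
  TwoForm.pullback (m := P.k) P.i (Ω.form P.U)

theorem isSymplecticOn_form (Ω : 𝒳.SymplecticForm) : IsSymplecticOn (P.form Ω) P.O :=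
  OrbispaceChart.restrictsToSymplectic_isotropySet (Ω.symplectic P.U) (Ω.invariant P.U) P.H _ _ _
    P.isLocalParametrization

theorem flatL_form (Ω : 𝒳.SymplecticForm) {z : Euc P.k}
    {I : Euc P.k →L[ℝ] Euc (𝒳.chart P.U).dim}
    (hI : HasMFDerivAt (𝓡 P.k) (𝓡 (𝒳.chart P.U).dim) P.i z I) (a b : Euc P.k) :
    flatL (P.form Ω z) a b = (Ω.form P.U).flat (P.i z) (I a) (I b) :=
  (Ω.form P.U).flat_pullback hI a b

variable [ChartedSpace (Euc d) S] [IsManifold (𝓡 d) ∞ S]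

theorem contDiffOn_comp_q (h : 𝒳.ProjectionsAreSubmersions S d)
    {f : S → ℝ} (hf : ContMDiff (𝓡 d) 𝓘(ℝ, ℝ) ∞ f) : ContDiffOn ℝ ∞ (f ∘ P.q) P.O :=
  contMDiffOn_iff_contDiffOn.1 (hf.comp_contMDiffOn (h P).1)

variable {P}

/-- The images of Hamiltonian vectors on isotropy submanifolds are Hamiltonian with respect to all
paths in the stratum. -/
theorem fderiv_comp_lift (hat : ∀ D : 𝒳.StratumPatch S d,
      D.chart ∈ IsManifold.maximalAtlas (𝓡 d) ∞ S) (hS : 𝒳.IsStratum S d)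
    (Ω : 𝒳.SymplecticForm) {z : Euc P.k} (hz : z ∈ P.O)
    {I : Euc P.k →L[ℝ] Euc (𝒳.chart P.U).dim}
    (hI : HasMFDerivAt (𝓡 P.k) (𝓡 (𝒳.chart P.U).dim) P.i z I)
    {f : S → ℝ} (hf : ContMDiff (𝓡 d) 𝓘(ℝ, ℝ) ∞ f)
    {m : ℕ} {c : Euc m → (𝒳.chart P.U).dom} {x : Euc m → S} {w₀ : Euc m} (hc : c w₀ = P.i z)
    (hx : ∀ᶠ w in 𝓝 w₀, (𝒳.chart P.U).proj (c w) = x w)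
    {C : Euc m →L[ℝ] Euc (𝒳.chart P.U).dim}
    (hC : HasMFDerivAt (𝓡 m) (𝓡 (𝒳.chart P.U).dim) c w₀ C) (t : Euc m) :
    fderiv ℝ (f ∘ x) w₀ t = (Ω.form P.U).flat (P.i z)
      (I (hamiltonianField (P.form Ω) (f ∘ P.q) z)) (C t) := by
  obtain ⟨D, hD⟩ := hS.exists_patch (P.q z)
  have hzs := D.mem_chart_source_of_proj_y hD
  obtain ⟨θ, hθ, hzθ, hθz, hO, hW⟩ := D.exists_transfer Ω (P.q_eq z hz).symm hzs
  obtain ⟨T, -, hT, -⟩ := hθ.exists_hasMFDerivAt hzθ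
  obtain ⟨E, hE⟩ := D.σ.smooth_s.exists_hasMFDerivAt D.σ.isOpen_W hW
  obtain ⟨A, hA, hAl, hAΩ⟩ := (𝒳.chart P.U).exists_isotropy_average (P.i z)
  have hG : DifferentiableAt ℝ (f ∘ D.chart.symm) (D.chart (P.q z)) := by
    have h1 : ContMDiffOn (𝓡 d) 𝓘(ℝ, ℝ) ∞ (f ∘ D.chart.symm) D.chart.target :=
      hf.comp_contMDiffOn (contMDiffOn_symm_of_mem_maximalAtlas (hat D))
    exact ((contMDiffOn_iff_contDiffOn.1 h1).contDiffAt
      (D.chart.open_target.mem_nhds (D.chart.map_source hzs))).differentiableAt (by simp)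
  set G := fderiv ℝ (f ∘ D.chart.symm) (D.chart (P.q z))
  have key : ∀ {m : ℕ} {c : Euc m → (𝒳.chart P.U).dom} {x : Euc m → S} {w₀ : Euc m}
      {C : Euc m →L[ℝ] Euc (𝒳.chart P.U).dim}, c w₀ = P.i z →
      (∀ᶠ w in 𝓝 w₀, (𝒳.chart P.U).proj (c w) = x w) →
      HasMFDerivAt (𝓡 m) (𝓡 (𝒳.chart P.U).dim) c w₀ C →
      HasFDerivAt (D.chart ∘ x) (E.comp (T.comp C)) w₀ ∧
        HasFDerivAt (f ∘ x) (G.comp (E.comp (T.comp C))) w₀ := by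
    intro m c x w₀ C hc hx hC
    obtain ⟨h1, h2⟩ := StratumPatch.hasFDerivAt_lift hθ hx (hc ▸ hzθ) (hc ▸ hW) (hc ▸ hE)
      (hc ▸ hT) hC
    refine ⟨h1, ?_⟩
    have h3 : x w₀ = P.q z := Subtype.ext (by
      rw [← hx.self_of_nhds, hc, P.q_eq z hz])
    have h4 : HasFDerivAt (f ∘ D.chart.symm) G ((D.chart ∘ x) w₀) := by
      rw [Function.comp_apply, h3]
      exact hG.hasFDerivAt
    refine (h4.comp w₀ h1).congr_of_eventuallyEq ?_
    filter_upwards [h2] with w hw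
    simp only [Function.comp_apply, D.chart.left_inv hw]
  -- Translating the lift by κ leaves the path `x` unchanged, so all translates of `C t`, and hence
  -- their average, have the same image in the stratum.
  have h1 : (E.comp T) (A (C t)) = (E.comp T) (C t) := by
    refine hAl _ _ _ fun κ => ?_
    have h2 : HasMFDerivAt (𝓡 m) (𝓡 (𝒳.chart P.U).dim)
        ((fun p : (𝒳.chart P.U).dom => (κ : (𝒳.chart P.U).grp) • p) ∘ c) w₀
        (((𝒳.chart P.U).isotropyRep (P.i z) κ).comp C) := by
      refine HasMFDerivAt.comp (g := fun p : (𝒳.chart P.U).dom => (κ : (𝒳.chart P.U).grp) • p)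
        w₀ ?_ hC
      rw [hc]
      exact (𝒳.chart P.U).hasMFDerivAt_smul (P.i z) κ
    have h3 := (key (c := (fun p : (𝒳.chart P.U).dom => (κ : (𝒳.chart P.U).grp) • p) ∘ c)
      (x := x) (by rw [Function.comp_apply, hc]; exact κ.2)
      (hx.mono fun w hw => ((𝒳.chart P.U).proj_smul _ _).trans hw) h2).1
    exact DFunLike.congr_fun (h3.unique (key hc hx hC).1) t
  obtain ⟨v, hv⟩ : A (C t) ∈ range I := by
    rw [OrbispaceChart.range_eq_fixedSpace P.isLocalParametrization hz hI]
    exact hA _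
  have h4 : ∀ᶠ w in 𝓝 z, (𝒳.chart P.U).proj (P.i w) = P.q w := by
    filter_upwards [P.isLocalParametrization.isOpen.mem_nhds hz] with w hw
    exact (P.q_eq w hw).symm
  have h5 : HasFDerivAt (f ∘ P.q) (G.comp (E.comp (T.comp I))) z := (key rfl h4 hI).2
  have h6 : fderiv ℝ (f ∘ P.q) z v = G ((E.comp T) (I v)) := by
    rw [h5.fderiv]
    rfl
  have h7 : fderiv ℝ (f ∘ x) w₀ t = G ((E.comp T) (C t)) := by
    rw [(key hc hx hC).2.fderiv]
    rfl
  -- The averaged vector is tangent to the isotropy submanifold, where the Hamiltonian equation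
  -- applies. The average can then be dropped, because the Hamiltonian vector is fixed.
  rw [h7, ← h1, ← hv, ← h6, ← (P.isSymplecticOn_form Ω).flatL_hamiltonianField hz,
    P.flatL_form Ω hI, hv]
  refine hAΩ (Ω.invariant P.U) _ ?_ _
  rw [← SetLike.mem_coe, ← OrbispaceChart.range_eq_fixedSpace P.isLocalParametrization hz hI]
  exact mem_range_self _

/-- The brackets on the isotropy submanifolds over a point of a stratum agree. -/
theorem poissonBracket_eq_of_q_eq (hat : ∀ D : 𝒳.StratumPatch S d,
      D.chart ∈ IsManifold.maximalAtlas (𝓡 d) ∞ S) (hS : 𝒳.IsStratum S d)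
    (Ω : 𝒳.SymplecticForm) {P' : 𝒳.ParametrizedProjection S} {z : Euc P.k} (hz : z ∈ P.O)
    {z' : Euc P'.k} (hz' : z' ∈ P'.O) (hzz : P.q z = P'.q z')
    {f g : S → ℝ} (hf : ContMDiff (𝓡 d) 𝓘(ℝ, ℝ) ∞ f) (hg : ContMDiff (𝓡 d) 𝓘(ℝ, ℝ) ∞ g) :
    poissonBracket (P.form Ω) (f ∘ P.q) (g ∘ P.q) z =
      poissonBracket (P'.form Ω) (f ∘ P'.q) (g ∘ P'.q) z' := by
  obtain ⟨θ, hθ, hs, hθz⟩ := Ω.exists_isTransfer (p' := P.i z) (p := P'.i z')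
    (by rw [← P.q_eq z hz, ← P'.q_eq z' hz', hzz])
  obtain ⟨T, T', hT, hT', -, hTT⟩ := hθ.exists_hasMFDerivAt hs
  rw [hθz] at hT'
  obtain ⟨I, hI⟩ := P.exists_hasMFDerivAt_i hz
  obtain ⟨I', hI'⟩ := P'.exists_hasMFDerivAt_i hz'
  have hs' : P'.i z' ∈ θ.target := hθz ▸ θ.map_source hs
  have hθz' : θ.symm (P'.i z') = P.i z := by rw [← hθz, θ.left_inv hs]
  -- The map `θ ∘ P.i` lifts `P.q` to the other chart, possibly leaving the isotropy submanifold
  -- there; `fderiv_comp_lift` permits this.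
  have h1 : ∀ᶠ w in 𝓝 z, (𝒳.chart P'.U).proj ((θ ∘ P.i) w) = P.q w := by
    filter_upwards [P.isLocalParametrization.isOpen.mem_nhds hz,
      hI.continuousAt.eventually_mem (θ.open_source.mem_nhds hs)] with w hw hws
    rw [P.q_eq w hw]
    exact hθ.proj_eq _ hws
  have h2 : ∀ᶠ w in 𝓝 z', (𝒳.chart P.U).proj ((θ.symm ∘ P'.i) w) = P'.q w := by
    filter_upwards [P'.isLocalParametrization.isOpen.mem_nhds hz',
      hI'.continuousAt.eventually_mem (θ.open_target.mem_nhds hs')] with w hw hws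
    rw [P'.q_eq w hw]
    exact hθ.symm.proj_eq _ hws
  have h3 := fderiv_comp_lift hat hS Ω hz' hI' hf hθz h1 (hT.comp z hI)
    (hamiltonianField (P.form Ω) (g ∘ P.q) z)
  have h4 := fderiv_comp_lift hat hS Ω hz hI hg hθz' h2 (hT'.comp z' hI')
    (hamiltonianField (P'.form Ω) (f ∘ P'.q) z')
  have h5 := hθ.flat_eq _ hs T hT (I (hamiltonianField (P.form Ω) (g ∘ P.q) z))
    (T' (I' (hamiltonianField (P'.form Ω) (f ∘ P'.q) z')))
  rw [hTT, hθz] at h5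
  -- One bracket is read as the derivative of `f` along the field of `g`, the other as minus the
  -- derivative of `g` along the field of `f`. Invariance of ω under θ equates them.
  rw [(P.isSymplecticOn_form Ω).poissonBracket_eq hz, h3, TwoForm.flat_swap,
    poissonBracket_swap, (P'.isSymplecticOn_form Ω).poissonBracket_eq hz', h4]
  exact congrArg Neg.neg h5

end ParametrizedProjection

end Orbispace

section Bracket

variable {k : ℕ} {η : Euc k → Euc k [⋀^Fin 2]→L[ℝ] ℝ} {O : Set (Euc k)} {φ φ' ψ ψ' χ : Euc k → ℝ}
  {z : Euc k}

theorem IsSymplecticOn.poissonBracket_add_left (h : IsSymplecticOn η O) (hz : z ∈ O)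
    (hφ : DifferentiableAt ℝ φ z) (hφ' : DifferentiableAt ℝ φ' z) :
    poissonBracket η (φ + φ') ψ z = poissonBracket η φ ψ z + poissonBracket η φ' ψ z := by
  simp only [h.poissonBracket_eq hz, fderiv_add hφ hφ', add_apply]

theorem IsSymplecticOn.poissonBracket_smul_left (h : IsSymplecticOn η O) (hz : z ∈ O)
    (hφ : DifferentiableAt ℝ φ z) (c : ℝ) :
    poissonBracket η (c • φ) ψ z = c * poissonBracket η φ ψ z := by
  simp only [h.poissonBracket_eq hz, fderiv_const_smul hφ c, smul_apply,
    smul_eq_mul]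

theorem IsSymplecticOn.poissonBracket_mul_right (h : IsSymplecticOn η O) (hz : z ∈ O)
    (hψ : DifferentiableAt ℝ ψ z) (hχ : DifferentiableAt ℝ χ z) :
    poissonBracket η φ (ψ * χ) z =
      poissonBracket η φ ψ z * χ z + ψ z * poissonBracket η φ χ z := by
  simp only [poissonBracket_swap φ, h.poissonBracket_eq hz, fderiv_mul hψ hχ,
    add_apply, smul_apply, smul_eq_mul]
  ring

theorem poissonBracket_congr_right (h : ψ =ᶠ[𝓝 z] ψ') :
    poissonBracket η φ ψ z = poissonBracket η φ ψ' z := by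
  simp only [poissonBracket, hamiltonianField, h.fderiv_eq]

end Bracket

/-! ### The Poisson structure of a stratum -/

namespace Orbispace

variable {X : Type u} [TopologicalSpace X] {𝒳 : Orbispace.{u, v, w} X} {S : Set X} {d : ℕ}

/-- The parametrized projections jointly cover `S`, so identities on it can be checked upstairs. -/
theorem IsStratum.ext_q (hS : 𝒳.IsStratum S d) {α : Type*} {f g : S → α}
    (hfg : ∀ (P : 𝒳.ParametrizedProjection S), ∀ z ∈ P.O, f (P.q z) = g (P.q z)) (x : S) :
    f x = g x := by
  obtain ⟨P, z, hz, rfl⟩ := hS.exists_parametrizedProjection x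
  exact hfg P z hz

/-- The bracket of two functions on a stratum. -/
def IsStratum.bracketFun (hS : 𝒳.IsStratum S d) (Ω : 𝒳.SymplecticForm) (f g : S → ℝ) (x : S) : ℝ :=
  poissonBracket ((hS.exists_parametrizedProjection x).choose.form Ω)
    (f ∘ (hS.exists_parametrizedProjection x).choose.q)
    (g ∘ (hS.exists_parametrizedProjection x).choose.q)
    (hS.exists_parametrizedProjection x).choose_spec.choose

variable [ChartedSpace (Euc d) S] [IsManifold (𝓡 d) ∞ S]

/-- Frees the bracket from the choice in its definition, by independence of the parametrized
projection. -/
theorem IsStratum.bracketFun_q (hS : 𝒳.IsStratum S d) (Ω : 𝒳.SymplecticForm)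
    (hat : ∀ D : 𝒳.StratumPatch S d, D.chart ∈ IsManifold.maximalAtlas (𝓡 d) ∞ S)
    {f g : S → ℝ} (hf : ContMDiff (𝓡 d) 𝓘(ℝ, ℝ) ∞ f)
    (hg : ContMDiff (𝓡 d) 𝓘(ℝ, ℝ) ∞ g) (P : 𝒳.ParametrizedProjection S) {z : Euc P.k}
    (hz : z ∈ P.O) :
    hS.bracketFun Ω f g (P.q z) = poissonBracket (P.form Ω) (f ∘ P.q) (g ∘ P.q) z :=
  (ParametrizedProjection.poissonBracket_eq_of_q_eq hat hS Ω
    (hS.exists_parametrizedProjection (P.q z)).choose_spec.choose_spec.1 hz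
    (hS.exists_parametrizedProjection (P.q z)).choose_spec.choose_spec.2 hf hg)

theorem IsStratum.contMDiff_bracketFun (hS : 𝒳.IsStratum S d)
    (h : 𝒳.ProjectionsAreSubmersions S d) (Ω : 𝒳.SymplecticForm)
    (hat : ∀ D : 𝒳.StratumPatch S d, D.chart ∈ IsManifold.maximalAtlas (𝓡 d) ∞ S)
    {f g : S → ℝ} (hf : ContMDiff (𝓡 d) 𝓘(ℝ, ℝ) ∞ f) (hg : ContMDiff (𝓡 d) 𝓘(ℝ, ℝ) ∞ g) :
    ContMDiff (𝓡 d) 𝓘(ℝ, ℝ) ∞ (hS.bracketFun Ω f g) := by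
  refine h.contMDiff_of_comp hS fun P => contMDiffOn_iff_contDiffOn.2 ?_
  exact ((P.isSymplecticOn_form Ω).contDiffOn_poissonBracket P.isLocalParametrization.isOpen
    (P.contDiffOn_comp_q h hf) (P.contDiffOn_comp_q h hg)).congr
    fun z hz => hS.bracketFun_q Ω hat hf hg P hz

theorem ParametrizedProjection.differentiableAt_comp_q (P : 𝒳.ParametrizedProjection S)
    (h : 𝒳.ProjectionsAreSubmersions S d) {f : S → ℝ} (hf : ContMDiff (𝓡 d) 𝓘(ℝ, ℝ) ∞ f)
    {z : Euc P.k} (hz : z ∈ P.O) : DifferentiableAt ℝ (f ∘ P.q) z :=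
  ((P.contDiffOn_comp_q h hf).contDiffAt
    (P.isLocalParametrization.isOpen.mem_nhds hz)).differentiableAt (by simp)

section

variable (hS : 𝒳.IsStratum S d) (h : 𝒳.ProjectionsAreSubmersions S d)
    (hat : ∀ D : 𝒳.StratumPatch S d, D.chart ∈ IsManifold.maximalAtlas (𝓡 d) ∞ S)
    (Ω : 𝒳.SymplecticForm)

/-- The bracket of two smooth functions on a stratum. -/
def IsStratum.bracket (f g : C^∞⟮𝓡 d, S; 𝓘(ℝ, ℝ), ℝ⟯) : C^∞⟮𝓡 d, S; 𝓘(ℝ, ℝ), ℝ⟯ :=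
  ⟨hS.bracketFun Ω f g, hS.contMDiff_bracketFun h Ω hat f.contMDiff g.contMDiff⟩

theorem IsStratum.bracket_q (f g : C^∞⟮𝓡 d, S; 𝓘(ℝ, ℝ), ℝ⟯) (P : 𝒳.ParametrizedProjection S)
    {z : Euc P.k} (hz : z ∈ P.O) :
    hS.bracket h hat Ω f g (P.q z) = poissonBracket (P.form Ω) (f ∘ P.q) (g ∘ P.q) z :=
  hS.bracketFun_q Ω hat f.contMDiff g.contMDiff P hz

theorem IsStratum.bracket_antisymm (f g : C^∞⟮𝓡 d, S; 𝓘(ℝ, ℝ), ℝ⟯) :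
    hS.bracket h hat Ω f g = -hS.bracket h hat Ω g f := by
  ext1 x
  revert x
  refine hS.ext_q fun P z hz => ?_
  rw [ContMDiffMap.coe_neg, Pi.neg_apply, hS.bracket_q h hat Ω _ _ P hz,
    hS.bracket_q h hat Ω _ _ P hz, poissonBracket_swap]

theorem IsStratum.bracket_add_left (f f' g : C^∞⟮𝓡 d, S; 𝓘(ℝ, ℝ), ℝ⟯) :
    hS.bracket h hat Ω (f + f') g = hS.bracket h hat Ω f g + hS.bracket h hat Ω f' g := by
  ext1 x
  revert x
  refine hS.ext_q fun P z hz => ?_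
  rw [ContMDiffMap.coe_add, Pi.add_apply, hS.bracket_q h hat Ω _ _ P hz,
    hS.bracket_q h hat Ω _ _ P hz, hS.bracket_q h hat Ω _ _ P hz]
  exact (P.isSymplecticOn_form Ω).poissonBracket_add_left hz
    (P.differentiableAt_comp_q h f.contMDiff hz) (P.differentiableAt_comp_q h f'.contMDiff hz)

theorem IsStratum.bracket_smul_left (c : ℝ) (f g : C^∞⟮𝓡 d, S; 𝓘(ℝ, ℝ), ℝ⟯) :
    hS.bracket h hat Ω (c • f) g = c • hS.bracket h hat Ω f g := by
  ext1 x
  revert x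
  refine hS.ext_q fun P z hz => ?_
  rw [ContMDiffMap.coe_smul, Pi.smul_apply, hS.bracket_q h hat Ω _ _ P hz,
    hS.bracket_q h hat Ω _ _ P hz]
  exact (P.isSymplecticOn_form Ω).poissonBracket_smul_left hz
    (P.differentiableAt_comp_q h f.contMDiff hz) c

/-- The Poisson structure of a stratum. -/
def IsStratum.poissonStructure : PoissonStructure d S where
  bracket := LinearMap.mk₂ ℝ (hS.bracket h hat Ω) (hS.bracket_add_left h hat Ω)
    (hS.bracket_smul_left h hat Ω)
    (fun f g g' => by
      rw [hS.bracket_antisymm, hS.bracket_add_left, hS.bracket_antisymm h hat Ω f g,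
        hS.bracket_antisymm h hat Ω f g', neg_add])
    (fun c f g => by
      rw [hS.bracket_antisymm, hS.bracket_smul_left, hS.bracket_antisymm h hat Ω f g, smul_neg])
  antisymm := hS.bracket_antisymm h hat Ω
  leibniz f g g' := by
    simp only [LinearMap.mk₂_apply]
    ext1 x
    revert x
    refine hS.ext_q fun P z hz => ?_
    rw [ContMDiffMap.coe_add, Pi.add_apply, ContMDiffMap.coe_mul, ContMDiffMap.coe_mul,
      Pi.mul_apply, Pi.mul_apply, hS.bracket_q h hat Ω _ _ P hz, hS.bracket_q h hat Ω _ _ P hz,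
      hS.bracket_q h hat Ω _ _ P hz]
    exact (P.isSymplecticOn_form Ω).poissonBracket_mul_right hz
      (P.differentiableAt_comp_q h g.contMDiff hz) (P.differentiableAt_comp_q h g'.contMDiff hz)
  jacobi f g g' := by
    simp only [LinearMap.mk₂_apply]
    ext1 x
    revert x
    refine hS.ext_q fun P z hz => ?_
    have key : ∀ f g g' : C^∞⟮𝓡 d, S; 𝓘(ℝ, ℝ), ℝ⟯,
        hS.bracket h hat Ω f (hS.bracket h hat Ω g g') (P.q z) =
          poissonBracket (P.form Ω) (f ∘ P.q)
            (poissonBracket (P.form Ω) (g ∘ P.q) (g' ∘ P.q)) z := by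
      intro f g g'
      rw [hS.bracket_q h hat Ω _ _ P hz]
      exact poissonBracket_congr_right (Filter.eventually_of_mem
        (P.isLocalParametrization.isOpen.mem_nhds hz) fun _ hz' =>
          hS.bracket_q h hat Ω g g' P hz')
    rw [ContMDiffMap.coe_add, Pi.add_apply, ContMDiffMap.coe_add, Pi.add_apply, key, key, key]
    exact (P.isSymplecticOn_form Ω).jacobi P.isLocalParametrization.isOpen hz
      (P.contDiffOn_comp_q h f.contMDiff) (P.contDiffOn_comp_q h g.contMDiff)
      (P.contDiffOn_comp_q h g'.contMDiff)

theorem IsStratum.inducesPoisson :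
    Ω.InducesPoisson S d (hS.poissonStructure h hat Ω) := fun P f g _ hz =>
  ((P.isSymplecticOn_form Ω).isBracketValue_iff hz).2 (hS.bracket_q h hat Ω f g P hz)

theorem IsStratum.poissonStructure_unique {B : PoissonStructure d S}
    (hB : Ω.InducesPoisson S d B) : B = hS.poissonStructure h hat Ω := by
  refine PoissonStructure.ext ?_
  refine LinearMap.ext fun f => LinearMap.ext fun g => ?_
  ext1 x
  revert x
  refine hS.ext_q fun P z hz => ?_
  have h1 := ((P.isSymplecticOn_form Ω).isBracketValue_iff hz).1 (hB P f g z hz)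
  exact h1.trans (hS.bracket_q h hat Ω f g P hz).symm

end

end Orbispace

/-! ### The symplectic form on a stratum of an orbifold -/

theorem IsSymplecticOn.congr {n : ℕ} {η η' : Euc n → Euc n [⋀^Fin 2]→L[ℝ] ℝ} {O : Set (Euc n)}
    (h : IsSymplecticOn η O) (hO : IsOpen O) (heq : ∀ z ∈ O, η' z = η z) : IsSymplecticOn η' O where
  smooth := h.smooth.congr heq
  closed z hz := by
    have h1 : η' =ᶠ[𝓝 z] η := Filter.eventually_of_mem (hO.mem_nhds hz) heq
    rw [h1.extDeriv_eq, h.closed z hz]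
  nondegenerate z hz := by
    rw [heq z hz]
    exact h.nondegenerate z hz

namespace Orbispace

variable {X : Type u} [TopologicalSpace X] {𝒳 : Orbispace.{u, v, w} X} {S : Set X} {d : ℕ}

theorem IsOrbifold.gdim_eq_zero (hX : 𝒳.IsOrbifold) (U : 𝒳.Obj) : (𝒳.chart U).gdim = 0 :=
  have := hX U
  (𝒳.chart U).gdim_eq_zero_of_finite

/-- In an orbifold, the inverses of the charts of the strata are projections of local
parametrizations of isotropy submanifolds. -/
def StratumPatch.parametrizedProjection (D : 𝒳.StratumPatch S d) (hX : 𝒳.IsOrbifold) :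
    𝒳.ParametrizedProjection S where
  U := D.U
  H := _
  k := d
  O := D.σ.O
  i := D.σ.j
  isLocalParametrization := D.σ.isLocalParametrization (hX.gdim_eq_zero D.U)
  q := D.chart.symm
  q_eq _ hu := D.chart_symm_apply hu

variable [ChartedSpace (Euc d) S]

/-- The form on a stratum of an orbifold induced by the forms on the isotropy submanifolds. -/
def IsStratum.form (hS : 𝒳.IsStratum S d) (Ω : 𝒳.SymplecticForm) : TwoForm d S := fun x =>
  TwoForm.pullback (hS.exists_patch x).choose.chart
    (TwoForm.pullback (m := d) (hS.exists_patch x).choose.σ.j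
      (Ω.form (hS.exists_patch x).choose.U)) x

variable [IsManifold (𝓡 d) ∞ S]

/-- For finite groups `s` inverts `j` over `S`, so the transferred parametrization `θ ∘ P.i`
coincides near `z` with `j` after the chart of `P.q`. As θ preserves ω, the two pullbacks agree. -/
theorem IsStratum.inducesForm (hS : 𝒳.IsStratum S d) (h : 𝒳.ProjectionsAreSubmersions S d)
    (hat : ∀ D : 𝒳.StratumPatch S d, D.chart ∈ atlas (Euc d) S)
    (hX : 𝒳.IsOrbifold) (Ω : 𝒳.SymplecticForm) : Ω.InducesForm S d (hS.form Ω) := by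
  intro P z hz
  set D := (hS.exists_patch (P.q z)).choose with hDdef
  have hzs : P.q z ∈ D.chart.source :=
    D.mem_chart_source_of_proj_y (hS.exists_patch (P.q z)).choose_spec
  obtain ⟨θ, hθ, hzθ, hθz, hO, hW⟩ := D.exists_transfer Ω (P.q_eq z hz).symm hzs
  obtain ⟨T, -, hT, -⟩ := hθ.exists_hasMFDerivAt hzθ
  obtain ⟨J, hJ⟩ := D.σ.smooth_j.exists_hasMFDerivAt D.σ.isOpen_O hO
  obtain ⟨E, -, hE, -⟩ := hasMFDerivAt_atlas (hat D) hzs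
  obtain ⟨I, hI⟩ := P.exists_hasMFDerivAt_i hz
  obtain ⟨Q, hQ, -⟩ := h.exists_hasMFDerivAt P hz
  have h1 : θ ∘ P.i =ᶠ[𝓝 z] D.σ.j ∘ D.chart ∘ P.q := by
    have h2 : ∀ᶠ w in 𝓝 z, P.i w ∈ θ.source ∩ θ ⁻¹' D.σ.W :=
      hI.continuousAt.eventually_mem ((θ.isOpen_inter_preimage D.σ.isOpen_W).mem_nhds ⟨hzθ, hW⟩)
    filter_upwards [h2, P.isLocalParametrization.isOpen.mem_nhds hz] with w hw hwO
    have h3 := (P.q_eq w hwO).symm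
    simp only [Function.comp_apply]
    rw [(StratumPatch.chart_eq hθ h3 hw.1 hw.2).2]
    refine (D.σ.j_s (hX.gdim_eq_zero D.U) _ hw.2 ?_).symm
    rw [hθ.proj_eq _ hw.1, h3]
    exact (P.q w).2
  have h4 : HasMFDerivAt (𝓡 P.k) (𝓡 (𝒳.chart D.U).dim) (D.σ.j ∘ D.chart ∘ P.q) z
      (J.comp (E.comp Q)) := HasMFDerivAt.comp (g := D.σ.j) z hJ (hE.comp z hQ)
  have h5 : T.comp I = J.comp (E.comp Q) :=
    hasMFDerivAt_unique (hT.comp z hI) (h4.congr_of_eventuallyEq h1)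
  refine TwoForm.ext_flat (n := P.k) fun a b => ?_
  have h6 := (hS.form Ω).flat_pullback hQ a b
  have h7 := TwoForm.flat_pullback (TwoForm.pullback (m := d) D.σ.j (Ω.form D.U)) hE (Q a) (Q b)
  have h8 := (Ω.form D.U).flat_pullback hJ (E (Q a)) (E (Q b))
  have h9 := (Ω.form P.U).flat_pullback hI a b
  have h10 := hθ.flat_eq _ hzθ T hT (I a) (I b)
  have h11 : ∀ a, T (I a) = J (E (Q a)) := fun a => DFunLike.congr_fun h5 a
  rw [h11, h11, hθz] at h10
  exact h6.trans (h7.trans (h8.trans (h10.trans h9.symm)))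

theorem SymplecticForm.InducesForm.flat_eq {Ω : 𝒳.SymplecticForm} {σ : TwoForm d S}
    (hσ : Ω.InducesForm S d σ) {P : 𝒳.ParametrizedProjection S} {z : Euc P.k} (hz : z ∈ P.O)
    {Q : Euc P.k →L[ℝ] Euc d} (hQ : HasMFDerivAt (𝓡 P.k) (𝓡 d) P.q z Q) (a b : Euc P.k) :
    σ.flat (P.q z) (Q a) (Q b) = flatL (P.form Ω z) a b := by
  rw [← σ.flat_pullback hQ]
  exact congrArg (fun η : Euc P.k [⋀^Fin 2]→L[ℝ] ℝ => flatL η a b) (hσ P z hz)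

/-- By surjectivity of the derivatives, every pair of tangent vectors of `S` comes from some `M_H`.
-/
theorem SymplecticForm.InducesForm.unique (hS : 𝒳.IsStratum S d)
    (h : 𝒳.ProjectionsAreSubmersions S d) {Ω : 𝒳.SymplecticForm} {σ σ' : TwoForm d S}
    (hσ : Ω.InducesForm S d σ) (hσ' : Ω.InducesForm S d σ') : σ = σ' := by
  funext x
  obtain ⟨P, z, hz, rfl⟩ := hS.exists_parametrizedProjection x
  obtain ⟨Q, hQ, hQs⟩ := h.exists_hasMFDerivAt P hz
  refine TwoForm.ext_flat fun a b => ?_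
  obtain ⟨a, rfl⟩ := hQs a
  obtain ⟨b, rfl⟩ := hQs b
  rw [hσ.flat_eq hz hQ, hσ'.flat_eq hz hQ]

/-- Inverse patch charts are themselves parametrized projections, so in each chart σ is the
restricted form on an isotropy submanifold. -/
theorem SymplecticForm.InducesForm.isSymplecticForm {Ω : 𝒳.SymplecticForm} {σ : TwoForm d S}
    (hσ : Ω.InducesForm S d σ)
    (hat : ∀ e ∈ atlas (Euc d) S, ∃ D : 𝒳.StratumPatch S d, e = D.chart)
    (hX : 𝒳.IsOrbifold) : IsSymplecticForm σ := by
  intro e he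
  obtain ⟨D, rfl⟩ := hat e he
  exact ((D.parametrizedProjection hX).isSymplecticOn_form Ω).congr D.σ.isOpen_O
    fun z hz => hσ (D.parametrizedProjection hX) z hz

/-- The derivative of the projection is onto and intertwines the forms, so it sends Hamiltonian
vectors upstairs to Hamiltonian vectors of σ. -/
theorem SymplecticForm.InducesForm.isBracketValue (hS : 𝒳.IsStratum S d)
    (h : 𝒳.ProjectionsAreSubmersions S d) {Ω : 𝒳.SymplecticForm} {σ : TwoForm d S}
    (hσ : Ω.InducesForm S d σ) {B : PoissonStructure d S} (hB : Ω.InducesPoisson S d B)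
    (f g : C^∞⟮𝓡 d, S; 𝓘(ℝ, ℝ), ℝ⟯) (x : S) : IsBracketValue σ f g x (B.bracket f g x) := by
  obtain ⟨P, z, hz, rfl⟩ := hS.exists_parametrizedProjection x
  obtain ⟨Q, hQ, hQs⟩ := h.exists_hasMFDerivAt P hz
  have h1 := ((P.isSymplecticOn_form Ω).isBracketValue_iff hz).1 (hB P f g z hz)
  have key : ∀ f : C^∞⟮𝓡 d, S; 𝓘(ℝ, ℝ), ℝ⟯, ∀ t : Euc d,
      σ.flat (P.q z) (Q (hamiltonianField (P.form Ω) (f ∘ P.q) z)) t =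
        (mfderiv (𝓡 d) 𝓘(ℝ, ℝ) f (P.q z) t : ℝ) := by
    intro f t
    obtain ⟨t, rfl⟩ := hQs t
    rw [hσ.flat_eq hz hQ, (P.isSymplecticOn_form Ω).flatL_hamiltonianField hz]
    have h2 : MDifferentiableAt (𝓡 d) 𝓘(ℝ, ℝ) f (P.q z) :=
      f.contMDiff.contMDiffAt.mdifferentiableAt (by simp)
    obtain ⟨F, hF⟩ : ∃ F : Euc d →L[ℝ] ℝ, HasMFDerivAt (𝓡 d) 𝓘(ℝ, ℝ) f (P.q z) F :=
      ⟨_, h2.hasMFDerivAt⟩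
    have h3 : HasFDerivAt (f ∘ P.q) (F.comp Q) z := hasMFDerivAt_iff_hasFDerivAt.1 (hF.comp z hQ)
    rw [h3.fderiv, hF.mfderiv]
    rfl
  refine ⟨Q (hamiltonianField (P.form Ω) (f ∘ P.q) z), Q (hamiltonianField (P.form Ω) (g ∘ P.q) z),
    key f, key g, ?_⟩
  rw [h1]
  exact (hσ.flat_eq hz hQ _ _).symm

end Orbispace

end

/-! ### The main theorem -/

theorem mainTheorem7 {X : Type u} [TopologicalSpace X] [T2Space X] [SecondCountableTopology X]
    [LocallyConnectedSpace X] [ParacompactSpace X]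
    (𝒳 : Orbispace.{u, v, w} X) (Ω : 𝒳.SymplecticForm) :
    -- every `M_H` is a symplectic submanifold
    (∀ (U : 𝒳.Obj) (H : Subgroup (𝒳.chart U).grp),
      IsEmbeddedSubmanifold (𝒳.chart U).dim ((𝒳.chart U).isotropySet H) ∧
      RestrictsToSymplectic (Ω.form U) ((𝒳.chart U).isotropySet H)) ∧
    ∀ (S : Set X) (d : ℕ), 𝒳.IsStratum S d →
      -- `S` has a unique smooth structure for which all projections `M_H ∩ proj⁻¹ S → S` are
      -- smooth submersions
      ∃ (c : ChartedSpace (Euc d) S) (_ : IsManifold (𝓡 d) ∞ S),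
        𝒳.ProjectionsAreSubmersions S d ∧
        (∀ c' : ChartedSpace (Euc d) S, @IsManifold ℝ _ _ _ _ _ _ (𝓡 d) ∞ S _ c' →
          @Orbispace.ProjectionsAreSubmersions X _ 𝒳 S d c' →
          @IsManifold.maximalAtlas ℝ _ _ _ _ _ _ (𝓡 d) ∞ S _ c' =
            @IsManifold.maximalAtlas ℝ _ _ _ _ _ _ (𝓡 d) ∞ S _ c) ∧
        -- and a unique Poisson structure induced by the symplectic structures of the `M_H`,
        ∃ B : PoissonStructure d S, Ω.InducesPoisson S d B ∧
          (∀ B' : PoissonStructure d S, Ω.InducesPoisson S d B' → B' = B) ∧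
          -- which in the case of an orbifold comes from a symplectic form on `S`
          (𝒳.IsOrbifold → ∃! σ : TwoForm d S, IsSymplecticForm σ ∧ Ω.InducesForm S d σ ∧
            ∀ (f g : C^∞⟮𝓡 d, S; 𝓘(ℝ, ℝ), ℝ⟯) (x : S),
              IsBracketValue σ f g x (B.bracket f g x)) := by
  refine ⟨fun U H => ⟨(𝒳.chart U).isEmbeddedSubmanifold_isotropySet H,
    OrbispaceChart.restrictsToSymplectic_isotropySet (Ω.symplectic U) (Ω.invariant U) H⟩,
    fun S d hS => ?_⟩
  let c := hS.chartedSpace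
  have hM : IsManifold (𝓡 d) ∞ S := hS.isManifold Ω
  have h := hS.projectionsAreSubmersions Ω
  have hat : ∀ D : 𝒳.StratumPatch S d, D.chart ∈ atlas (Euc d) S := fun D => mem_range_self D
  have hmax : ∀ D : 𝒳.StratumPatch S d, D.chart ∈ IsManifold.maximalAtlas (𝓡 d) ∞ S :=
    fun D => IsManifold.subset_maximalAtlas (hat D)
  have hB := hS.inducesPoisson h hmax Ω
  refine ⟨c, hM, h, fun c' hM' h' => hS.maximalAtlas_eq c c' hM hM' h h',
    hS.poissonStructure h hmax Ω, hB, fun B' hB' => hS.poissonStructure_unique h hmax Ω hB',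
    fun hX => ?_⟩
  have hσ := hS.inducesForm h hat hX Ω
  refine ⟨hS.form Ω, ⟨hσ.isSymplecticForm (fun e he => ?_) hX, hσ, fun f g x =>
    hσ.isBracketValue hS h hB f g x⟩, fun σ' hσ' => hσ'.2.1.unique hS h hσ⟩
  obtain ⟨D, rfl⟩ := he
  exact ⟨D, rfl⟩
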